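/- **Setting.** Let $p$ be a prime, $K$ a complete discretely valued field of mixed characteristic $(0,p)$ with perfect residue field $k$, and $E\subseteq K$ a finite extension of $\mathbf{Q}_p$ with uniformizer $\pi$ and residue field $\mathbf{F}_q$. Let $W=W_{\mathcal{O}_E}(k)\subseteq\mathcal{O}_K$ be the ring of ramified Witt vectors (the complete discrete valuation ring over $\mathcal{O}_E$ inside $\mathcal{O}_K$ with uniformizer $\pi$ and residue field $k$), $\varphi_q$ its $\mathcal{O}_E$-linear lift of the $q$-power Frobenius, and $K_{0}=W[1/\pi]$. Fix a uniformizer $\pi_K$ of $K$, let $E(u)\in W[u]$ be its Eisenstein polynomial over $K_0$, of degree $e$, and put $\mathfrak{S}=W[[u]]$, $I=(E(u))\subset\mathfrak{S}$, $\varphi_q(u)=u^q$. Let $\mathfrak{S}\langle I/\pi\rangle$ be the $\pi$-adic completion of $\mathfrak{S}[I/\pi]$ and $$R=\mathfrak{S}\langle I/\pi\rangle[1/\pi]=K_0\langle u^e/\pi\rangle\subset K_0[[u]].$$ The Frobenius $\varphi_q$ extends to $R$, and $\varphi_q(E(u))$ is a unit in $R$, so $\varphi_q$ extends to $R[1/I]$.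 Let $\widehat{\mathfrak{S}}_0=R^{\wedge}_I$ and $\mathrm{Fr}(\widehat{\mathfrak{S}}_0)=\widehat{\mathfrak{S}}_0[1/E(u)]$. * $\mathrm{HP}^{\varphi_q}(K)$ is the category of triples $(D,\varphi_D,\Lambda)$, where $D$ is a finite-dimensional $K_0$-vector space, $\varphi_D:\varphi_q^*D\simeq D$ is a linear isomorphism and $\Lambda$ is an $\widehat{\mathfrak{S}}_0$-lattice in $D\otimes_{K_0}\mathrm{Fr}(\widehat{\mathfrak{S}}_0)$. Morphisms are the linear maps that commute with the Frobenius maps and map the lattice into the lattice. * $\mathrm{Vect}^{\varphi_q}(R)$ is the category of finite projective $R$-modules $M$ with an $R[1/I]$-linear isomorphism $\varphi_M:(\varphi_q^*M)[1/I]\simeq M[1/I]$. Morphisms are the $R$-linear maps that commute with the Frobenius maps. **The functor $\mathcal{M}(\cdot)$.** For $(D,\varphi_D,\Lambda)$, the module $\mathcal{M}(D)$ is the Beauville–Laszlo glueing of $D\otimes_{K_0}R[1/I]$ and $\Lambda$, i.e. the $R$-submodule of $D\otimes_{K_0}R[1/I]$ of the elements whose image in $D\otimes_{K_0}\mathrm{Fr}(\widehat{\mathfrak{S}}_0)$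 lies in $\Lambda$. Its Frobenius is the one that corresponds to $\varphi_D\otimes\varphi_q$ on $D\otimes_{K_0}R[1/I]$. **The functor $D(\cdot)$.** For $M\in\mathrm{Vect}^{\varphi_q}(R)$, the isocrystal $D(M)=M\otimes_{R,\,u\mapsto0}K_0$ carries the Frobenius induced by $\varphi_M$. Its lattice is $M\otimes_R\widehat{\mathfrak{S}}_0=M^\wedge_I$, transported to $D(M)\otimes_{K_0}\mathrm{Fr}(\widehat{\mathfrak{S}}_0)$ along an $R[1/I]$-linear $\varphi_q$-equivariant map $\xi:D(M)\otimes_{K_0}R[1/I]\to M[1/I]$ that lifts the identity modulo $u$. **Theorem.** For every $M\in\mathrm{Vect}^{\varphi_q}(R)$ there is exactly one such map $\xi$. The two constructions above are well-defined functors $$\mathcal{M}(\cdot):\mathrm{HP}^{\varphi_q}(K)\to\mathrm{Vect}^{\varphi_q}(R),\qquad D(\cdot):\mathrm{Vect}^{\varphi_q}(R)\to\mathrm{HP}^{\varphi_q}(K),$$ and they are mutually inverse equivalences of categories. -/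

import Mathlib

open scoped TensorProduct Polynomial PowerSeries

universe u v w

namespace BreuilKisin

section BaseChange

variable {A B C : Type*} [CommRing A] [CommRing B] [CommRing C]

/-- The semilinear map `B ⊗[A] M → N`, `b ⊗ m ↦ τ b • g m`. -/
noncomputable def semilinearLift [Algebra A B] {M N : Type*} [AddCommGroup M] [Module A M]
    [AddCommGroup N] [Module C N] (τ : B →+* C) {σ : A →+* C}
    (h : ∀ a, τ (algebraMap A B a) = σ a) (g : M →ₛₗ[σ] N) : B ⊗[A] M →ₛₗ[τ] N where
  toFun := TensorProduct.liftAddHom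
    (AddMonoidHom.mk' (fun b => AddMonoidHom.mk' (fun m => τ b • g m)
        (fun x y => by rw [map_add, smul_add]))
      (fun x y => by ext m; exact (by rw [map_add, add_smul] :
        τ (x + y) • g m = τ x • g m + τ y • g m)))
    (fun a b m => by
      change τ (a • b) • g m = τ b • g (a • m)
      rw [Algebra.smul_def, map_mul, h, map_smulₛₗ, smul_smul, mul_comm])
  map_add' := map_add _
  map_smul' := by
    intro b x
    induction x with
    | zero => rw [smul_zero, map_zero, smul_zero]
    | add x y hx hy => rw [smul_add, map_add, hx, hy, map_add, smul_add]
    | tmul c m =>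
      rw [TensorProduct.smul_tmul', TensorProduct.liftAddHom_tmul, TensorProduct.liftAddHom_tmul]
      change τ (b * c) • g m = τ b • τ c • g m
      rw [map_mul, mul_smul]

@[simp] theorem semilinearLift_tmul [Algebra A B] {M N : Type*} [AddCommGroup M] [Module A M]
    [AddCommGroup N] [Module C N] (τ : B →+* C) {σ : A →+* C}
    (h : ∀ a, τ (algebraMap A B a) = σ a) (g : M →ₛₗ[σ] N) (b : B) (m : M) :
    semilinearLift τ h g (b ⊗ₜ m) = τ b • g m := rfl

/-- The `B`-module structure of `B ⊗[A] M`. -/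
noncomputable abbrev baseChangeModule (A B : Type*) [CommRing A] [CommRing B] [Algebra A B]
    (M : Type*) [AddCommGroup M] [Module A M] : Module B (B ⊗[A] M) :=
  inferInstance

/-- `Pullback f M = B ⊗_{A, f} M`, the base change of an `A`-module along a ring map `f : A → B`. -/
def Pullback (f : A →+* B) (M : Type*) [AddCommGroup M] [Module A M] : Type _ :=
  @TensorProduct A _ B M _ _ f.toAlgebra.toModule _

namespace Pullback

variable (f : A →+* B) (M : Type*) [AddCommGroup M] [Module A M]

noncomputable instance : AddCommGroup (Pullback f M) :=
  @TensorProduct.addCommGroup A _ B M _ _ f.toAlgebra.toModule _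

noncomputable instance : Module B (Pullback f M) :=
  @baseChangeModule A B _ _ f.toAlgebra M _ _

variable {M}

/-- The canonical `f`-semilinear map `M → f^* M`, `m ↦ 1 ⊗ m`. -/
noncomputable def unit : M →ₛₗ[f] Pullback f M where
  toFun m := @TensorProduct.tmul A _ B M _ _ f.toAlgebra.toModule _ 1 m
  map_add' _ _ := @TensorProduct.tmul_add A _ B M _ _ f.toAlgebra.toModule _ _ _ _
  map_smul' a x := by
    let := f.toAlgebra
    change ((1 : B) ⊗ₜ[A] (a • x) : B ⊗[A] M) = f a • ((1 : B) ⊗ₜ[A] x : B ⊗[A] M)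
    rw [TensorProduct.tmul_smul, TensorProduct.smul_tmul', TensorProduct.smul_tmul',
      Algebra.smul_def, smul_eq_mul]
    rfl

variable {f}

/-- The `τ`-semilinear map `f^* M → N`, `b ⊗ m ↦ τ b • g m`. -/
noncomputable def lift {N : Type*} [AddCommGroup N] [Module C N] (τ : B →+* C) {σ : A →+* C}
    (h : ∀ a, τ (f a) = σ a) (g : M →ₛₗ[σ] N) : Pullback f M →ₛₗ[τ] N :=
  @semilinearLift A B C _ _ _ f.toAlgebra M N _ _ _ _ τ σ h g

@[simp] theorem lift_unit {N : Type*} [AddCommGroup N] [Module C N] (τ : B →+* C) {σ : A →+* C}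
    (h : ∀ a, τ (f a) = σ a) (g : M →ₛₗ[σ] N) (m : M) : lift τ h g (unit f m) = g m := by
  have := @semilinearLift_tmul A B C _ _ _ f.toAlgebra M N _ _ _ _ τ σ h g 1 m
  rw [map_one, one_smul] at this
  exact this

end Pullback

end BaseChange
section Disc

variable {W : Type u} [CommRing W]

/-- The power series `∑ aₙ uⁿ` over `K₀ = Frac W` that converge on the closed disc `|u|ᵉ ≤ |ϖ|`: for every
`N`, all but finitely many of the elements `aₙ ϖ^⌊n/e⌋` lie in `ϖᴺ W`. -/
def IsConvergent (ϖ : W) (e : ℕ) (f : (FractionRing W)⟦X⟧) : Prop :=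
  ∀ N : ℕ, ∃ n₀ : ℕ, ∀ n ≥ n₀, ∃ w : W,
    PowerSeries.coeff n f * algebraMap W (FractionRing W) ϖ ^ (n / e) = algebraMap W (FractionRing W) (ϖ ^ N * w)

theorem IsConvergent.add {ϖ : W} {e : ℕ} {f g : (FractionRing W)⟦X⟧}
    (hf : IsConvergent ϖ e f) (hg : IsConvergent ϖ e g) : IsConvergent ϖ e (f + g) := by
  intro N
  obtain ⟨n₁, h₁⟩ := hf N
  obtain ⟨n₂, h₂⟩ := hg N
  refine ⟨max n₁ n₂, fun n hn => ?_⟩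
  obtain ⟨a, ha⟩ := h₁ n (le_trans (le_max_left _ _) hn)
  obtain ⟨b, hb⟩ := h₂ n (le_trans (le_max_right _ _) hn)
  exact ⟨a + b, by rw [map_add, add_mul, ha, hb, ← map_add, mul_add]⟩

theorem isConvergent_of_coeff_eq_zero (ϖ : W) (e : ℕ) {f : (FractionRing W)⟦X⟧} (n₀ : ℕ)
    (h : ∀ n ≥ n₀, PowerSeries.coeff n f = 0) : IsConvergent ϖ e f :=
  fun _ => ⟨n₀, fun n hn => ⟨0, by rw [h n hn]; simp⟩⟩

variable [IsDomain W] [IsDiscreteValuationRing W]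

/-- Every fraction becomes integral after multiplication by a power of a uniformizer. -/
theorem exists_pow_mul_integral {ϖ : W} (hϖ : Irreducible ϖ) (x : FractionRing W) :
    ∃ (C : ℕ) (w : W), x * algebraMap W (FractionRing W) ϖ ^ C = algebraMap W (FractionRing W) w := by
  obtain ⟨a, b, hb, rfl⟩ := IsFractionRing.div_surjective (A := W) x
  have hb0 : b ≠ 0 := nonZeroDivisors.ne_zero hb
  obtain ⟨n, u, rfl⟩ := IsDiscreteValuationRing.eq_unit_mul_pow_irreducible hb0 hϖ
  refine ⟨n, a * ((u⁻¹ : Wˣ) : W), ?_⟩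
  have h1 : algebraMap W (FractionRing W) ((u : W) * ϖ ^ n) ≠ 0 := by
    simpa using hb0
  rw [div_mul_eq_mul_div, div_eq_iff h1, ← map_pow, ← map_mul, ← map_mul]
  congr 1
  have : (u : W) * ((u⁻¹ : Wˣ) : W) = 1 := by simp
  linear_combination (-a * ϖ ^ n) * this

theorem IsConvergent.bounded {ϖ : W} (hϖ : Irreducible ϖ) {e : ℕ} {f : (FractionRing W)⟦X⟧}
    (hf : IsConvergent ϖ e f) : ∃ C : ℕ, ∀ n, ∃ w : W,
      PowerSeries.coeff n f * algebraMap W (FractionRing W) ϖ ^ (n / e) * algebraMap W (FractionRing W) ϖ ^ C =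
        algebraMap W (FractionRing W) w := by
  obtain ⟨n₀, h₀⟩ := hf 0
  choose c w hc using fun n => exists_pow_mul_integral hϖ
    (PowerSeries.coeff n f * algebraMap W (FractionRing W) ϖ ^ (n / e))
  refine ⟨∑ i ∈ Finset.range n₀, c i, fun n => ?_⟩
  by_cases hn : n < n₀
  · have hle : c n ≤ ∑ i ∈ Finset.range n₀, c i :=
      Finset.single_le_sum (f := c) (fun _ _ => Nat.zero_le _) (Finset.mem_range.2 hn)
    obtain ⟨d, hd⟩ := Nat.exists_eq_add_of_le hle
    exact ⟨w n * ϖ ^ d, by rw [hd, pow_add, ← mul_assoc, hc, map_mul, map_pow]⟩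
  · obtain ⟨v, hv⟩ := h₀ n (not_lt.1 hn)
    exact ⟨v * ϖ ^ (∑ i ∈ Finset.range n₀, c i), by
      rw [hv, pow_zero, one_mul, map_mul, map_pow]⟩

theorem IsConvergent.mul {ϖ : W} (hϖ : Irreducible ϖ) {e : ℕ} {f g : (FractionRing W)⟦X⟧}
    (hf : IsConvergent ϖ e f) (hg : IsConvergent ϖ e g) : IsConvergent ϖ e (f * g) := by
  obtain ⟨C, hC⟩ := hf.bounded hϖ
  obtain ⟨C', hC'⟩ := hg.bounded hϖ
  have hϖ0 : algebraMap W (FractionRing W) ϖ ≠ 0 := by simpa using hϖ.ne_zero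
  intro N
  obtain ⟨n₁, h₁⟩ := hf (N + C')
  obtain ⟨n₂, h₂⟩ := hg (N + C)
  refine ⟨n₁ + n₂, fun n hn => ?_⟩
  have key : ∀ p ∈ Finset.HasAntidiagonal.antidiagonal n, ∃ w : W,
      PowerSeries.coeff p.1 f * PowerSeries.coeff p.2 g * algebraMap W (FractionRing W) ϖ ^ (n / e) =
        algebraMap W (FractionRing W) (ϖ ^ N * w) := by
    rintro ⟨i, j⟩ hp
    rw [Finset.HasAntidiagonal.mem_antidiagonal] at hp
    simp only at hp ⊢
    have hle : i / e + j / e ≤ n / e := by rw [← hp]; exact Nat.div_add_div_le_add_div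
    obtain ⟨d, hd⟩ := Nat.exists_eq_add_of_le hle
    by_cases hi : n₁ ≤ i
    · obtain ⟨a, ha⟩ := h₁ i hi
      obtain ⟨b, hb⟩ := hC' j
      refine ⟨a * b * ϖ ^ d, mul_right_cancel₀ (pow_ne_zero C' hϖ0) ?_⟩
      rw [hd]
      simp only [map_mul, map_pow] at ha hb ⊢
      rw [← hb]
      linear_combination (PowerSeries.coeff j g * algebraMap W (FractionRing W) ϖ ^ (j / e) *
        algebraMap W (FractionRing W) ϖ ^ d * algebraMap W (FractionRing W) ϖ ^ C') * ha
    · obtain ⟨a, ha⟩ := h₂ j (by omega)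
      obtain ⟨b, hb⟩ := hC i
      refine ⟨a * b * ϖ ^ d, mul_right_cancel₀ (pow_ne_zero C hϖ0) ?_⟩
      rw [hd]
      simp only [map_mul, map_pow] at ha hb ⊢
      rw [← hb]
      linear_combination (PowerSeries.coeff i f * algebraMap W (FractionRing W) ϖ ^ (i / e) *
        algebraMap W (FractionRing W) ϖ ^ d * algebraMap W (FractionRing W) ϖ ^ C) * ha
  choose! w hw using key
  refine ⟨∑ p ∈ Finset.HasAntidiagonal.antidiagonal n, w p, ?_⟩
  rw [PowerSeries.coeff_mul, Finset.sum_mul, Finset.sum_congr rfl hw, Finset.mul_sum, map_sum]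

/-- The ring `K₀⟨uᵉ/ϖ⟩` of functions on the closed disc `|u|ᵉ ≤ |ϖ|`, as a subring of `K₀⟦u⟧`. -/
def discAlgebra {ϖ : W} (hϖ : Irreducible ϖ) (e : ℕ) : Subalgebra (FractionRing W) (FractionRing W)⟦X⟧ where
  carrier := {f | IsConvergent ϖ e f}
  mul_mem' := IsConvergent.mul hϖ
  add_mem' := IsConvergent.add
  algebraMap_mem' a := isConvergent_of_coeff_eq_zero ϖ e 1 fun n hn => by
    rw [PowerSeries.algebraMap_apply, Algebra.algebraMap_self_apply, PowerSeries.coeff_C,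
      if_neg (by omega)]

/-- The power series with bounded coefficients `aₙ ϖ^⌊n/m⌋ ∈ W` converge on any strictly smaller disc,
and so do their inverses if the constant coefficient is a unit. -/
theorem exists_isConvergent_inverse {ϖ : W} (hϖ : Irreducible ϖ) {e q : ℕ} (he : 0 < e)
    (hq : 2 ≤ q) {f : (FractionRing W)⟦X⟧}
    (hf : ∀ n, ∃ w : W, PowerSeries.coeff n f * algebraMap W (FractionRing W) ϖ ^ (n / (q * e)) =
      algebraMap W (FractionRing W) w)
    (h0 : ∃ w : Wˣ, PowerSeries.coeff 0 f = algebraMap W (FractionRing W) w) :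
    ∃ g : (FractionRing W)⟦X⟧, IsConvergent ϖ e g ∧ f * g = 1 := by
  obtain ⟨w0, hw0⟩ := h0
  have hϖ0 : algebraMap W (FractionRing W) ϖ ≠ 0 := by simpa using hϖ.ne_zero
  have hu0 : algebraMap W (FractionRing W) w0 ≠ 0 := by simp
  have hc0 : PowerSeries.constantCoeff f ≠ 0 := by
    rw [← PowerSeries.coeff_zero_eq_constantCoeff_apply, hw0]; exact hu0
  have hmul : f * f⁻¹ = 1 := PowerSeries.mul_inv_cancel f hc0
  have hbd : ∀ n, ∃ w : W, PowerSeries.coeff n f⁻¹ * algebraMap W (FractionRing W) ϖ ^ (n / (q * e)) =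
      algebraMap W (FractionRing W) w := by
    intro n
    induction n using Nat.strong_induction_on with
    | _ n ih =>
      have hinv : (algebraMap W (FractionRing W) w0)⁻¹ = algebraMap W (FractionRing W) ((w0⁻¹ : Wˣ) : W) := by
        apply inv_eq_of_mul_eq_one_right
        rw [← map_mul]; simp
      rcases Nat.eq_zero_or_pos n with rfl | hn
      · refine ⟨((w0⁻¹ : Wˣ) : W), ?_⟩
        have := congrArg (PowerSeries.coeff 0) hmul
        rw [PowerSeries.coeff_mul] at this
        simp only [Finset.Nat.antidiagonal_zero, Finset.sum_singleton, hw0, PowerSeries.coeff_zero_one]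
          at this
        rw [Nat.zero_div, pow_zero, mul_one, ← hinv]
        exact eq_inv_of_mul_eq_one_right this
      · have hco := congrArg (PowerSeries.coeff n) hmul
        rw [PowerSeries.coeff_mul, PowerSeries.coeff_one, if_neg hn.ne',
          ← Finset.sum_erase_add _ _ (show ((0, n) : ℕ × ℕ) ∈ Finset.HasAntidiagonal.antidiagonal n by simp)] at hco
        simp only at hco
        have key : ∀ p ∈ (Finset.HasAntidiagonal.antidiagonal n).erase (0, n), ∃ w : W,
            PowerSeries.coeff p.1 f * PowerSeries.coeff p.2 f⁻¹ *
              algebraMap W (FractionRing W) ϖ ^ (n / (q * e)) = algebraMap W (FractionRing W) w := by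
          rintro ⟨i, j⟩ hp
          rw [Finset.mem_erase, Finset.HasAntidiagonal.mem_antidiagonal] at hp
          simp only [ne_eq, Prod.mk.injEq, not_and] at hp
          have hj : j < n := by
            by_contra hcon
            exact hp.1 (by omega) (by omega)
          obtain ⟨a, ha⟩ := hf i
          obtain ⟨b, hb⟩ := ih j hj
          have hle : i / (q * e) + j / (q * e) ≤ n / (q * e) := by
            rw [← hp.2]; exact Nat.div_add_div_le_add_div
          obtain ⟨d, hd⟩ := Nat.exists_eq_add_of_le hle
          refine ⟨a * b * ϖ ^ d, ?_⟩
          simp only [map_mul, map_pow]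
          rw [hd, ← ha, ← hb]
          ring
        choose! w hw using key
        refine ⟨-((w0⁻¹ : Wˣ) : W) * ∑ p ∈ (Finset.HasAntidiagonal.antidiagonal n).erase (0, n), w p, ?_⟩
        rw [map_mul, map_neg, ← hinv, map_sum, ← Finset.sum_congr rfl hw, ← Finset.sum_mul]
        rw [hw0] at hco
        have hinv' : (algebraMap W (FractionRing W) w0)⁻¹ * algebraMap W (FractionRing W) w0 = 1 := inv_mul_cancel₀ hu0
        linear_combination ((algebraMap W (FractionRing W) w0)⁻¹ * algebraMap W (FractionRing W) ϖ ^ (n / (q * e))) * hco -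
          (PowerSeries.coeff n f⁻¹ * algebraMap W (FractionRing W) ϖ ^ (n / (q * e))) * hinv'
  refine ⟨f⁻¹, fun N => ?_, hmul⟩
  refine ⟨2 * N * (q * e) + q * e, fun n hn => ?_⟩
  obtain ⟨w, hw⟩ := hbd n
  have hpos : 0 < q * e := by positivity
  have h1 : 2 * N ≤ n / (q * e) := by
    rw [Nat.le_div_iff_mul_le hpos]; omega
  have h2 : n / (q * e) * 2 ≤ n / e := by
    rw [mul_comm q e, ← Nat.div_div_eq_div_mul]
    have := Nat.div_mul_le_self (n / e) q
    nlinarith [Nat.zero_le (n / e / q)]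
  obtain ⟨d, hd⟩ := Nat.exists_eq_add_of_le (show N + n / (q * e) ≤ n / e by omega)
  refine ⟨w * ϖ ^ d, ?_⟩
  rw [hd]
  simp only [map_mul, map_pow]
  rw [← hw]; ring

end Disc

/-- The standing data: `OE` and `OK` are the rings of integers of `E ⊆ K`, `W` is the ring of ramified
Witt vectors `W_{OE}(k)` of the residue field `k` of `OK`, i.e. the complete discrete valuation ring
over `OE`, contained in `OK`, with uniformizer `π` and residue field `k`; `frob` is the `OE`-linear
lift of the `q`-power Frobenius, where `q` is the number of elements of the residue field of `OE`;
`πK` is a uniformizer of `K`, and `eis` is its Eisenstein polynomial over `W`. -/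
structure BKDatum (OE : Type v) (OK : Type w) (W : Type u)
    [CommRing OE] [IsDomain OE] [IsDiscreteValuationRing OE]
    [CommRing OK] [IsDomain OK] [IsDiscreteValuationRing OK]
    [CommRing W] [IsDomain W] [IsDiscreteValuationRing W]
    [Algebra OE W] [Algebra W OK] where
  π : OE
  irreducible_π : Irreducible π
  irreducible_algebraMap_π : Irreducible (algebraMap OE W π)
  residue_surjective : Function.Surjective
    ((IsLocalRing.residue OK).comp (algebraMap W OK))
  frob : W →ₐ[OE] W
  frob_spec : ∀ x : W,
    algebraMap OE W π ∣ frob x - x ^ Nat.card (IsLocalRing.ResidueField OE)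
  πK : OK
  irreducible_πK : Irreducible πK
  eis : W[X]
  monic_eis : eis.Monic
  isEisensteinAt_eis : eis.IsEisensteinAt (Ideal.span {algebraMap OE W π})
  aeval_πK_eis : Polynomial.aeval πK eis = 0

namespace BKDatum

variable {OE : Type v} {OK : Type w} {W : Type u}
  [CommRing OE] [IsDomain OE] [IsDiscreteValuationRing OE]
  [CommRing OK] [IsDomain OK] [IsDiscreteValuationRing OK]
  [CommRing W] [IsDomain W] [IsDiscreteValuationRing W]
  [Algebra OE W] [Algebra W OK] (B : BKDatum OE OK W)

/-- `π`, viewed in `W`. -/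
def ϖ : W := algebraMap OE W B.π

theorem irreducible_ϖ : Irreducible B.ϖ := B.irreducible_algebraMap_π

/-- The number of elements of the residue field of `OE`. -/
noncomputable def q (_ : BKDatum OE OK W) : ℕ := Nat.card (IsLocalRing.ResidueField OE)

/-- The degree of the Eisenstein polynomial. -/
noncomputable def e : ℕ := B.eis.natDegree

theorem e_pos : 0 < B.e := by
  rcases Nat.eq_zero_or_pos B.eis.natDegree with h | h
  · have h1 := (Polynomial.Monic.natDegree_eq_zero B.monic_eis).1 h
    have h2 := B.aeval_πK_eis
    rw [h1, map_one] at h2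
    exact absurd h2 one_ne_zero
  · exact h

theorem frob_ϖ : B.frob B.ϖ = B.ϖ := B.frob.commutes B.π

/-- The ring `𝔖_E⟨I/π⟩[1/π] = K₀⟨uᵉ/π⟩`. -/
def R : Type u := discAlgebra B.irreducible_ϖ B.e

noncomputable instance : CommRing B.R :=
  inferInstanceAs (CommRing (discAlgebra B.irreducible_ϖ B.e))

noncomputable instance : Algebra (FractionRing W) B.R :=
  inferInstanceAs (Algebra (FractionRing W) (discAlgebra B.irreducible_ϖ B.e))

/-- The inclusion of `𝔖_E⟨I/π⟩[1/π]` in `K₀⟦u⟧`. -/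
noncomputable def toSeries : B.R →+* (FractionRing W)⟦X⟧ :=
  (discAlgebra B.irreducible_ϖ B.e).val.toRingHom

/-- The Eisenstein polynomial `E(u)` as an element of `𝔖_E⟨I/π⟩[1/π]`. -/
noncomputable def E : B.R :=
  ⟨((B.eis.map (algebraMap W (FractionRing W)) : (FractionRing W)[X]) : (FractionRing W)⟦X⟧),
    isConvergent_of_coeff_eq_zero _ _ (B.e + 1) fun n hn => by
      rw [Polynomial.coeff_coe, Polynomial.coeff_map,
        Polynomial.coeff_eq_zero_of_natDegree_lt (show B.eis.natDegree < n from hn), map_zero]⟩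

/-- Evaluation at `u = 0` on `𝔖_E⟨I/π⟩[1/π]`. -/
noncomputable def evR : B.R →+* FractionRing W :=
  (PowerSeries.constantCoeff (R := FractionRing W)).comp B.toSeries

theorem eis_coeff_zero : ∃ u : Wˣ, B.eis.coeff 0 = B.ϖ * u := by
  have h1 : B.eis.coeff 0 ∈ Ideal.span {B.ϖ} := B.isEisensteinAt_eis.mem B.e_pos
  have h2 : B.eis.coeff 0 ∉ (Ideal.span {B.ϖ}) ^ 2 := B.isEisensteinAt_eis.notMem
  obtain ⟨c, hc⟩ := Ideal.mem_span_singleton.1 h1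
  rw [Ideal.span_singleton_pow, Ideal.mem_span_singleton, hc, pow_two] at h2
  have hu : IsUnit c := by
    by_contra hcon
    apply h2
    apply mul_dvd_mul_left
    rw [← Ideal.mem_span_singleton, ← B.irreducible_ϖ.maximalIdeal_eq]
    exact (IsLocalRing.mem_maximalIdeal c).2 hcon
  exact ⟨hu.unit, hc⟩

theorem isUnit_evR_E : IsUnit (B.evR B.E) := by
  obtain ⟨u, hu⟩ := B.eis_coeff_zero
  rw [isUnit_iff_ne_zero]
  change PowerSeries.constantCoeff ((B.eis.map (algebraMap W (FractionRing W)) :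
    (FractionRing W)[X]) : (FractionRing W)⟦X⟧) ≠ 0
  rw [← PowerSeries.coeff_zero_eq_constantCoeff_apply, Polynomial.coeff_coe, Polynomial.coeff_map,
    hu]
  simpa using B.irreducible_ϖ.ne_zero

/-! The ring `R` is indeed `𝔖_E⟨I/π⟩[1/π]`, where `𝔖_E⟨I/π⟩` is the `π`-adic completion of the
subring `𝔖_E[I/π]` of `𝔖_E[1/π]`: see `mem_R_iff` and `isAdicCompletion_intRing` below. -/

/-- The ring `𝔖_E[I/π] = 𝔖_E[E(u)/π]`, as a subring of `K₀⟦u⟧`. -/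
noncomputable def polyRing : Subring (FractionRing W)⟦X⟧ :=
  Subring.closure (Set.range (PowerSeries.map (algebraMap W (FractionRing W))) ∪
    {(algebraMap W (FractionRing W) B.ϖ)⁻¹ • B.toSeries B.E})

/-- The ring `𝔖_E⟨I/π⟩`: the elements of `R` all of whose coefficients satisfy `aₙ π^⌊n/e⌋ ∈ W`. -/
def intRing : Subring (FractionRing W)⟦X⟧ where
  carrier := {f | IsConvergent B.ϖ B.e f ∧ ∀ n, ∃ w : W,
    PowerSeries.coeff n f * algebraMap W (FractionRing W) B.ϖ ^ (n / B.e) =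
      algebraMap W (FractionRing W) w}
  mul_mem' := by
    rintro f g ⟨hf, hf'⟩ ⟨hg, hg'⟩
    refine ⟨hf.mul B.irreducible_ϖ hg, fun n => ?_⟩
    have key : ∀ p ∈ Finset.HasAntidiagonal.antidiagonal n, ∃ w : W,
        PowerSeries.coeff p.1 f * PowerSeries.coeff p.2 g *
          algebraMap W (FractionRing W) B.ϖ ^ (n / B.e) = algebraMap W (FractionRing W) w := by
      rintro ⟨i, j⟩ hp
      rw [Finset.HasAntidiagonal.mem_antidiagonal] at hp
      simp only at hp ⊢
      have hle : i / B.e + j / B.e ≤ n / B.e := by rw [← hp]; exact Nat.div_add_div_le_add_div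
      obtain ⟨d, hd⟩ := Nat.exists_eq_add_of_le hle
      obtain ⟨a, ha⟩ := hf' i
      obtain ⟨b, hb⟩ := hg' j
      refine ⟨a * b * B.ϖ ^ d, ?_⟩
      simp only [map_mul, map_pow]
      rw [hd, ← ha, ← hb]; ring
    choose! w hw using key
    refine ⟨∑ p ∈ Finset.HasAntidiagonal.antidiagonal n, w p, ?_⟩
    rw [PowerSeries.coeff_mul, Finset.sum_mul, Finset.sum_congr rfl hw, map_sum]
  one_mem' := by
    refine ⟨one_mem (discAlgebra B.irreducible_ϖ B.e), fun n => ?_⟩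
    rw [PowerSeries.coeff_one]
    split_ifs with h
    · exact ⟨1, by rw [h]; simp⟩
    · exact ⟨0, by simp⟩
  add_mem' := by
    rintro f g ⟨hf, hf'⟩ ⟨hg, hg'⟩
    refine ⟨hf.add hg, fun n => ?_⟩
    obtain ⟨a, ha⟩ := hf' n
    obtain ⟨b, hb⟩ := hg' n
    exact ⟨a + b, by rw [map_add, add_mul, ha, hb, ← map_add]⟩
  zero_mem' := ⟨zero_mem (discAlgebra B.irreducible_ϖ B.e), fun n => ⟨0, by simp⟩⟩
  neg_mem' := by
    rintro f ⟨hf, hf'⟩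
    refine ⟨neg_mem (S := Subalgebra _ _) (s := discAlgebra B.irreducible_ϖ B.e) hf, fun n => ?_⟩
    obtain ⟨a, ha⟩ := hf' n
    exact ⟨-a, by rw [map_neg, neg_mul, ha, ← map_neg]⟩

/-- `R = 𝔖_E⟨I/π⟩[1/π]`. -/
theorem mem_R_iff (f : (FractionRing W)⟦X⟧) : f ∈ discAlgebra B.irreducible_ϖ B.e ↔
    ∃ N : ℕ, algebraMap W (FractionRing W) B.ϖ ^ N • f ∈ B.intRing := by
  have hϖ0 : algebraMap W (FractionRing W) B.ϖ ≠ 0 := by simpa using B.irreducible_ϖ.ne_zero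
  constructor
  · intro hf
    obtain ⟨C, hC⟩ := IsConvergent.bounded B.irreducible_ϖ hf
    refine ⟨C, (discAlgebra B.irreducible_ϖ B.e).smul_mem hf _, fun n => ?_⟩
    obtain ⟨w, hw⟩ := hC n
    exact ⟨w, by rw [← hw, PowerSeries.coeff_smul, smul_eq_mul]; ring⟩
  · rintro ⟨N, hN, -⟩
    have := (discAlgebra B.irreducible_ϖ B.e).smul_mem hN
      (algebraMap W (FractionRing W) B.ϖ ^ N)⁻¹
    rwa [smul_smul, inv_mul_cancel₀ (pow_ne_zero _ hϖ0), one_smul] at this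

/-- The elements of `𝔖_E[I/π]` are the power series such that, for some `m`, all the elements
`aₙ π^min(m, ⌊n/e⌋)` lie in `W`. -/
theorem mem_polyRing_iff (f : (FractionRing W)⟦X⟧) : f ∈ B.polyRing ↔ ∃ m : ℕ, ∀ n, ∃ w : W,
    PowerSeries.coeff n f * algebraMap W (FractionRing W) B.ϖ ^ (min m (n / B.e)) =
      algebraMap W (FractionRing W) w := by
  have hϖ0 : algebraMap W (FractionRing W) B.ϖ ≠ 0 := by simpa using B.irreducible_ϖ.ne_zero
  have he := B.e_pos
  have hcoe : ∀ n, PowerSeries.coeff n (B.toSeries B.E) =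
      algebraMap W (FractionRing W) (B.eis.coeff n) := fun n => by
    change PowerSeries.coeff n ((B.eis.map (algebraMap W (FractionRing W)) :
      (FractionRing W)[X]) : (FractionRing W)⟦X⟧) = _
    rw [Polynomial.coeff_coe, Polynomial.coeff_map]
  constructor
  · intro hf
    refine Subring.closure_induction ?_ ⟨0, fun n => ⟨0, by simp⟩⟩ ⟨0, fun n => ?_⟩ ?_ ?_ ?_ hf
    · rintro x (⟨s, rfl⟩ | rfl)
      · exact ⟨0, fun n => ⟨PowerSeries.coeff n s, by simp⟩⟩
      · refine ⟨1, fun n => ?_⟩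
        rw [PowerSeries.coeff_smul, hcoe, smul_eq_mul]
        rcases lt_trichotomy n B.e with hn | hn | hn
        · obtain ⟨c, hc⟩ := Ideal.mem_span_singleton.1 (B.isEisensteinAt_eis.mem hn)
          refine ⟨c, ?_⟩
          rw [Nat.div_eq_of_lt hn, hc, map_mul]
          change _ * (algebraMap W (FractionRing W) B.ϖ * _) * _ = _
          rw [Nat.min_zero, pow_zero, mul_one, inv_mul_cancel_left₀ hϖ0]
        · refine ⟨1, ?_⟩
          have : B.eis.coeff n = 1 := by rw [hn]; exact B.monic_eis
          rw [this, hn, Nat.div_self he]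
          simp [hϖ0]
        · refine ⟨0, ?_⟩
          rw [Polynomial.coeff_eq_zero_of_natDegree_lt (show B.eis.natDegree < n from hn)]
          simp
    · rw [PowerSeries.coeff_one]
      split_ifs
      · exact ⟨1, by simp⟩
      · exact ⟨0, by simp⟩
    · rintro x y - - ⟨m, hm⟩ ⟨m', hm'⟩
      refine ⟨max m m', fun n => ?_⟩
      obtain ⟨a, ha⟩ := hm n
      obtain ⟨b, hb⟩ := hm' n
      obtain ⟨d, hd⟩ := Nat.exists_eq_add_of_le
        (show min m (n / B.e) ≤ min (max m m') (n / B.e) by omega)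
      obtain ⟨d', hd'⟩ := Nat.exists_eq_add_of_le
        (show min m' (n / B.e) ≤ min (max m m') (n / B.e) by omega)
      refine ⟨a * B.ϖ ^ d + b * B.ϖ ^ d', ?_⟩
      rw [map_add, map_add, add_mul, map_mul, map_mul, map_pow, map_pow, ← ha, ← hb]
      conv_lhs =>
        congr
        · rw [hd]
        · rw [hd']
      ring
    · rintro x - ⟨m, hm⟩
      refine ⟨m, fun n => ?_⟩
      obtain ⟨a, ha⟩ := hm n
      exact ⟨-a, by rw [map_neg, neg_mul, ha, ← map_neg]⟩
    · rintro x y - - ⟨m, hm⟩ ⟨m', hm'⟩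
      refine ⟨m + m', fun n => ?_⟩
      have key : ∀ p ∈ Finset.HasAntidiagonal.antidiagonal n, ∃ w : W,
          PowerSeries.coeff p.1 x * PowerSeries.coeff p.2 y *
            algebraMap W (FractionRing W) B.ϖ ^ (min (m + m') (n / B.e)) =
              algebraMap W (FractionRing W) w := by
        rintro ⟨i, j⟩ hp
        rw [Finset.HasAntidiagonal.mem_antidiagonal] at hp
        simp only at hp ⊢
        have hle : i / B.e + j / B.e ≤ n / B.e := by rw [← hp]; exact Nat.div_add_div_le_add_div
        obtain ⟨a, ha⟩ := hm i
        obtain ⟨b, hb⟩ := hm' j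
        obtain ⟨d, hd⟩ := Nat.exists_eq_add_of_le
          (show min m (i / B.e) + min m' (j / B.e) ≤ min (m + m') (n / B.e) by omega)
        refine ⟨a * b * B.ϖ ^ d, ?_⟩
        simp only [map_mul, map_pow]
        rw [hd, ← ha, ← hb]; ring
      choose! w hw using key
      refine ⟨∑ p ∈ Finset.HasAntidiagonal.antidiagonal n, w p, ?_⟩
      rw [PowerSeries.coeff_mul, Finset.sum_mul, Finset.sum_congr rfl hw, map_sum]
  · rintro ⟨m, hm⟩
    have hS : ∀ s : W⟦X⟧, PowerSeries.map (algebraMap W (FractionRing W)) s ∈ B.polyRing :=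
      fun s => Subring.subset_closure (Or.inl ⟨s, rfl⟩)
    -- the element `uᵉ/π`
    have hX : (algebraMap W (FractionRing W) B.ϖ)⁻¹ • (PowerSeries.X ^ B.e) ∈ B.polyRing := by
      have h1 : ∀ n, ∃ c : W, n < B.e → B.eis.coeff n = B.ϖ * c := fun n => by
        by_cases hn : n < B.e
        · obtain ⟨c, hc⟩ := Ideal.mem_span_singleton.1 (B.isEisensteinAt_eis.mem hn)
          exact ⟨c, fun _ => hc⟩
        · exact ⟨0, fun h => absurd h hn⟩
      choose c hc using h1
      have h0 : (algebraMap W (FractionRing W) B.ϖ)⁻¹ • B.toSeries B.E ∈ B.polyRing :=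
        Subring.subset_closure (Or.inr rfl)
      have h2 := sub_mem h0 (hS (PowerSeries.mk fun n => if n < B.e then c n else 0))
      convert h2 using 1
      ext n
      rw [map_sub, PowerSeries.coeff_smul, PowerSeries.coeff_smul, hcoe, PowerSeries.coeff_map,
        PowerSeries.coeff_mk, PowerSeries.coeff_X_pow, smul_eq_mul, smul_eq_mul]
      rcases lt_trichotomy n B.e with hn | hn | hn
      · rw [if_neg hn.ne, if_pos hn, hc n hn, map_mul, inv_mul_cancel_left₀ hϖ0]; simp
      · have : B.eis.coeff n = 1 := by rw [hn]; exact B.monic_eis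
        rw [if_pos hn, if_neg (by omega), this]; simp
      · rw [if_neg hn.ne', if_neg (by omega),
          Polynomial.coeff_eq_zero_of_natDegree_lt (show B.eis.natDegree < n from hn)]
        simp
    have hmono : ∀ (s : W⟦X⟧) (k : ℕ), (algebraMap W (FractionRing W) B.ϖ ^ k)⁻¹ •
        (PowerSeries.X ^ (B.e * k) * PowerSeries.map (algebraMap W (FractionRing W)) s) ∈
          B.polyRing := by
      intro s k
      have := mul_mem (pow_mem hX k) (hS s)
      convert this using 1
      rw [_root_.smul_pow, ← pow_mul, inv_pow, smul_mul_assoc]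
    choose w hw using hm
    have hsum : f = (∑ n ∈ Finset.range (B.e * m),
          (algebraMap W (FractionRing W) B.ϖ ^ (n / B.e))⁻¹ •
            (PowerSeries.X ^ (B.e * (n / B.e)) * PowerSeries.map (algebraMap W (FractionRing W))
              (PowerSeries.monomial (n % B.e) (w n)))) +
        (algebraMap W (FractionRing W) B.ϖ ^ m)⁻¹ •
          (PowerSeries.X ^ (B.e * m) * PowerSeries.map (algebraMap W (FractionRing W))
              (PowerSeries.mk fun n => w (n + B.e * m))) := by
      ext n
      rw [map_add, map_sum]
      have hterm : ∀ k, PowerSeries.coeff n ((algebraMap W (FractionRing W) B.ϖ ^ (k / B.e))⁻¹ •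
            (PowerSeries.X ^ (B.e * (k / B.e)) * PowerSeries.map (algebraMap W (FractionRing W))
              (PowerSeries.monomial (k % B.e) (w k)))) =
          if n = k then (algebraMap W (FractionRing W) B.ϖ ^ (k / B.e))⁻¹ *
            algebraMap W (FractionRing W) (w k) else 0 := by
        intro k
        have hk := Nat.div_add_mod k B.e
        rw [PowerSeries.coeff_smul, PowerSeries.coeff_X_pow_mul', smul_eq_mul]
        rw [PowerSeries.coeff_map, PowerSeries.coeff_monomial]
        by_cases hnk : n = k
        · subst hnk
          rw [if_pos (Nat.mul_div_le n B.e), if_pos (by omega), if_pos rfl]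
        · rw [if_neg hnk]
          split_ifs with h1 h2
          · omega
          · simp
          · simp
      rw [Finset.sum_congr rfl fun k _ => hterm k, Finset.sum_ite_eq, PowerSeries.coeff_smul,
        PowerSeries.coeff_X_pow_mul', PowerSeries.coeff_map, PowerSeries.coeff_mk, smul_eq_mul]
      have hwn := hw n
      by_cases hn : n < B.e * m
      · have h1 : n / B.e < m := by rw [Nat.div_lt_iff_lt_mul he, mul_comm]; exact hn
        rw [if_pos (Finset.mem_range.2 hn), if_neg (by omega), mul_zero, add_zero, ← hwn,
          min_eq_right h1.le]
        field_simp
      · have h1 : m ≤ n / B.e := by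
          rw [Nat.le_div_iff_mul_le he, mul_comm]; omega
        rw [if_neg (by rw [Finset.mem_range]; exact hn), if_pos (by omega), zero_add,
          Nat.sub_add_cancel (by omega), ← hwn, min_eq_left h1]
        field_simp
    rw [hsum]
    exact add_mem (sum_mem fun n _ => hmono _ _) (hmono _ _)

/-- `𝔖_E⟨I/π⟩` is the `π`-adic completion of `𝔖_E[I/π]`: it is `π`-adically complete, contains
`𝔖_E[I/π]`, and the two rings have the same reduction modulo every power of `π`. -/
theorem isAdicCompletion_intRing [IsAdicComplete (IsLocalRing.maximalIdeal W) W] :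
    (∃ ϖ' : B.intRing, (ϖ' : (FractionRing W)⟦X⟧) =
        PowerSeries.C (algebraMap W (FractionRing W) B.ϖ) ∧
      IsAdicComplete (Ideal.span {ϖ'}) B.intRing) ∧
    B.polyRing ≤ B.intRing ∧
    (∀ (N : ℕ), ∀ f ∈ B.intRing, ∃ a ∈ B.polyRing, ∃ g ∈ B.intRing,
      f = a + algebraMap W (FractionRing W) B.ϖ ^ N • g) ∧
    ∀ (N : ℕ), ∀ g ∈ B.intRing, algebraMap W (FractionRing W) B.ϖ ^ N • g ∈ B.polyRing →
      g ∈ B.polyRing := by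
  have hϖ0 : algebraMap W (FractionRing W) B.ϖ ≠ 0 := by simpa using B.irreducible_ϖ.ne_zero
  have he := B.e_pos
  have hC : PowerSeries.C (algebraMap W (FractionRing W) B.ϖ) ∈ B.intRing := by
    refine ⟨(discAlgebra B.irreducible_ϖ B.e).algebraMap_mem _, fun n => ?_⟩
    rw [PowerSeries.coeff_C]
    split_ifs with h
    · exact ⟨B.ϖ, by rw [h]; simp⟩
    · exact ⟨0, by simp⟩
  -- divisibility by powers of the uniformizer in `intRing`
  have hdvd : ∀ (k : ℕ) (f : B.intRing), f ∈ (Ideal.span {(⟨_, hC⟩ : B.intRing)}) ^ k ↔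
      ∀ n, ∃ w : W, PowerSeries.coeff n (f : (FractionRing W)⟦X⟧) *
        algebraMap W (FractionRing W) B.ϖ ^ (n / B.e) =
          algebraMap W (FractionRing W) (B.ϖ ^ k * w) := by
    intro k f
    rw [Ideal.span_singleton_pow, Ideal.mem_span_singleton]
    have hcoe : ∀ g : B.intRing, (((⟨_, hC⟩ : B.intRing) ^ k * g : B.intRing) :
        (FractionRing W)⟦X⟧) = algebraMap W (FractionRing W) B.ϖ ^ k • (g : (FractionRing W)⟦X⟧) := by
      intro g
      rw [PowerSeries.smul_eq_C_mul, map_pow]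
      rfl
    constructor
    · rintro ⟨g, rfl⟩ n
      obtain ⟨w, hw⟩ := g.2.2 n
      refine ⟨w, ?_⟩
      rw [hcoe, PowerSeries.coeff_smul, smul_eq_mul, mul_assoc, hw, map_mul, map_pow]
    · intro h
      have hg : (algebraMap W (FractionRing W) B.ϖ ^ k)⁻¹ • (f : (FractionRing W)⟦X⟧) ∈
          B.intRing := by
        refine ⟨(discAlgebra B.irreducible_ϖ B.e).smul_mem f.2.1 _, fun n => ?_⟩
        obtain ⟨w, hw⟩ := h n
        refine ⟨w, ?_⟩
        rw [PowerSeries.coeff_smul, smul_eq_mul, mul_assoc, hw, map_mul, map_pow,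
          inv_mul_cancel_left₀ (pow_ne_zero _ hϖ0)]
      refine ⟨⟨_, hg⟩, Subtype.ext ?_⟩
      rw [hcoe, smul_smul, mul_inv_cancel₀ (pow_ne_zero _ hϖ0), one_smul]
  have hinj := IsFractionRing.injective W (FractionRing W)
  have hmaxpow : ∀ (k : ℕ) (w : W),
      w ∈ (IsLocalRing.maximalIdeal W ^ k • ⊤ : Ideal W) ↔ ∃ v, w = B.ϖ ^ k * v := by
    intro k w
    rw [smul_eq_mul, Ideal.mul_top, B.irreducible_ϖ.maximalIdeal_eq, Ideal.span_singleton_pow,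
      Ideal.mem_span_singleton]
    rfl
  refine ⟨⟨⟨_, hC⟩, rfl, { haus' := ?_, prec' := ?_ }⟩, ?_, ?_, ?_⟩
  · intro f hf
    refine Subtype.ext (PowerSeries.ext fun n => ?_)
    obtain ⟨w, hw⟩ := f.2.2 n
    have hw0 : w = 0 := by
      refine IsHausdorff.haus (I := IsLocalRing.maximalIdeal W) inferInstance w fun k => ?_
      rw [SModEq.zero, hmaxpow]
      have := hf k
      rw [SModEq.zero, smul_eq_mul, Ideal.mul_top, hdvd] at this
      obtain ⟨v, hv⟩ := this n
      exact ⟨v, hinj (by rw [← hw, hv])⟩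
    rw [hw0, map_zero] at hw
    simpa using (mul_eq_zero.1 hw).resolve_right (pow_ne_zero _ hϖ0)
  · intro f hf
    choose w hw using fun (k n : ℕ) => (f k).2.2 n
    have hcauchy : ∀ n {k l : ℕ}, k ≤ l →
        w k n ≡ w l n [SMOD (IsLocalRing.maximalIdeal W ^ k • ⊤ : Ideal W)] := by
      intro n k l hkl
      have := hf hkl
      rw [SModEq.sub_mem, smul_eq_mul, Ideal.mul_top, hdvd] at this
      obtain ⟨v, hv⟩ := this n
      rw [SModEq.sub_mem, hmaxpow]
      refine ⟨v, hinj ?_⟩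
      rw [map_sub, ← hw, ← hw, ← hv, ← sub_mul]
      rfl
    choose L hL using fun n => IsPrecomplete.prec (I := IsLocalRing.maximalIdeal W)
      inferInstance (f := fun k => w k n) (hcauchy n)
    have hLc : ∀ n, PowerSeries.coeff n (PowerSeries.mk fun n =>
        algebraMap W (FractionRing W) (L n) * (algebraMap W (FractionRing W) B.ϖ ^ (n / B.e))⁻¹) *
          algebraMap W (FractionRing W) B.ϖ ^ (n / B.e) = algebraMap W (FractionRing W) (L n) := by
      intro n
      rw [PowerSeries.coeff_mk, mul_assoc, inv_mul_cancel₀ (pow_ne_zero _ hϖ0), mul_one]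
    have hL' : ∀ k n, ∃ v, w k n - L n = B.ϖ ^ k * v := by
      intro k n
      have := hL n k
      rwa [SModEq.sub_mem, hmaxpow] at this
    refine ⟨⟨PowerSeries.mk fun n => algebraMap W (FractionRing W) (L n) *
      (algebraMap W (FractionRing W) B.ϖ ^ (n / B.e))⁻¹, fun N => ?_, fun n => ⟨_, hLc n⟩⟩,
      fun k => ?_⟩
    · obtain ⟨n₀, h₀⟩ := (f N).2.1 N
      refine ⟨n₀, fun n hn => ?_⟩
      obtain ⟨a, ha⟩ := h₀ n hn
      obtain ⟨v, hv⟩ := hL' N n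
      rw [hw] at ha
      refine ⟨a - v, ?_⟩
      rw [hLc]
      congr 1
      linear_combination hinj ha - hv
    · rw [SModEq.sub_mem, smul_eq_mul, Ideal.mul_top, hdvd]
      intro n
      obtain ⟨v, hv⟩ := hL' k n
      refine ⟨v, ?_⟩
      rw [← hv, map_sub, ← hw, ← hLc, ← sub_mul]
      rfl
  · intro f hf
    rw [mem_polyRing_iff] at hf
    obtain ⟨m, hm⟩ := hf
    choose w hw using hm
    have key : ∀ n, PowerSeries.coeff n f * algebraMap W (FractionRing W) B.ϖ ^ (n / B.e) =
        algebraMap W (FractionRing W) (B.ϖ ^ (n / B.e - m) * w n) := by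
      intro n
      rw [map_mul, map_pow, ← hw, mul_left_comm, ← pow_add]
      congr 2
      omega
    refine ⟨fun N => ⟨(N + m) * B.e, fun n hn => ?_⟩, fun n => ⟨_, key n⟩⟩
    have h1 : N + m ≤ n / B.e := by rw [Nat.le_div_iff_mul_le he]; exact hn
    obtain ⟨d, hd⟩ := Nat.exists_eq_add_of_le (show N ≤ n / B.e - m by omega)
    exact ⟨B.ϖ ^ d * w n, by rw [key, hd, pow_add, mul_assoc]⟩
  · intro N f hf
    obtain ⟨n₀, h₀⟩ := hf.1 N
    choose w hw using hf.2
    have ha : (PowerSeries.mk fun n => if n < n₀ then PowerSeries.coeff n f else 0) ∈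
        B.polyRing := by
      rw [mem_polyRing_iff]
      refine ⟨n₀, fun n => ?_⟩
      rw [PowerSeries.coeff_mk]
      split_ifs with h
      · refine ⟨w n, ?_⟩
        rw [min_eq_right ((Nat.div_le_self _ _).trans h.le), hw]
      · exact ⟨0, by simp⟩
    refine ⟨_, ha, (algebraMap W (FractionRing W) B.ϖ ^ N)⁻¹ •
      (f - PowerSeries.mk fun n => if n < n₀ then PowerSeries.coeff n f else 0), ⟨?_, ?_⟩, ?_⟩
    · refine (discAlgebra B.irreducible_ϖ B.e).smul_mem (sub_mem hf.1 ?_) _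
      exact isConvergent_of_coeff_eq_zero _ _ n₀ fun n hn => by
        rw [PowerSeries.coeff_mk, if_neg (by omega)]
    · intro n
      rw [PowerSeries.coeff_smul, map_sub, PowerSeries.coeff_mk, smul_eq_mul]
      split_ifs with h
      · exact ⟨0, by simp⟩
      · obtain ⟨v, hv⟩ := h₀ n (not_lt.1 h)
        refine ⟨v, ?_⟩
        rw [sub_zero, mul_assoc, hv, map_mul, map_pow, inv_mul_cancel_left₀ (pow_ne_zero _ hϖ0)]
    · rw [smul_smul, mul_inv_cancel₀ (pow_ne_zero _ hϖ0), one_smul, add_sub_cancel]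
  · intro N g hg hNg
    rw [mem_polyRing_iff] at hNg ⊢
    obtain ⟨m, hm⟩ := hNg
    refine ⟨m + N, fun n => ?_⟩
    by_cases h : n / B.e ≤ m + N
    · rw [min_eq_right h]; exact hg.2 n
    · obtain ⟨w, hw⟩ := hm n
      refine ⟨w, ?_⟩
      rw [PowerSeries.coeff_smul, smul_eq_mul, min_eq_left (by omega)] at hw
      rw [min_eq_left (by omega), ← hw, pow_add]
      ring

/-- The ring `𝔖_E⟨I/π⟩[1/π][1/I]`. -/
def RI : Type u := Localization.Away B.E

noncomputable instance : CommRing B.RI := inferInstanceAs (CommRing (Localization.Away B.E))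

noncomputable instance : Algebra B.R B.RI :=
  inferInstanceAs (Algebra B.R (Localization.Away B.E))

instance : IsLocalization.Away B.E B.RI :=
  inferInstanceAs (IsLocalization.Away B.E (Localization.Away B.E))

noncomputable instance : Algebra (FractionRing W) B.RI :=
  ((algebraMap B.R B.RI).comp (algebraMap (FractionRing W) B.R)).toAlgebra

instance : IsScalarTower (FractionRing W) B.R B.RI := .of_algebraMap_eq' rfl

/-- The complete local ring `𝔖̂₀` at the point `E(u) = 0`, i.e. the `I`-adic completion of
`𝔖_E⟨I/π⟩[1/π]`. -/
def S₀ : Type u := AdicCompletion (Ideal.span {B.E}) B.R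

noncomputable instance : CommRing B.S₀ :=
  inferInstanceAs (CommRing (AdicCompletion (Ideal.span {B.E}) B.R))

noncomputable instance : Algebra B.R B.S₀ :=
  inferInstanceAs (Algebra B.R (AdicCompletion (Ideal.span {B.E}) B.R))

noncomputable instance : Algebra (FractionRing W) B.S₀ :=
  ((algebraMap B.R B.S₀).comp (algebraMap (FractionRing W) B.R)).toAlgebra

instance : IsScalarTower (FractionRing W) B.R B.S₀ := .of_algebraMap_eq' rfl

/-- The fraction field `Fr(𝔖̂₀) = 𝔖̂₀[1/E(u)]`. -/
def FrS₀ : Type u := Localization.Away (algebraMap B.R B.S₀ B.E)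

noncomputable instance : CommRing B.FrS₀ :=
  inferInstanceAs (CommRing (Localization.Away (algebraMap B.R B.S₀ B.E)))

noncomputable instance : Algebra B.S₀ B.FrS₀ :=
  inferInstanceAs (Algebra B.S₀ (Localization.Away (algebraMap B.R B.S₀ B.E)))

instance : IsLocalization.Away (algebraMap B.R B.S₀ B.E) B.FrS₀ :=
  inferInstanceAs (IsLocalization.Away (algebraMap B.R B.S₀ B.E)
    (Localization.Away (algebraMap B.R B.S₀ B.E)))

noncomputable instance : Algebra B.R B.FrS₀ :=
  ((algebraMap B.S₀ B.FrS₀).comp (algebraMap B.R B.S₀)).toAlgebra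

instance : IsScalarTower B.R B.S₀ B.FrS₀ := .of_algebraMap_eq' rfl

noncomputable instance : Algebra (FractionRing W) B.FrS₀ :=
  ((algebraMap B.S₀ B.FrS₀).comp (algebraMap (FractionRing W) B.S₀)).toAlgebra

instance : IsScalarTower (FractionRing W) B.S₀ B.FrS₀ := .of_algebraMap_eq' rfl

instance : IsScalarTower (FractionRing W) B.R B.FrS₀ := .of_algebraMap_eq' rfl

/-- Evaluation at `u = 0` on `𝔖_E⟨I/π⟩[1/π][1/I]`. -/
noncomputable def evRI : B.RI →+* FractionRing W :=
  IsLocalization.Away.lift (S := B.RI) B.E (g := B.evR) B.isUnit_evR_E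

theorem evRI_algebraMap (f : B.R) : B.evRI (algebraMap B.R B.RI f) = B.evR f :=
  IsLocalization.Away.lift_eq B.E _ f

theorem isUnit_algebraMap_E : IsUnit (algebraMap B.R B.FrS₀ B.E) := by
  rw [IsScalarTower.algebraMap_apply B.R B.S₀ B.FrS₀]
  exact IsLocalization.Away.algebraMap_isUnit _

/-- The natural map `𝔖_E⟨I/π⟩[1/π][1/I] → Fr(𝔖̂₀)`. -/
noncomputable def toFrS₀ : B.RI →ₐ[B.R] B.FrS₀ :=
  IsLocalization.liftAlgHom (M := Submonoid.powers B.E) (f := Algebra.ofId B.R B.FrS₀) (by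
    rintro ⟨_, n, rfl⟩
    rw [map_pow]
    exact B.isUnit_algebraMap_E.pow n)

theorem frob_injective : Function.Injective B.frob := by
  rw [injective_iff_map_eq_zero]
  intro x hx
  by_contra hx0
  obtain ⟨n, u, rfl⟩ := IsDiscreteValuationRing.eq_unit_mul_pow_irreducible hx0 B.irreducible_ϖ
  rw [map_mul, map_pow, frob_ϖ] at hx
  have hu : IsUnit (B.frob u) := u.isUnit.map B.frob
  exact (mul_ne_zero hu.ne_zero (pow_ne_zero n B.irreducible_ϖ.ne_zero)) hx

/-- The Frobenius `φ_q` of `K₀ = W[1/π]`. -/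
noncomputable def frobK : FractionRing W →+* FractionRing W :=
  IsFractionRing.map (j := (B.frob : W →+* W)) B.frob_injective

@[simp] theorem frobK_algebraMap (x : W) :
    B.frobK (algebraMap W (FractionRing W) x) = algebraMap W (FractionRing W) (B.frob x) :=
  IsLocalization.map_eq (M := nonZeroDivisors W) (S := FractionRing W)
    (nonZeroDivisors_le_comap_nonZeroDivisors_of_injective _ B.frob_injective) x

variable [Finite (IsLocalRing.ResidueField OE)]

theorem two_le_q : 2 ≤ B.q :=
  Finite.one_lt_card (α := IsLocalRing.ResidueField OE)

/-- The Frobenius `∑ aₙ uⁿ ↦ ∑ φ_q(aₙ) u^{qn}` of `K₀⟦u⟧`. -/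
noncomputable def frobSeries : (FractionRing W)⟦X⟧ →+* (FractionRing W)⟦X⟧ :=
  (PowerSeries.expand (R := FractionRing W) B.q
    (by have := B.two_le_q; omega)).toRingHom.comp (PowerSeries.map B.frobK)

theorem coeff_frobSeries (f : (FractionRing W)⟦X⟧) (n : ℕ) :
    PowerSeries.coeff n (B.frobSeries f) =
      if B.q ∣ n then B.frobK (PowerSeries.coeff (n / B.q) f) else 0 := by
  change PowerSeries.coeff n (PowerSeries.expand B.q
    (by have := B.two_le_q; omega) (PowerSeries.map B.frobK f)) = _
  rw [PowerSeries.coeff_expand]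
  split_ifs <;> simp

theorem isConvergent_frobSeries {f : (FractionRing W)⟦X⟧} (hf : IsConvergent B.ϖ B.e f) :
    IsConvergent B.ϖ B.e (B.frobSeries f) := by
  intro N
  obtain ⟨n₀, h₀⟩ := hf N
  have hq := B.two_le_q
  refine ⟨n₀ * B.q, fun n hn => ?_⟩
  rw [coeff_frobSeries]
  split_ifs with hd
  · obtain ⟨m, rfl⟩ := hd
    have hm : n₀ ≤ m := by
      rw [ge_iff_le, mul_comm] at hn
      exact Nat.le_of_mul_le_mul_left hn (by omega)
    obtain ⟨w, hw⟩ := h₀ m hm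
    rw [Nat.mul_div_cancel_left _ (by omega)]
    have hle : m / B.e ≤ B.q * m / B.e := Nat.div_le_div_right (by nlinarith)
    obtain ⟨d, hd⟩ := Nat.exists_eq_add_of_le hle
    refine ⟨B.frob w * B.ϖ ^ d, ?_⟩
    have := congrArg B.frobK hw
    rw [map_mul, map_pow, frobK_algebraMap, frobK_algebraMap, map_mul, map_pow, frob_ϖ] at this
    rw [hd, pow_add, ← mul_assoc, this, ← map_pow, ← map_mul, mul_assoc]
  · exact ⟨0, by simp⟩

/-- The Frobenius `φ_q` of `𝔖_E⟨I/π⟩[1/π]`. -/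
noncomputable def frobR : B.R →+* B.R :=
  (B.frobSeries.comp B.toSeries).codRestrict
    (discAlgebra B.irreducible_ϖ B.e) fun f => B.isConvergent_frobSeries f.2

theorem toSeries_frobR (f : B.R) : B.toSeries (B.frobR f) = B.frobSeries (B.toSeries f) := rfl

theorem evR_frobR (f : B.R) : B.evR (B.frobR f) = B.frobK (B.evR f) := by
  change PowerSeries.constantCoeff (B.frobSeries (B.toSeries f)) =
    B.frobK (PowerSeries.constantCoeff (B.toSeries f))
  rw [← PowerSeries.coeff_zero_eq_constantCoeff_apply, coeff_frobSeries, if_pos (dvd_zero _),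
    Nat.zero_div, PowerSeries.coeff_zero_eq_constantCoeff_apply]

/-- `φ_q(E(u))` is a unit of `𝔖_E⟨I/π⟩[1/π]`. -/
theorem isUnit_frobR_E : IsUnit (B.frobR B.E) := by
  have hq := B.two_le_q
  have he := B.e_pos
  have hϖ0 : algebraMap W (FractionRing W) B.ϖ ≠ 0 := by simpa using B.irreducible_ϖ.ne_zero
  obtain ⟨u, hu⟩ := B.eis_coeff_zero
  have hcoe : ∀ m, PowerSeries.coeff m (B.toSeries B.E) =
      algebraMap W (FractionRing W) (B.eis.coeff m) := fun m => by
    change PowerSeries.coeff m ((B.eis.map (algebraMap W (FractionRing W)) :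
      (FractionRing W)[X]) : (FractionRing W)⟦X⟧) = _
    rw [Polynomial.coeff_coe, Polynomial.coeff_map]
  have hco : ∀ n, PowerSeries.coeff n (B.frobSeries (B.toSeries B.E)) =
      if B.q ∣ n then algebraMap W (FractionRing W) (B.frob (B.eis.coeff (n / B.q))) else 0 := by
    intro n
    rw [coeff_frobSeries, hcoe, frobK_algebraMap]
  have h1 : ∀ n, ∃ w : W, PowerSeries.coeff n
      ((algebraMap W (FractionRing W) B.ϖ)⁻¹ • B.frobSeries (B.toSeries B.E)) *
        algebraMap W (FractionRing W) B.ϖ ^ (n / (B.q * B.e)) =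
          algebraMap W (FractionRing W) w := by
    intro n
    rw [PowerSeries.coeff_smul, hco]
    split_ifs with hd
    · obtain ⟨m, rfl⟩ := hd
      rw [Nat.mul_div_cancel_left _ (by omega), Nat.mul_div_mul_left _ _ (by omega)]
      rcases lt_trichotomy m B.e with hm | hm | hm
      · have : B.eis.coeff m ∈ Ideal.span {B.ϖ} := B.isEisensteinAt_eis.mem hm
        obtain ⟨c, hc⟩ := Ideal.mem_span_singleton.1 this
        refine ⟨B.frob c * B.ϖ ^ (m / B.e), ?_⟩
        rw [hc, map_mul, frob_ϖ]
        simp only [map_mul, map_pow, smul_eq_mul]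
        field_simp
      · refine ⟨1, ?_⟩
        have : B.eis.coeff m = 1 := by rw [hm]; exact B.monic_eis
        rw [this, hm, Nat.div_self he]
        simp [hϖ0]
      · refine ⟨0, ?_⟩
        rw [Polynomial.coeff_eq_zero_of_natDegree_lt (show B.eis.natDegree < m from hm)]
        simp
    · exact ⟨0, by simp⟩
  have h2 : ∃ w : Wˣ, PowerSeries.coeff 0
      ((algebraMap W (FractionRing W) B.ϖ)⁻¹ • B.frobSeries (B.toSeries B.E)) =
        algebraMap W (FractionRing W) w := by
    refine ⟨Units.map (B.frob : W →* W) u, ?_⟩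
    rw [PowerSeries.coeff_smul, hco, if_pos (dvd_zero _), Nat.zero_div, hu, map_mul, frob_ϖ, map_mul,
      smul_eq_mul, ← mul_assoc, inv_mul_cancel₀ hϖ0, one_mul]
    rfl
  obtain ⟨g, hg, hfg⟩ := exists_isConvergent_inverse B.irreducible_ϖ he hq h1 h2
  let g' : B.R := ⟨g, hg⟩
  refine IsUnit.of_mul_eq_one ((algebraMap W (FractionRing W) B.ϖ)⁻¹ • g') (Subtype.ext ?_)
  change B.frobSeries (B.toSeries B.E) * ((algebraMap W (FractionRing W) B.ϖ)⁻¹ • g) = 1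
  rw [← hfg, mul_smul_comm, smul_mul_assoc]

/-- The Frobenius `φ_q` of `𝔖_E⟨I/π⟩[1/π][1/I]`, which exists because `φ_q(E(u))` is a unit. -/
noncomputable def frobRI : B.RI →+* B.RI :=
  IsLocalization.Away.lift (S := B.RI) B.E (g := (algebraMap B.R B.RI).comp B.frobR)
    (B.isUnit_frobR_E.map (algebraMap B.R B.RI))

theorem frobRI_algebraMap (f : B.R) :
    B.frobRI (algebraMap B.R B.RI f) = algebraMap B.R B.RI (B.frobR f) :=
  IsLocalization.Away.lift_eq B.E _ f

theorem frobR_algebraMap (a : FractionRing W) :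
    B.frobR (algebraMap (FractionRing W) B.R a) = algebraMap (FractionRing W) B.R (B.frobK a) := by
  refine Subtype.ext ?_
  change B.frobSeries (PowerSeries.C a) = PowerSeries.C (B.frobK a)
  change PowerSeries.expand B.q (by have := B.two_le_q; omega)
    (PowerSeries.map B.frobK (PowerSeries.C a)) = _
  rw [PowerSeries.map_C, PowerSeries.expand_C]

theorem frobRI_algebraMap_K (a : FractionRing W) :
    B.frobRI (algebraMap (FractionRing W) B.RI a) =
      algebraMap (FractionRing W) B.RI (B.frobK a) := by
  rw [IsScalarTower.algebraMap_apply (FractionRing W) B.R B.RI, frobRI_algebraMap,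
    frobR_algebraMap, ← IsScalarTower.algebraMap_apply]

end BKDatum

section Modules

open CategoryTheory

variable {OE : Type v} {OK : Type w} {W : Type u}
  [CommRing OE] [IsDomain OE] [IsDiscreteValuationRing OE]
  [CommRing OK] [IsDomain OK] [IsDiscreteValuationRing OK]
  [CommRing W] [IsDomain W] [IsDiscreteValuationRing W]
  [Algebra OE W] [Algebra W OK] [Finite (IsLocalRing.ResidueField OE)]

/-- A `φ_q`-module over `𝔖_E⟨I/π⟩[1/π]`: a vector bundle `M` with an isomorphism
`(φ_q^* M)[1/I] ≃ M[1/I]`. -/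
structure PhiModule (B : BKDatum OE OK W) where
  carrier : Type u
  [addCommGroup : AddCommGroup carrier]
  [module : Module B.R carrier]
  [finite : Module.Finite B.R carrier]
  [projective : Module.Projective B.R carrier]
  frob : (B.RI ⊗[B.R] Pullback B.frobR carrier) ≃ₗ[B.RI] (B.RI ⊗[B.R] carrier)

namespace PhiModule

variable {B : BKDatum OE OK W}

attribute [instance] addCommGroup module finite projective

/-- The semilinear map `M → M[1/I]`, `m ↦ φ_M (1 ⊗ m)`, that determines the Frobenius of `M`. -/
noncomputable def phi (M : PhiModule B) :
    M.carrier →ₛₗ[(algebraMap B.R B.RI).comp B.frobR] (B.RI ⊗[B.R] M.carrier) where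
  toFun m := M.frob (1 ⊗ₜ Pullback.unit B.frobR m)
  map_add' x y := by rw [map_add, TensorProduct.tmul_add, map_add]
  map_smul' a x := by
    rw [map_smulₛₗ, TensorProduct.tmul_smul, ← algebraMap_smul B.RI, map_smul]
    rfl

/-- The semilinear endomorphism of `M[1/I]` induced by the Frobenius of `M`. -/
noncomputable def phiRI (M : PhiModule B) :
    (B.RI ⊗[B.R] M.carrier) →ₛₗ[B.frobRI] (B.RI ⊗[B.R] M.carrier) :=
  semilinearLift B.frobRI B.frobRI_algebraMap M.phi

/-- A morphism of `φ_q`-modules is a linear map that commutes with the Frobenius isomorphisms. -/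
@[ext]
structure Hom (M N : PhiModule B) where
  hom : M.carrier →ₗ[B.R] N.carrier
  comm : ∀ m, hom.baseChange B.RI (M.phi m) = N.phi (hom m)

noncomputable instance : Category (PhiModule B) where
  Hom := Hom
  id M := ⟨LinearMap.id, fun m => by rw [LinearMap.baseChange_id]; rfl⟩
  comp f g := ⟨g.hom ∘ₗ f.hom, fun m => by
    rw [LinearMap.baseChange_comp, LinearMap.comp_apply, f.comm, g.comm, LinearMap.comp_apply]⟩
  id_comp _ := rfl
  comp_id _ := rfl
  assoc _ _ _ := rfl

/-- The reduction modulo `u`, `D(M) = M ⊗ K₀`. -/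
abbrev fibre (M : PhiModule B) : Type u := Pullback B.evR M.carrier

/-- The reduction map `M[1/I] → D(M)`. -/
noncomputable def red (M : PhiModule B) :
    (B.RI ⊗[B.R] M.carrier) →ₛₗ[B.evRI] M.fibre :=
  semilinearLift B.evRI B.evRI_algebraMap (Pullback.unit B.evR)

theorem evRI_comp (f : B.R) :
    B.evRI (((algebraMap B.R B.RI).comp B.frobR) f) = (B.frobK.comp B.evR) f := by
  rw [RingHom.comp_apply, B.evRI_algebraMap, B.evR_frobR, RingHom.comp_apply]

/-- The semilinear map `M → D(M)`, `m ↦ φ_M (1 ⊗ m) mod u`. -/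
noncomputable def redPhi (M : PhiModule B) : M.carrier →ₛₗ[B.frobK.comp B.evR] M.fibre where
  toFun m := M.red (M.phi m)
  map_add' x y := by rw [map_add, map_add]
  map_smul' a x := by rw [map_smulₛₗ, map_smulₛₗ, evRI_comp]

/-- The semilinear Frobenius of `D(M)` induced by that of `M`, `a ⊗ m ↦ φ_q(a) • (φ_M m mod u)`. -/
noncomputable def fibrePhi (M : PhiModule B) : M.fibre →ₛₗ[B.frobK] M.fibre :=
  Pullback.lift B.frobK (fun _ => rfl) M.redPhi

/-- `ξ : D(M) ⊗ 𝔖_E⟨I/π⟩[1/π][1/I] → M[1/I]` is `φ_q`-equivariant and lifts the identity of `D(M)`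
modulo `u`. -/
def IsFrobeniusLift (M : PhiModule B)
    (ξ : (B.RI ⊗[FractionRing W] M.fibre) →ₗ[B.RI] (B.RI ⊗[B.R] M.carrier)) : Prop :=
  (∀ d, M.red (ξ (1 ⊗ₜ d)) = d) ∧ ∀ d, ξ (1 ⊗ₜ M.fibrePhi d) = M.phiRI (ξ (1 ⊗ₜ d))

/-- The map `M[1/I] → M ⊗ Fr(𝔖̂₀)`. -/
noncomputable def toFr (M : PhiModule B) :
    (B.RI ⊗[B.R] M.carrier) →ₗ[B.R] (B.FrS₀ ⊗[B.R] M.carrier) :=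
  B.toFrS₀.toLinearMap.rTensor M.carrier

/-- The completion `M^∧_I`, as a lattice in `M^∧_I[1/I] = M ⊗ Fr(𝔖̂₀)`. -/
noncomputable def completion (M : PhiModule B) : Submodule B.S₀ (B.FrS₀ ⊗[B.R] M.carrier) :=
  Submodule.span B.S₀ (Set.range fun m : M.carrier => (1 : B.FrS₀) ⊗ₜ[B.R] m)

/-- The base change `D(M) ⊗ Fr(𝔖̂₀) → M ⊗ Fr(𝔖̂₀)` of `ξ`. -/
noncomputable def frXi (M : PhiModule B)
    (ξ : (B.RI ⊗[FractionRing W] M.fibre) →ₗ[B.RI] (B.RI ⊗[B.R] M.carrier)) :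
    (B.FrS₀ ⊗[FractionRing W] M.fibre) →ₗ[B.FrS₀] (B.FrS₀ ⊗[B.R] M.carrier) :=
  LinearMap.liftBaseChange B.FrS₀
    (M.toFr.restrictScalars (FractionRing W) ∘ₗ ξ.restrictScalars (FractionRing W) ∘ₗ
      TensorProduct.mk (FractionRing W) B.RI M.fibre 1)

/-- The lattice in `D(M) ⊗ Fr(𝔖̂₀)` that corresponds to `M^∧_I` under `ξ`. -/
noncomputable def fibreLattice (M : PhiModule B)
    (ξ : (B.RI ⊗[FractionRing W] M.fibre) →ₗ[B.RI] (B.RI ⊗[B.R] M.carrier)) :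
    Submodule B.S₀ (B.FrS₀ ⊗[FractionRing W] M.fibre) :=
  M.completion.comap ((M.frXi ξ).restrictScalars B.S₀)

end PhiModule

/-- A Hodge–Pink isocrystal over `K`: a finite-dimensional `K₀`-vector space `D` with an isomorphism
`φ_q^* D ≃ D` and an `𝔖̂₀`-lattice in `D ⊗ Fr(𝔖̂₀)`. -/
structure HodgePink (B : BKDatum OE OK W) where
  carrier : Type u
  [addCommGroup : AddCommGroup carrier]
  [module : Module (FractionRing W) carrier]
  [finite : Module.Finite (FractionRing W) carrier]
  frob : Pullback B.frobK carrier ≃ₗ[FractionRing W] carrier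
  lattice : Submodule B.S₀ (B.FrS₀ ⊗[FractionRing W] carrier)
  isLattice : lattice.IsLattice B.FrS₀

namespace HodgePink

variable {B : BKDatum OE OK W}

attribute [instance] addCommGroup module finite

/-- The semilinear Frobenius `d ↦ φ_D (1 ⊗ d)` of `D`. -/
noncomputable def phi (D : HodgePink B) : D.carrier →ₛₗ[B.frobK] D.carrier where
  toFun d := D.frob (Pullback.unit B.frobK d)
  map_add' x y := by rw [map_add, map_add]
  map_smul' a x := by rw [map_smulₛₗ, map_smul]

/-- A morphism of Hodge–Pink isocrystals is a linear map that commutes with the Frobenius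
isomorphisms and maps the lattice into the lattice. -/
@[ext]
structure Hom (D D' : HodgePink B) where
  hom : D.carrier →ₗ[FractionRing W] D'.carrier
  comm : ∀ d, hom (D.phi d) = D'.phi (hom d)
  map_lattice : ∀ x ∈ D.lattice, hom.baseChange B.FrS₀ x ∈ D'.lattice

noncomputable instance : Category (HodgePink B) where
  Hom := Hom
  id D := ⟨LinearMap.id, fun _ => rfl, fun x hx => by rwa [LinearMap.baseChange_id]⟩
  comp f g := ⟨g.hom ∘ₗ f.hom, fun d => by
      rw [LinearMap.comp_apply, f.comm, g.comm, LinearMap.comp_apply],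
    fun x hx => by
      rw [LinearMap.baseChange_comp]
      exact g.map_lattice _ (f.map_lattice x hx)⟩
  id_comp _ := rfl
  comp_id _ := rfl
  assoc _ _ _ := rfl

/-- The semilinear map `D → D ⊗ 𝔖_E⟨I/π⟩[1/π][1/I]`, `d ↦ 1 ⊗ φ_D d`. -/
noncomputable def tmulPhi (D : HodgePink B) :
    D.carrier →ₛₗ[B.frobRI.comp (algebraMap (FractionRing W) B.RI)]
      (B.RI ⊗[FractionRing W] D.carrier) where
  toFun d := 1 ⊗ₜ D.phi d
  map_add' x y := by rw [map_add, TensorProduct.tmul_add]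
  map_smul' a x := by
    rw [map_smulₛₗ, TensorProduct.tmul_smul, RingHom.comp_apply, B.frobRI_algebraMap_K,
      algebraMap_smul]

/-- The semilinear Frobenius `r ⊗ d ↦ φ_q(r) ⊗ φ_D d` of `D ⊗ 𝔖_E⟨I/π⟩[1/π][1/I]`. -/
noncomputable def phiRI (D : HodgePink B) :
    (B.RI ⊗[FractionRing W] D.carrier) →ₛₗ[B.frobRI] (B.RI ⊗[FractionRing W] D.carrier) :=
  semilinearLift B.frobRI (fun _ => rfl) D.tmulPhi

/-- The map `D ⊗ 𝔖_E⟨I/π⟩[1/π][1/I] → D ⊗ Fr(𝔖̂₀)`. -/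
noncomputable def toFr (D : HodgePink B) :
    (B.RI ⊗[FractionRing W] D.carrier) →ₗ[B.R] (B.FrS₀ ⊗[FractionRing W] D.carrier) :=
  TensorProduct.AlgebraTensorModule.map B.toFrS₀.toLinearMap LinearMap.id

/-- The Beauville–Laszlo glueing of `D ⊗ 𝔖_E⟨I/π⟩[1/π][1/I]` and the lattice `Λ` along
`D ⊗ Fr(𝔖̂₀)`, i.e. the elements of `D ⊗ 𝔖_E⟨I/π⟩[1/π][1/I]` whose image lies in `Λ`. -/
noncomputable def glueing (D : HodgePink B) : Submodule B.R (B.RI ⊗[FractionRing W] D.carrier) :=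
  (D.lattice.restrictScalars B.R).comap D.toFr

end HodgePink

/-- `F` is the functor `M(·)`: the module `M(D)` is identified, naturally in `D`, with the
Beauville–Laszlo glueing of `D ⊗ 𝔖_E⟨I/π⟩[1/π][1/I]` and `Λ`, and under the induced map
`M(D)[1/I] → D ⊗ 𝔖_E⟨I/π⟩[1/π][1/I]` the Frobenius of `M(D)` corresponds to that of `D`. -/
def IsModificationFunctor {B : BKDatum OE OK W} (F : HodgePink B ⥤ PhiModule B) : Prop :=
  ∃ ι : ∀ D : HodgePink B, (F.obj D).carrier →ₗ[B.R] (B.RI ⊗[FractionRing W] D.carrier),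
    (∀ D, Function.Injective (ι D) ∧ LinearMap.range (ι D) = D.glueing) ∧
    (∀ D m, (ι D).liftBaseChange B.RI ((F.obj D).phi m) = D.phiRI (ι D m)) ∧
    ∀ (D D' : HodgePink B) (f : D ⟶ D') (m : (F.obj D).carrier),
      ι D' ((F.map f).hom m) = f.hom.baseChange B.RI (ι D m)

/-- `G` is the functor `D(·)`: the isocrystal of `D(M)` is identified, naturally in `M`, with the
reduction of `M` modulo `u` with its induced Frobenius, and its lattice is `M^∧_I`, transported along
a Frobenius-equivariant lift `ξ` of the identity. -/
def IsReductionFunctor {B : BKDatum OE OK W} (G : PhiModule B ⥤ HodgePink B) : Prop :=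
  ∃ α : ∀ M : PhiModule B, M.fibre ≃ₗ[FractionRing W] (G.obj M).carrier,
    (∀ M d, α M (M.fibrePhi d) = (G.obj M).phi (α M d)) ∧
    (∀ M, ∃ ξ, M.IsFrobeniusLift ξ ∧ ∀ x,
      (α M).toLinearMap.baseChange B.FrS₀ x ∈ (G.obj M).lattice ↔ x ∈ M.fibreLattice ξ) ∧
    ∀ (M N : PhiModule B) (f : M ⟶ N) (m : M.carrier),
      (G.map f).hom (α M (Pullback.unit B.evR m)) = α N (Pullback.unit B.evR (f.hom m))

end Modules

end BreuilKisin

open CategoryTheory BreuilKisin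

/-! ### Taylor expansions at `u = 0` and the growth of their coefficients. -/

namespace BreuilKisin

namespace BKDatum

variable {OE : Type v} {OK : Type w} {W : Type u}
  [CommRing OE] [IsDomain OE] [IsDiscreteValuationRing OE]
  [CommRing OK] [IsDomain OK] [IsDiscreteValuationRing OK]
  [CommRing W] [IsDomain W] [IsDiscreteValuationRing W]
  [Algebra OE W] [Algebra W OK] (B : BKDatum OE OK W)

/-! The core is Dwork's trick. A Frobenius-equivariant map `D(M) → M[1/I]` is a fixed point of `x ↦
φ_M ∘ x ∘ φ_D⁻¹`. In coordinates it solves a linear system `x = A φ_q(x)` with `A` over `R[1/I]`,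
and the condition modulo `u` prescribes `x(0)`. Since `φ_q(u) = u^q` with `q ≥ 2`, the system
contracts the `u`-adic topology, so an admissible `x(0)` extends to exactly one solution in `K₀⟦u⟧`.
As `A` has poles on the disc of `R`, this solution is at first known to converge only near `0`. But
`φ_q` replaces a radius of convergence `r < 1` by `r^(1/q)`, so `φ_q^k(x)` has entries in `R` for
large `k`, and `φ_q^j(x) = φ_q^j(A) φ_q^(j+1)(x)` brings the solution back to `R[1/I]` one step at a
time. This is `exists_series_fixed` and `exists_fixed_vector`; uniqueness is `eq_zero_of_fixed`.
Together they give the map `ξ`.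

The map `ξ` is an isomorphism. By Nakayama its cokernel is killed by some `a` with `a(0) = 1`. As
the image of `ξ` is Frobenius-stable and `φ_M` is an isomorphism, every `φ_q^k(a)` kills the
cokernel too, and `φ_q^k(a)` is a unit for large `k`. A section of `ξ` then yields an endomorphism
of `D(M) ⊗ R[1/I]` that is the identity at `u = 0`; its determinant is nonzero, so `ξ` is injective.

What remains is lattice theory at the point `E(u) = 0`. Division by the Eisenstein polynomial shows
that `R / I` is a field. Hence a submodule that is commensurable with the free module `D ⊗ R` is
finite projective, which applies to the glueing. Approximating elements of `𝔖̂₀` by elements of `R`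
shows that the glueing generates `Λ`, and `R[1/I] ∩ 𝔖̂₀ = R` shows that `M` is recovered from
`M[1/I]` and `M^∧_I`.

Both composites are now identified through `ξ`. For `D`, inverting `E` does not affect the fibre at
`u = 0`, so the inclusion `M(D) ⊆ D ⊗ R[1/I]` reduces to `D(M(D)) ≃ D`; its inverse after inverting
`E` is an equivariant lift of the identity and must be `ξ` by uniqueness, whence the lattices agree.
For `M`, the map `ξ` carries the glueing of `D(M)` onto `M[1/I] ∩ M^∧_I = M`. -/

theorem algebraMap_ϖ_ne_zero : algebraMap W (FractionRing W) B.ϖ ≠ 0 := by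
  simpa using B.irreducible_ϖ.ne_zero

theorem toSeries_injective : Function.Injective B.toSeries := Subtype.val_injective

variable {B} in
theorem exists_toSeries_eq {f : (FractionRing W)⟦X⟧} (hf : IsConvergent B.ϖ B.e f) :
    ∃ r : B.R, B.toSeries r = f := ⟨⟨f, hf⟩, rfl⟩

instance : IsDomain B.R := inferInstanceAs (IsDomain (discAlgebra B.irreducible_ϖ B.e))

theorem E_ne_zero : B.E ≠ 0 := fun h => by
  have := B.isUnit_evR_E
  rw [h, map_zero] at this
  exact not_isUnit_zero this

theorem isUnit_toSeries_E : IsUnit (B.toSeries B.E) :=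
  PowerSeries.isUnit_iff_constantCoeff.2 B.isUnit_evR_E

/-- The Taylor expansion at `u = 0` of the elements of `R[1/I]`. -/
noncomputable def serRI : B.RI →+* (FractionRing W)⟦X⟧ :=
  IsLocalization.Away.lift (S := B.RI) B.E (g := B.toSeries) B.isUnit_toSeries_E

@[simp] theorem serRI_algebraMap (f : B.R) : B.serRI (algebraMap B.R B.RI f) = B.toSeries f :=
  IsLocalization.Away.lift_eq B.E _ f

@[simp] theorem serRI_algebraMap_K (a : FractionRing W) :
    B.serRI (algebraMap (FractionRing W) B.RI a) = PowerSeries.C a := by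
  rw [IsScalarTower.algebraMap_apply (FractionRing W) B.R B.RI, serRI_algebraMap]
  rfl

theorem isUnit_algebraMap_RI_E : IsUnit (algebraMap B.R B.RI B.E) :=
  IsLocalization.Away.algebraMap_isUnit _

/-- Every element of `R[1/I]` is of the form `r / E ^ n`. -/
theorem exists_pow_mul_eq (x : B.RI) :
    ∃ (n : ℕ) (r : B.R), algebraMap B.R B.RI B.E ^ n * x = algebraMap B.R B.RI r := by
  obtain ⟨n, r, h⟩ := IsLocalization.Away.surj B.E x
  exact ⟨n, r, by rw [← h, mul_comm]⟩

theorem algebraMap_RI_injective : Function.Injective (algebraMap B.R B.RI) := fun x y h =>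
  B.toSeries_injective (by rw [← serRI_algebraMap, h, serRI_algebraMap])

/-- Since `E(0) ≠ 0`, clearing denominators reduces this to `R ⊆ K₀⟦u⟧`. Equations in `R[1/I]` can
from here on be checked on power series. -/
theorem serRI_injective : Function.Injective B.serRI := by
  rw [injective_iff_map_eq_zero]
  intro x hx
  obtain ⟨n, r, h⟩ := B.exists_pow_mul_eq x
  have h0 : B.toSeries r = 0 := by rw [← serRI_algebraMap, ← h, map_mul, hx, mul_zero]
  have hr : r = 0 := B.toSeries_injective (by rw [h0, map_zero])
  rw [hr, map_zero] at h
  exact ((B.isUnit_algebraMap_RI_E.pow n).mul_right_eq_zero).1 h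

instance : IsDomain B.RI := B.serRI_injective.isDomain B.serRI

theorem constantCoeff_serRI (x : B.RI) : PowerSeries.constantCoeff (B.serRI x) = B.evRI x := by
  have : (PowerSeries.constantCoeff (R := FractionRing W)).comp B.serRI = B.evRI := by
    refine IsLocalization.ringHom_ext (Submonoid.powers B.E) ?_
    ext r
    simp only [RingHom.comp_apply, serRI_algebraMap, evRI_algebraMap]
    rfl
  exact congrArg (· x) (congrArg DFunLike.coe this)

@[simp] theorem evRI_algebraMap_K (a : FractionRing W) :
    B.evRI (algebraMap (FractionRing W) B.RI a) = a := by
  rw [← constantCoeff_serRI, serRI_algebraMap_K, PowerSeries.constantCoeff_C]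

/-- The coordinate `u`, as an element of `R`. -/
noncomputable def uR : B.R :=
  ⟨PowerSeries.X, isConvergent_of_coeff_eq_zero _ _ 2 fun n hn => by
    rw [PowerSeries.coeff_X, if_neg (by omega)]⟩

/-- The power series in `u / ϖ ^ t` with bounded coefficients, up to a factor `ϖ ^ a` in the radius:
`a_n ϖ^(⌊a n / b⌋ + c)` is integral. -/
def IsBounded (a b c : ℕ) (f : (FractionRing W)⟦X⟧) : Prop :=
  ∀ n, ∃ w : W, PowerSeries.coeff n f * algebraMap W (FractionRing W) B.ϖ ^ (a * n / b + c) =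
    algebraMap W (FractionRing W) w

variable {B}

theorem IsBounded.mono {a b c c' : ℕ} {f : (FractionRing W)⟦X⟧} (h : B.IsBounded a b c f)
    (hc : c ≤ c') : B.IsBounded a b c' f := by
  intro n
  obtain ⟨w, hw⟩ := h n
  refine ⟨w * B.ϖ ^ (c' - c), ?_⟩
  rw [map_mul, map_pow, ← hw, mul_assoc, ← pow_add]
  congr 2; omega

theorem integral_pow_of_le {x : FractionRing W} {m n : ℕ} (hmn : m ≤ n)
    (h : ∃ w : W, x * algebraMap W (FractionRing W) B.ϖ ^ m = algebraMap W (FractionRing W) w) :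
    ∃ w : W, x * algebraMap W (FractionRing W) B.ϖ ^ n = algebraMap W (FractionRing W) w := by
  obtain ⟨w, hw⟩ := h
  obtain ⟨d, rfl⟩ := Nat.exists_eq_add_of_le hmn
  exact ⟨w * B.ϖ ^ d, by rw [pow_add, ← mul_assoc, hw, map_mul, map_pow]⟩

theorem integral_sum {ι : Type*} (s : Finset ι) (f : ι → FractionRing W) (m : ℕ)
    (h : ∀ i ∈ s, ∃ w : W, f i * algebraMap W (FractionRing W) B.ϖ ^ m =
      algebraMap W (FractionRing W) w) :
    ∃ w : W, (∑ i ∈ s, f i) * algebraMap W (FractionRing W) B.ϖ ^ m =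
      algebraMap W (FractionRing W) w := by
  choose! w hw using h
  exact ⟨∑ i ∈ s, w i, by rw [Finset.sum_mul, Finset.sum_congr rfl hw, map_sum]⟩

theorem integral_mul {x y : FractionRing W} {m n k : ℕ} (hk : m + n ≤ k)
    (hx : ∃ w : W, x * algebraMap W (FractionRing W) B.ϖ ^ m = algebraMap W (FractionRing W) w)
    (hy : ∃ w : W, y * algebraMap W (FractionRing W) B.ϖ ^ n = algebraMap W (FractionRing W) w) :
    ∃ w : W, x * y * algebraMap W (FractionRing W) B.ϖ ^ k = algebraMap W (FractionRing W) w := by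
  refine integral_pow_of_le hk ?_
  obtain ⟨v, hv⟩ := hx
  obtain ⟨w, hw⟩ := hy
  exact ⟨v * w, by rw [map_mul, ← hv, ← hw, pow_add]; ring⟩

theorem IsBounded.mul {a c c' : ℕ} {f g : (FractionRing W)⟦X⟧}
    (hf : B.IsBounded a 1 c f) (hg : B.IsBounded a 1 c' g) : B.IsBounded a 1 (c + c') (f * g) := by
  intro n
  rw [PowerSeries.coeff_mul]
  refine integral_sum _ _ _ ?_
  rintro ⟨i, j⟩ hp
  rw [Finset.HasAntidiagonal.mem_antidiagonal] at hp
  refine integral_mul ?_ (hf i) (hg j)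
  simp only [Nat.div_one] at hp ⊢
  rw [← hp]; linarith [mul_add a i j]

theorem exists_isBounded_family {ι : Type*} [Fintype ι] {f : ι → (FractionRing W)⟦X⟧}
    (h : ∀ i, ∃ c, B.IsBounded 1 1 c (f i)) : ∃ c, ∀ i, B.IsBounded 1 1 c (f i) := by
  choose c hc using h
  exact ⟨∑ i, c i, fun i => (hc i).mono
    (Finset.single_le_sum (f := c) (fun _ _ => Nat.zero_le _) (Finset.mem_univ i))⟩

variable (B)

theorem coeff_toSeries_E (m : ℕ) : PowerSeries.coeff m (B.toSeries B.E) =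
    algebraMap W (FractionRing W) (B.eis.coeff m) := by
  change PowerSeries.coeff m ((B.eis.map (algebraMap W (FractionRing W)) :
    (FractionRing W)[X]) : (FractionRing W)⟦X⟧) = _
  rw [Polynomial.coeff_coe, Polynomial.coeff_map]

/-- `1 / E(u)` is bounded on the disc `|u| ≤ |ϖ|`. -/
theorem exists_bounded_inverse_E :
    ∃ g : (FractionRing W)⟦X⟧, B.IsBounded 1 1 1 g ∧ B.toSeries B.E * g = 1 := by
  have hϖ0 := B.algebraMap_ϖ_ne_zero
  obtain ⟨w, hw⟩ := B.eis_coeff_zero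
  -- Substitute `u = ϖ v`. Since `E(0) = ϖ · unit` and every other term gains a factor `ϖ`, one has
  -- `E(ϖ v) = ϖ h(v)` with `h` integral and `h(0)` a unit. The inverse of `E` is therefore `ϖ⁻¹
  -- h⁻¹(u / ϖ)`, whose coefficient in degree `n` has denominator at most `ϖ^(n+1)`.
  let h : W⟦X⟧ := PowerSeries.mk fun n =>
    if n = 0 then (w : W) else B.ϖ ^ (n - 1) * B.eis.coeff n
  have hE : PowerSeries.rescale (algebraMap W (FractionRing W) B.ϖ) (B.toSeries B.E) =
      PowerSeries.C (algebraMap W (FractionRing W) B.ϖ) *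
        PowerSeries.map (algebraMap W (FractionRing W)) h := by
    ext n
    rw [PowerSeries.coeff_rescale, coeff_toSeries_E, PowerSeries.coeff_C_mul,
      PowerSeries.coeff_map, PowerSeries.coeff_mk]
    split_ifs with hn
    · rw [hn, hw, pow_zero, one_mul, map_mul]
    · obtain ⟨m, rfl⟩ := Nat.exists_eq_succ_of_ne_zero hn
      rw [map_mul, map_pow, Nat.succ_sub_one, pow_succ]; ring
  have hu : IsUnit h := PowerSeries.isUnit_iff_constantCoeff.2 (by
    rw [← PowerSeries.coeff_zero_eq_constantCoeff_apply, PowerSeries.coeff_mk, if_pos rfl]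
    exact w.isUnit)
  obtain ⟨h', hh'⟩ := hu.exists_right_inv
  refine ⟨PowerSeries.C (algebraMap W (FractionRing W) B.ϖ)⁻¹ *
    PowerSeries.rescale (algebraMap W (FractionRing W) B.ϖ)⁻¹
      (PowerSeries.map (algebraMap W (FractionRing W)) h'), fun n => ?_, ?_⟩
  · refine ⟨PowerSeries.coeff n h', ?_⟩
    rw [PowerSeries.coeff_C_mul, PowerSeries.coeff_rescale, PowerSeries.coeff_map, one_mul,
      Nat.div_one, inv_pow, pow_succ]
    field_simp
  · have : B.toSeries B.E = PowerSeries.rescale (algebraMap W (FractionRing W) B.ϖ)⁻¹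
        (PowerSeries.C (algebraMap W (FractionRing W) B.ϖ) *
        PowerSeries.map (algebraMap W (FractionRing W)) h) := by
      rw [← hE, PowerSeries.rescale_rescale, mul_inv_cancel₀ hϖ0, PowerSeries.rescale_one]
      rfl
    have hC : ∀ a b : FractionRing W, PowerSeries.rescale a (PowerSeries.C b) = PowerSeries.C b := by
      intro a b
      ext n
      rw [PowerSeries.coeff_rescale, PowerSeries.coeff_C]
      split_ifs with h
      · rw [h]; simp
      · simp
    rw [this, map_mul, hC, mul_mul_mul_comm, ← map_mul, mul_inv_cancel₀ hϖ0, ← map_mul, ← map_mul,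
      hh']
    simp

/-- The Taylor expansions of the elements of `R[1/I]` are bounded on the disc `|u| ≤ |ϖ|`. -/
theorem exists_isBounded_serRI (x : B.RI) : ∃ c, B.IsBounded 1 1 c (B.serRI x) := by
  obtain ⟨n, r, h⟩ := B.exists_pow_mul_eq x
  obtain ⟨g, hg, hEg⟩ := B.exists_bounded_inverse_E
  have hr : ∃ c, B.IsBounded 1 1 c (B.toSeries r) := by
    obtain ⟨C, hC⟩ := IsConvergent.bounded B.irreducible_ϖ r.2
    refine ⟨C, fun n => ?_⟩
    -- The disc `|u| ≤ |ϖ|` lies inside the disc `|u|ᵉ ≤ |ϖ|` of `R`; on coefficients this is `⌊n/e⌋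
    -- ≤ n`. On the smaller disc `E` has no zeros, so powers of its inverse are bounded as well.
    refine integral_pow_of_le (m := n / B.e + C) ?_ ?_
    · rw [one_mul, Nat.div_one]
      exact Nat.add_le_add_right (Nat.div_le_self _ _) _
    · obtain ⟨w, hw⟩ := hC n
      exact ⟨w, by rw [← hw, pow_add, mul_assoc]; rfl⟩
  obtain ⟨c, hc⟩ := hr
  have hgn : ∀ n, ∃ c, B.IsBounded 1 1 c (g ^ n) := by
    intro n
    induction n with
    | zero => exact ⟨0, fun n => ⟨if n = 0 then B.ϖ ^ n else 0, by
        rw [pow_zero, PowerSeries.coeff_one]; split_ifs with h <;> simp [h]⟩⟩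
    | succ n ih => obtain ⟨c, hc⟩ := ih; exact ⟨_, by rw [pow_succ]; exact hc.mul hg⟩
  obtain ⟨c', hc'⟩ := hgn n
  refine ⟨c' + c, ?_⟩
  convert hc'.mul hc using 1
  have h2 := congrArg B.serRI h
  rw [map_mul, map_pow, serRI_algebraMap, serRI_algebraMap] at h2
  rw [← h2, ← mul_assoc, ← mul_pow, mul_comm g, hEg, one_pow, one_mul]

variable [Finite (IsLocalRing.ResidueField OE)]

theorem serRI_frobRI (x : B.RI) : B.serRI (B.frobRI x) = B.frobSeries (B.serRI x) := by
  have : B.serRI.comp B.frobRI = B.frobSeries.comp B.serRI := by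
    refine IsLocalization.ringHom_ext (Submonoid.powers B.E) ?_
    ext r : 1
    simp only [RingHom.comp_apply, serRI_algebraMap, frobRI_algebraMap, toSeries_frobR]
  exact congrArg (· x) (congrArg DFunLike.coe this)

theorem evRI_frobRI (x : B.RI) : B.evRI (B.frobRI x) = B.frobK (B.evRI x) := by
  rw [← constantCoeff_serRI, serRI_frobRI, ← constantCoeff_serRI,
    ← PowerSeries.coeff_zero_eq_constantCoeff_apply, coeff_frobSeries, if_pos (dvd_zero _),
    Nat.zero_div, PowerSeries.coeff_zero_eq_constantCoeff_apply]

variable {B}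

/-- The Frobenius moves the coefficient of degree `m` to degree `qm`, and it preserves denominators
because it fixes `ϖ`. The slope `a / b` is therefore divided by `q`, while the constant `c` does not
change. -/
theorem IsBounded.frobSeries {a b c : ℕ} {f : (FractionRing W)⟦X⟧}
    (h : B.IsBounded a b c f) : B.IsBounded a (b * B.q) c (B.frobSeries f) := by
  intro n
  have hq := B.two_le_q
  rw [coeff_frobSeries]
  split_ifs with hd
  · obtain ⟨m, rfl⟩ := hd
    rw [Nat.mul_div_cancel_left _ (by omega), mul_left_comm, mul_comm b, Nat.mul_div_mul_left _ _
      (by omega)]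
    obtain ⟨w, hw⟩ := h m
    refine ⟨B.frob w, ?_⟩
    rw [← frobK_algebraMap, ← hw, map_mul, map_pow, frobK_algebraMap, frob_ϖ]
  · exact ⟨0, by simp⟩

theorem IsBounded.frobSeries_iterate {a b c : ℕ} {f : (FractionRing W)⟦X⟧}
    (h : B.IsBounded a b c f) (k : ℕ) :
    B.IsBounded a (b * B.q ^ k) c (B.frobSeries^[k] f) := by
  induction k with
  | zero => simpa using h
  | succ k ih =>
    rw [Function.iterate_succ_apply', pow_succ, ← mul_assoc]
    exact ih.frobSeries

/-- Allows the number of Frobenius iterations to be chosen equal to the size that `q ^ k` has to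
reach. -/
theorem le_q_pow (k : ℕ) : k ≤ B.q ^ k :=
  (Nat.lt_pow_self B.two_le_q).le

/-- A sufficiently high power of the Frobenius makes a bounded power series converge on the closed
disc `|u|ᵉ ≤ |ϖ|`. -/
theorem IsBounded.isConvergent_frobSeries_iterate {a c : ℕ} {f : (FractionRing W)⟦X⟧}
    (h : B.IsBounded a 1 c f) {k : ℕ} (hk : 2 * B.e * a ≤ B.q ^ k) :
    IsConvergent B.ϖ B.e (B.frobSeries^[k] f) := by
  intro N
  have he := B.e_pos
  -- After `k` iterations the denominator in degree `n` is at most `ϖ^(⌊n/2e⌋ + c)`, whereas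
  -- `ϖ^⌊n/e⌋` is available. The difference is at least `⌊n/2e⌋ - c`, and the bound on `n` makes
  -- `⌊n/2e⌋` exceed `N + c`.
  refine ⟨2 * B.e * (N + c + 1), fun n hn => ?_⟩
  obtain ⟨w, hw⟩ := h.frobSeries_iterate k n
  have hq : 0 < B.q ^ k := by have := B.two_le_q; positivity
  have h1 : a * n / (1 * B.q ^ k) ≤ n / (2 * B.e) := by
    rw [one_mul, Nat.le_div_iff_mul_le (by positivity)]
    have h2 := Nat.div_mul_le_self (a * n) (B.q ^ k)
    by_contra hcon
    rw [not_le] at hcon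
    have h3 : a * n / B.q ^ k * (2 * B.e * a) ≤ a * n :=
      (Nat.mul_le_mul_left _ hk).trans h2
    rcases Nat.eq_zero_or_pos a with rfl | ha
    · simp at hcon
    · nlinarith
  have h4 : n / (2 * B.e) * 2 ≤ n / B.e := by
    rw [mul_comm 2, ← Nat.div_div_eq_div_mul]; exact Nat.div_mul_le_self _ _
  have h5 : N + c + 1 ≤ n / (2 * B.e) := by
    rw [Nat.le_div_iff_mul_le (by positivity), mul_comm]; exact hn
  obtain ⟨d, hd⟩ := Nat.exists_eq_add_of_le
    (show N + (a * n / (1 * B.q ^ k) + c) ≤ n / B.e by omega)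
  refine ⟨w * B.ϖ ^ d, ?_⟩
  rw [hd]
  simp only [map_mul, map_pow]
  rw [← hw]; ring

end BKDatum

end BreuilKisin

/-! ### Frobenius equations over `R[1/I]`. -/

namespace BreuilKisin

namespace BKDatum

variable {OE : Type v} {OK : Type w} {W : Type u}
  [CommRing OE] [IsDomain OE] [IsDiscreteValuationRing OE]
  [CommRing OK] [IsDomain OK] [IsDiscreteValuationRing OK]
  [CommRing W] [IsDomain W] [IsDiscreteValuationRing W]
  [Algebra OE W] [Algebra W OK] (B : BKDatum OE OK W)
  [Finite (IsLocalRing.ResidueField OE)]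

theorem frobSeries_X : B.frobSeries PowerSeries.X = PowerSeries.X ^ B.q := by
  have hq := B.two_le_q
  ext n
  rw [coeff_frobSeries, PowerSeries.coeff_X_pow]
  split_ifs with h1 h2 h2
  · rw [h2, Nat.div_self (by omega)]; simp
  · obtain ⟨m, rfl⟩ := h1
    rw [Nat.mul_div_cancel_left _ (by omega), PowerSeries.coeff_X, if_neg, map_zero]
    rintro rfl
    simp at h2
  · exact absurd (h2 ▸ dvd_rfl) h1
  · rfl

/-- The exponent `k` becomes `qk`, and `qk ≥ k + 1` because `q ≥ 2` and `k ≥ 1`. Nothing is gained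
for `k = 0`, which is why the constant term of a solution has to be prescribed. -/
theorem X_pow_succ_dvd_frobSeries {f : (FractionRing W)⟦X⟧} {k : ℕ} (hk : 1 ≤ k)
    (h : PowerSeries.X ^ k ∣ f) : PowerSeries.X ^ (k + 1) ∣ B.frobSeries f := by
  have hq := B.two_le_q
  have := map_dvd B.frobSeries h
  rw [map_pow, frobSeries_X, ← pow_mul] at this
  exact (pow_dvd_pow _ (by nlinarith)).trans this

variable {ι : Type*} [Fintype ι]

/-- A system of Frobenius equations `x = A φ_q(x)` contracts the `u`-adic topology. -/
theorem X_pow_succ_dvd_frob_system (A : ι → ι → (FractionRing W)⟦X⟧)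
    {y z : ι → (FractionRing W)⟦X⟧} {k : ℕ} (hk : 1 ≤ k)
    (h : ∀ j, PowerSeries.X ^ k ∣ y j - z j) (i : ι) :
    PowerSeries.X ^ (k + 1) ∣
      (∑ j, A i j * B.frobSeries (y j)) - ∑ j, A i j * B.frobSeries (z j) := by
  rw [← Finset.sum_sub_distrib]
  refine Finset.dvd_sum fun j _ => ?_
  rw [← mul_sub, ← map_sub]
  exact (B.X_pow_succ_dvd_frobSeries hk (h j)).mul_left _

/-- A power series that is divisible by all powers of `X` is zero. -/
theorem _root_.PowerSeries.eq_zero_of_forall_X_pow_dvd {K : Type*} [CommRing K] {f : K⟦X⟧}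
    (h : ∀ k ≥ 1, PowerSeries.X ^ k ∣ f) : f = 0 := by
  ext n
  exact (PowerSeries.X_pow_dvd_iff.1 (h (n + 1) (by omega))) n (by omega)

/-- Formal solutions of `x = A φ_q(x)` with prescribed constant term; the coefficients of the solution
have at most exponential growth. -/
theorem exists_series_fixed (A : ι → ι → (FractionRing W)⟦X⟧) {c g : ℕ}
    (hA : ∀ i j, B.IsBounded 1 1 c (A i j)) (G : ι → FractionRing W)
    (hg : ∀ i, ∃ w : W, G i * algebraMap W (FractionRing W) B.ϖ ^ g =
      algebraMap W (FractionRing W) w)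
    (hG : ∀ i, ∑ j, PowerSeries.constantCoeff (A i j) * B.frobK (G j) = G i) :
    ∃ x : ι → (FractionRing W)⟦X⟧, (∀ i, PowerSeries.constantCoeff (x i) = G i) ∧
      (∀ i, B.IsBounded (c + 1) 1 (c + g) (x i)) ∧
      ∀ i, ∑ j, A i j * B.frobSeries (x j) = x i := by
  have hq := B.two_le_q
  -- Fixed-point iteration, started at the constant vector `G`. The hypothesis `hG` keeps the
  -- constant term equal to `G` throughout.
  let T : (ι → (FractionRing W)⟦X⟧) → ι → (FractionRing W)⟦X⟧ :=
    fun y i => ∑ j, A i j * B.frobSeries (y j)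
  let y : ℕ → ι → (FractionRing W)⟦X⟧ := fun n => T^[n] fun i => PowerSeries.C (G i)
  have hsucc : ∀ n, y (n + 1) = T (y n) := fun n => Function.iterate_succ_apply' _ _ _
  have hT0 : ∀ z : ι → (FractionRing W)⟦X⟧, (∀ i, PowerSeries.constantCoeff (z i) = G i) →
      ∀ i, PowerSeries.constantCoeff (T z i) = G i := by
    intro z hz i
    rw [← hG i, map_sum]
    refine Finset.sum_congr rfl fun j _ => ?_
    rw [map_mul, ← hz j, ← PowerSeries.coeff_zero_eq_constantCoeff_apply (B.frobSeries (z j)),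
      coeff_frobSeries, if_pos (dvd_zero _), Nat.zero_div,
      PowerSeries.coeff_zero_eq_constantCoeff_apply]
  have hy0 : ∀ n i, PowerSeries.constantCoeff (y n i) = G i := by
    intro n
    induction n with
    | zero => intro i; exact PowerSeries.constantCoeff_C _
    | succ n ih => rw [hsucc]; exact hT0 _ ih
  -- The slope `c + 1` is what survives the iteration: multiplication by `A` costs a further
  -- constant `c` each time, and this is repaid because a coefficient of degree `b ≥ 1` lands in
  -- degree at least `qb ≥ b + 1`. For `b = 0` nothing is gained, so that case uses that the
  -- constant term is always `G`, with the smaller exponent `g` in place of `c + g`.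
  have hyb : ∀ n i, B.IsBounded (c + 1) 1 (c + g) (y n i) := by
    intro n
    induction n with
    | zero =>
      intro i m
      change ∃ w, PowerSeries.coeff m (PowerSeries.C (G i)) * _ = _
      rw [PowerSeries.coeff_C]
      split_ifs with h
      · exact integral_pow_of_le (by omega) (hg i)
      · exact ⟨0, by simp⟩
    | succ n ih =>
      rw [hsucc]
      intro i m
      change ∃ w, PowerSeries.coeff m (∑ j, A i j * B.frobSeries (y n j)) * _ = _
      rw [map_sum]
      refine integral_sum _ _ _ fun j _ => ?_
      rw [PowerSeries.coeff_mul]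
      refine integral_sum _ _ _ ?_
      rintro ⟨a, b⟩ hab
      rw [Finset.HasAntidiagonal.mem_antidiagonal] at hab
      simp only at hab ⊢
      rw [coeff_frobSeries]
      split_ifs with hd
      · obtain ⟨b, rfl⟩ := hd
        rw [Nat.mul_div_cancel_left _ (by omega)]
        have hfr : ∀ {x : FractionRing W} {m : ℕ}, (∃ w : W, x *
            algebraMap W (FractionRing W) B.ϖ ^ m = algebraMap W (FractionRing W) w) →
            ∃ w : W, B.frobK x * algebraMap W (FractionRing W) B.ϖ ^ m =
              algebraMap W (FractionRing W) w := by
          rintro x m ⟨w, hw⟩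
          exact ⟨B.frob w, by
            rw [← frobK_algebraMap, ← hw, map_mul, map_pow, frobK_algebraMap, frob_ϖ]⟩
        rcases Nat.eq_zero_or_pos b with rfl | hb
        · have h0 : PowerSeries.coeff 0 (y n j) = G j := by
            rw [PowerSeries.coeff_zero_eq_constantCoeff_apply, hy0]
          rw [h0]
          refine integral_mul ?_ (hA i j a) (hfr (hg j))
          simp only [Nat.div_one]
          nlinarith
        · refine integral_mul ?_ (hA i j a) (hfr (ih j b))
          simp only [Nat.div_one]
          have h1 : 2 * b ≤ B.q * b := Nat.mul_le_mul_right _ hq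
          rw [← hab]
          nlinarith [Nat.mul_le_mul_left c h1, Nat.mul_le_mul_left c hb, Nat.zero_le (c * a)]
      · exact ⟨0, by simp⟩
  have hstep : ∀ n i, PowerSeries.X ^ (n + 1) ∣ y (n + 1) i - y n i := by
    intro n
    induction n with
    | zero =>
      intro i
      rw [zero_add, pow_one, PowerSeries.X_dvd_iff, map_sub, hy0, hy0, sub_self]
    | succ n ih =>
      intro i
      rw [hsucc (n + 1), hsucc n]
      refine B.X_pow_succ_dvd_frob_system A (by omega) (fun j => ?_) i
      rw [← hsucc n]; exact ih j
  have hle : ∀ n d i, PowerSeries.X ^ (n + 1) ∣ y (n + d) i - y n i := by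
    intro n d i
    induction d with
    | zero => simp
    | succ d ih =>
      have := ((pow_dvd_pow PowerSeries.X (by omega)).trans (hstep (n + d) i)).add ih
      convert this using 1
      rw [← add_assoc]; ring
  let x : ι → (FractionRing W)⟦X⟧ := fun i => PowerSeries.mk fun n => PowerSeries.coeff n (y n i)
  have hx : ∀ n i, PowerSeries.X ^ (n + 1) ∣ x i - y n i := by
    intro n i
    rw [PowerSeries.X_pow_dvd_iff]
    intro m hm
    obtain ⟨d, rfl⟩ := Nat.exists_eq_add_of_le (Nat.lt_succ_iff.1 hm)
    have := PowerSeries.X_pow_dvd_iff.1 (hle m d i) m (by omega)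
    rw [map_sub, PowerSeries.coeff_mk, ← neg_sub, ← map_sub, this, neg_zero]
  refine ⟨x, fun i => ?_, fun i n => ?_, fun i => ?_⟩
  · rw [← PowerSeries.coeff_zero_eq_constantCoeff_apply, PowerSeries.coeff_mk,
      PowerSeries.coeff_zero_eq_constantCoeff_apply, hy0]
  · rw [PowerSeries.coeff_mk]
    exact hyb n i n
  · rw [← sub_eq_zero]
    refine PowerSeries.eq_zero_of_forall_X_pow_dvd fun k hk => ?_
    -- Both `T x` and `x` are compared with `y (k + 1) = T (y k)`.
    have h1 := B.X_pow_succ_dvd_frob_system A (k := k + 1) (by omega) (hx k) i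
    have h2 := hx (k + 1) i
    rw [hsucc] at h2
    have h3 := h1.sub h2
    refine (pow_dvd_pow PowerSeries.X (show k ≤ k + 1 + 1 by omega)).trans ?_
    convert h3 using 1
    simp only [T]
    ring

/-- **Dwork's trick**: a solution modulo `u` of a system of Frobenius equations `x = A φ_q(x)` over `R[1/I]`
lifts to a solution over `R[1/I]`. -/
theorem exists_fixed_vector (A : ι → ι → B.RI) (G : ι → FractionRing W)
    (hG : ∀ i, ∑ j, B.evRI (A i j) * B.frobK (G j) = G i) :
    ∃ x : ι → B.RI, (∀ i, B.evRI (x i) = G i) ∧ ∀ i, ∑ j, A i j * B.frobRI (x j) = x i := by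
  obtain ⟨c, hc⟩ := exists_isBounded_family (B := B) (ι := ι × ι)
    (f := fun p => B.serRI (A p.1 p.2)) fun p => B.exists_isBounded_serRI _
  choose g w hw using fun i => exists_pow_mul_integral B.irreducible_ϖ (G i)
  obtain ⟨x, hx0, hxb, hx⟩ := B.exists_series_fixed (fun i j => B.serRI (A i j))
    (c := c) (g := ∑ i, g i) (fun i j => hc (i, j)) G
    (fun i => integral_pow_of_le (Finset.single_le_sum (f := g) (fun _ _ => Nat.zero_le _)
      (Finset.mem_univ i)) ⟨w i, hw i⟩)
    (fun i => by simp only [constantCoeff_serRI]; exact hG i)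
  -- Applying the `k`-th power of the Frobenius to `x = A φ_q(x)` expresses `φ_q^k(x)` through
  -- `φ_q^k(A)` and `φ_q^(k+1)(x)`. The matrix `φ_q^k(A)` is defined over `R[1/I]`, so membership in
  -- `R[1/I]` descends from `k + 1` to `k`.
  have hdesc : ∀ k, (∀ i, ∃ z : B.RI, B.serRI z = B.frobSeries^[k] (x i)) →
      ∀ i, ∃ z : B.RI, B.serRI z = x i := by
    intro k
    induction k with
    | zero => exact id
    | succ k ih =>
      intro h
      refine ih fun i => ?_
      choose z hz using h
      refine ⟨∑ j, B.frobRI^[k] (A i j) * z j, ?_⟩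
      have hser : ∀ (k : ℕ) (a : B.RI), B.serRI (B.frobRI^[k] a) = B.frobSeries^[k] (B.serRI a) :=
        fun k a => Function.Semiconj.iterate_right (f := B.serRI) (ga := B.frobRI)
          (gb := B.frobSeries) B.serRI_frobRI k a
      rw [map_sum]
      conv_rhs => rw [← hx i]
      rw [← RingHom.coe_pow, ← RingHom.coe_pow, map_sum]
      refine Finset.sum_congr rfl fun j _ => ?_
      rw [map_mul, map_mul, RingHom.coe_pow, hser, hz, RingHom.coe_pow, Function.iterate_succ_apply]
  choose r hr using fun i => exists_toSeries_eq
    ((hxb i).isConvergent_frobSeries_iterate (B.le_q_pow (2 * B.e * (c + 1))))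
  choose z hz using hdesc (2 * B.e * (c + 1)) fun i =>
    ⟨algebraMap B.R B.RI (r i), by rw [serRI_algebraMap, hr]⟩
  refine ⟨z, fun i => ?_, fun i => B.serRI_injective ?_⟩
  · rw [← constantCoeff_serRI, hz, hx0]
  · rw [map_sum, hz, ← hx i]
    refine Finset.sum_congr rfl fun j _ => ?_
    rw [map_mul, serRI_frobRI, hz]

/-- If `a ≡ 1` modulo `u`, some power of the Frobenius maps `a` to a unit. -/
theorem exists_isUnit_frobRI_iterate (a : B.RI) (ha : B.evRI a = 1) :
    ∃ k, IsUnit (B.frobRI^[k] a) := by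
  obtain ⟨c, hc⟩ := B.exists_isBounded_serRI a
  have he := B.e_pos
  have hq := B.two_le_q
  let k := 2 * B.e * (c + 1)
  have hk : 2 * B.e * (c + 1) ≤ B.q ^ k := B.le_q_pow _
  have hser : B.serRI (B.frobRI^[k] a) = B.frobSeries^[k] (B.serRI a) :=
    Function.Semiconj.iterate_right (f := B.serRI) (ga := B.frobRI)
          (gb := B.frobSeries) B.serRI_frobRI k a
  have h0 : ∀ n (f : (FractionRing W)⟦X⟧), PowerSeries.coeff 0 f = 1 →
      PowerSeries.coeff 0 (B.frobSeries^[n] f) = 1 := by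
    intro n f hf
    induction n with
    | zero => exact hf
    | succ n ih =>
      rw [Function.iterate_succ_apply', coeff_frobSeries, if_pos (dvd_zero _), Nat.zero_div, ih,
        map_one]
  have ha0 : PowerSeries.coeff 0 (B.serRI a) = 1 := by
    rw [PowerSeries.coeff_zero_eq_constantCoeff_apply, constantCoeff_serRI, ha]
  -- The first nonconstant term of `φ_q^k(a)` has degree at least `q ^ k`. Since the constant term
  -- is exactly `1`, the additive constant `c` in the bound has to be absorbed only in these high
  -- degrees.
  have hdvd : ∀ n m (f : (FractionRing W)⟦X⟧), PowerSeries.coeff m (B.frobSeries^[n] f) ≠ 0 →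
      B.q ^ n ∣ m := by
    intro n
    induction n with
    | zero => intro m f _; simp
    | succ n ih =>
      intro m f hm
      rw [Function.iterate_succ_apply', coeff_frobSeries] at hm
      split_ifs at hm with hd
      · obtain ⟨m, rfl⟩ := hd
        rw [Nat.mul_div_cancel_left _ (by omega)] at hm
        rw [pow_succ']
        exact mul_dvd_mul_left _ (ih m f fun h => hm (by rw [h, map_zero]))
      · exact absurd rfl hm
  -- The inversion lemma is used with `2` in the place of `q`. In degree `q ^ k * m` with `m ≥ 1`
  -- the denominator is at most `ϖ^(m + c)`, and `2e(m + c) ≤ 2e(c + 1)m ≤ q ^ k * m`.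
  obtain ⟨g, hg, hfg⟩ := exists_isConvergent_inverse B.irreducible_ϖ he le_rfl
    (f := B.frobSeries^[k] (B.serRI a)) (fun n => by
      by_cases hn : PowerSeries.coeff n (B.frobSeries^[k] (B.serRI a)) = 0
      · exact ⟨0, by rw [hn]; simp⟩
      rcases Nat.eq_zero_or_pos n with rfl | hpos
      · exact ⟨1, by rw [h0 _ _ ha0]; simp⟩
      refine integral_pow_of_le ?_ (hc.frobSeries_iterate k n)
      obtain ⟨m, rfl⟩ := hdvd _ _ _ hn
      have hqk : 0 < B.q ^ k := by positivity
      have hm : 0 < m := Nat.pos_of_mul_pos_left hpos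
      rw [one_mul, one_mul, Nat.mul_div_cancel_left _ hqk, Nat.le_div_iff_mul_le (by positivity)]
      calc (m + c) * (2 * B.e) ≤ 2 * B.e * (c + 1) * m := by nlinarith [Nat.zero_le (B.e * c * (m - 1)), Nat.mul_le_mul_left (B.e * c) hm]
        _ ≤ B.q ^ k * m := Nat.mul_le_mul_right _ hk)
    ⟨1, by rw [h0 _ _ ha0]; simp⟩
  obtain ⟨r, rfl⟩ := exists_toSeries_eq hg
  refine ⟨k, IsUnit.of_mul_eq_one (algebraMap B.R B.RI r) (B.serRI_injective ?_)⟩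
  rw [map_mul, hser, serRI_algebraMap, map_one, hfg]

end BKDatum

end BreuilKisin

/-! ### Division by the Eisenstein polynomial. -/

namespace BreuilKisin

namespace BKDatum

variable {OE : Type v} {OK : Type w} {W : Type u}
  [CommRing OE] [IsDomain OE] [IsDiscreteValuationRing OE]
  [CommRing OK] [IsDomain OK] [IsDiscreteValuationRing OK]
  [CommRing W] [IsDomain W] [IsDiscreteValuationRing W]
  [Algebra OE W] [Algebra W OK] (B : BKDatum OE OK W)

/-- This is where the Eisenstein property enters: the lower coefficients are divisible by `ϖ`, and
the leading term `uᵉ/ϖ` is allowed in degree `e`. -/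
theorem ϖ_inv_smul_E_mem_intRing :
    (algebraMap W (FractionRing W) B.ϖ)⁻¹ • B.toSeries B.E ∈ B.intRing := by
  have hϖ0 := B.algebraMap_ϖ_ne_zero
  refine ⟨(discAlgebra B.irreducible_ϖ B.e).smul_mem B.E.2 _, fun n => ?_⟩
  rw [PowerSeries.coeff_smul, coeff_toSeries_E, smul_eq_mul]
  rcases lt_trichotomy n B.e with hn | hn | hn
  · obtain ⟨c, hc⟩ := Ideal.mem_span_singleton.1 (B.isEisensteinAt_eis.mem hn)
    refine ⟨c, ?_⟩
    rw [Nat.div_eq_of_lt hn, hc, map_mul]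
    change _ * (algebraMap W (FractionRing W) B.ϖ * _) * _ = _
    rw [pow_zero, mul_one, inv_mul_cancel_left₀ hϖ0]
  · refine ⟨1, ?_⟩
    have : B.eis.coeff n = 1 := by rw [hn]; exact B.monic_eis
    rw [this, hn, Nat.div_self B.e_pos]
    simp [hϖ0]
  · refine ⟨0, ?_⟩
    rw [Polynomial.coeff_eq_zero_of_natDegree_lt (show B.eis.natDegree < n from hn)]
    simp

theorem mem_intRing_of_coeff_eq_zero {f : (FractionRing W)⟦X⟧} {d : ℕ}
    (hd : ∀ n ≥ d, PowerSeries.coeff n f = 0)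
    (h : ∀ n < d, ∃ w : W, PowerSeries.coeff n f * algebraMap W (FractionRing W) B.ϖ ^ (n / B.e) =
      algebraMap W (FractionRing W) w) : f ∈ B.intRing := by
  refine ⟨isConvergent_of_coeff_eq_zero _ _ d hd, fun n => ?_⟩
  rcases lt_or_ge n d with hn | hn
  · exact h n hn
  · exact ⟨0, by rw [hd n hn]; simp⟩

/-- Division of polynomials by `E(u) / ϖ`. -/
theorem exists_eq_add_mul_of_coeff_eq_zero (d : ℕ) : ∀ f ∈ B.intRing,
    (∀ n ≥ d, PowerSeries.coeff n f = 0) → ∃ Q ∈ B.intRing, ∀ n ≥ B.e,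
      PowerSeries.coeff n
        (f - (algebraMap W (FractionRing W) B.ϖ)⁻¹ • B.toSeries B.E * Q) = 0 := by
  have hϖ0 := B.algebraMap_ϖ_ne_zero
  induction d with
  | zero => exact fun f _ h => ⟨0, zero_mem _, fun n _ => by rw [mul_zero, sub_zero, h n (by omega)]⟩
  | succ d ih =>
    intro f hf h
    by_cases hd : d < B.e
    · exact ⟨0, zero_mem _, fun n hn => by rw [mul_zero, sub_zero, h n (by omega)]⟩
    -- The term `c uᵈ` of top degree is cancelled by `ϖ c u^(d-e)` times `E/ϖ`. This multiplier is
    -- still integral because `⌊d/e⌋ = ⌊(d-e)/e⌋ + 1`.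
    have hQ : PowerSeries.monomial (d - B.e)
        (algebraMap W (FractionRing W) B.ϖ * PowerSeries.coeff d f) ∈ B.intRing := by
      refine B.mem_intRing_of_coeff_eq_zero (d := d - B.e + 1) (fun n hn => ?_) fun n hn => ?_
      · rw [PowerSeries.coeff_monomial, if_neg (by omega)]
      · rw [PowerSeries.coeff_monomial]
        split_ifs with hn'
        · obtain ⟨w, hw⟩ := hf.2 d
          refine ⟨w, ?_⟩
          rw [← hw, hn', show d / B.e = (d - B.e) / B.e + 1 by
            rw [← Nat.add_div_right _ B.e_pos, Nat.sub_add_cancel (not_lt.1 hd)], pow_succ]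
          ring
        · exact ⟨0, by simp⟩
    have key : ∀ n, PowerSeries.coeff n ((algebraMap W (FractionRing W) B.ϖ)⁻¹ • B.toSeries B.E *
        PowerSeries.monomial (d - B.e)
          (algebraMap W (FractionRing W) B.ϖ * PowerSeries.coeff d f)) =
        if d - B.e ≤ n then algebraMap W (FractionRing W) (B.eis.coeff (n - (d - B.e))) *
          PowerSeries.coeff d f else 0 := by
      intro n
      have hm : PowerSeries.monomial (d - B.e)
          (algebraMap W (FractionRing W) B.ϖ * PowerSeries.coeff d f) = PowerSeries.X ^ (d - B.e) *
            PowerSeries.C (algebraMap W (FractionRing W) B.ϖ * PowerSeries.coeff d f) := by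
        ext m
        rw [PowerSeries.coeff_monomial, PowerSeries.coeff_mul_C, PowerSeries.coeff_X_pow]
        split_ifs <;> simp
      rw [hm, mul_left_comm, PowerSeries.coeff_X_pow_mul']
      split_ifs
      · rw [PowerSeries.coeff_mul_C, PowerSeries.coeff_smul, coeff_toSeries_E, smul_eq_mul]
        field_simp
      · rfl
    obtain ⟨Q, hQ', hQe⟩ := ih (f - (algebraMap W (FractionRing W) B.ϖ)⁻¹ • B.toSeries B.E *
        PowerSeries.monomial (d - B.e)
          (algebraMap W (FractionRing W) B.ϖ * PowerSeries.coeff d f))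
      (sub_mem hf (mul_mem B.ϖ_inv_smul_E_mem_intRing hQ)) (fun n hn => by
        rw [map_sub, key, if_pos (by omega)]
        rcases hn.eq_or_lt with rfl | hn
        · have : B.eis.coeff (d - (d - B.e)) = 1 := by
            rw [Nat.sub_sub_self (not_lt.1 hd)]; exact B.monic_eis
          rw [this, map_one, one_mul, sub_self]
        · rw [h n hn, Polynomial.coeff_eq_zero_of_natDegree_lt (by change B.e < _; omega)]
          simp)
    refine ⟨_, add_mem hQ hQ', fun n hn => ?_⟩
    rw [mul_add, ← sub_sub]
    exact hQe n hn

variable [IsAdicComplete (IsLocalRing.maximalIdeal W) W]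

/-- Division by `E(u) / ϖ` in `𝔖_E⟨I/π⟩`. -/
theorem exists_eq_add_mul_intRing (f : (FractionRing W)⟦X⟧) (hf : f ∈ B.intRing) :
    ∃ Q ∈ B.intRing, ∀ n ≥ B.e, PowerSeries.coeff n
        (f - (algebraMap W (FractionRing W) B.ϖ)⁻¹ • B.toSeries B.E * Q) = 0 := by
  have hϖ0 := B.algebraMap_ϖ_ne_zero
  obtain ⟨⟨ϖ', hϖ', hcomplete⟩, -⟩ := B.isAdicCompletion_intRing
  let E' : B.intRing := ⟨_, B.ϖ_inv_smul_E_mem_intRing⟩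
  -- division modulo `ϖ`
  have hstep : ∀ f : B.intRing, ∃ Q h : B.intRing, ∀ n ≥ B.e,
      PowerSeries.coeff n ((f - E' * Q - ϖ' * h : B.intRing) : (FractionRing W)⟦X⟧) = 0 := by
    intro f
    obtain ⟨n₀, h₀⟩ := f.2.1 1
    obtain ⟨Q, hQ, hQe⟩ := B.exists_eq_add_mul_of_coeff_eq_zero n₀
      (PowerSeries.mk fun n => if n < n₀ then PowerSeries.coeff n (f : (FractionRing W)⟦X⟧) else 0)
      (B.mem_intRing_of_coeff_eq_zero (fun n hn => by
        rw [PowerSeries.coeff_mk, if_neg (not_lt.2 hn)]) fun n hn => by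
        rw [PowerSeries.coeff_mk, if_pos hn]; exact f.2.2 n)
      (fun n hn => by rw [PowerSeries.coeff_mk, if_neg (by omega)])
    have hh : (algebraMap W (FractionRing W) B.ϖ)⁻¹ • ((f : (FractionRing W)⟦X⟧) -
        PowerSeries.mk fun n => if n < n₀ then PowerSeries.coeff n (f : (FractionRing W)⟦X⟧) else 0)
          ∈ B.intRing := by
      constructor
      · refine (discAlgebra B.irreducible_ϖ B.e).smul_mem (sub_mem f.2.1 ?_) _
        exact isConvergent_of_coeff_eq_zero _ _ n₀ fun n hn => by
          rw [PowerSeries.coeff_mk, if_neg (by omega)]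
      · intro n
        rw [PowerSeries.coeff_smul, map_sub, PowerSeries.coeff_mk, smul_eq_mul]
        split_ifs with hn
        · exact ⟨0, by simp⟩
        · obtain ⟨w, hw⟩ := h₀ n (not_lt.1 hn)
          refine ⟨w, ?_⟩
          rw [sub_zero, mul_assoc, hw, pow_one, map_mul, inv_mul_cancel_left₀ hϖ0]
    refine ⟨⟨Q, hQ⟩, ⟨_, hh⟩, fun n hn => ?_⟩
    refine Eq.trans (congrArg _ ?_) (hQe n hn)
    change (f : (FractionRing W)⟦X⟧) - E' * Q - ϖ' * _ = _
    rw [hϖ', ← PowerSeries.smul_eq_C_mul, smul_smul, mul_inv_cancel₀ hϖ0, one_smul]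
    ring
  choose Q h hQh using hstep
  let f' : B.intRing := ⟨f, hf⟩
  let g : ℕ → B.intRing := fun n => h^[n] f'
  have hg : ∀ n, g (n + 1) = h (g n) := fun n => Function.iterate_succ_apply' _ _ _
  -- Successive approximation: modulo power series without terms of degree `≥ e`, the element `f`
  -- equals `(E/ϖ) S_N + ϖ^N g_N`. The remainder itself is never named; only the vanishing of its
  -- high coefficients is tracked.
  let S : ℕ → B.intRing := fun N => ∑ i ∈ Finset.range N, ϖ' ^ i * Q (g i)
  have hS : ∀ N, ∀ n ≥ B.e, PowerSeries.coeff n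
      ((f' - E' * S N - ϖ' ^ N * g N : B.intRing) : (FractionRing W)⟦X⟧) = 0 := by
    intro N n hn
    induction N with
    | zero => simp [S, g]
    | succ N ih =>
      have h1 : (f' - E' * S (N + 1) - ϖ' ^ (N + 1) * g (N + 1) : B.intRing) =
          (f' - E' * S N - ϖ' ^ N * g N) + ϖ' ^ N * (g N - E' * Q (g N) - ϖ' * h (g N)) := by
        simp only [S, Finset.sum_range_succ, hg]
        ring
      have h2 : ((ϖ' ^ N : B.intRing) : (FractionRing W)⟦X⟧) =
          PowerSeries.C (algebraMap W (FractionRing W) B.ϖ ^ N) := by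
        rw [map_pow, ← hϖ']; rfl
      rw [h1, Subring.coe_add, map_add, ih, Subring.coe_mul, h2, PowerSeries.coeff_C_mul,
        hQh (g N) n hn, mul_zero, add_zero]
  obtain ⟨L, hL⟩ := IsPrecomplete.prec (I := Ideal.span {ϖ'}) inferInstance (f := S) (by
    intro m n hmn
    rw [SModEq.sub_mem, smul_eq_mul, Ideal.mul_top, Ideal.span_singleton_pow,
      Ideal.mem_span_singleton, ← neg_sub, dvd_neg]
    obtain ⟨d, rfl⟩ := Nat.exists_eq_add_of_le hmn
    simp only [S, Finset.sum_range_add, add_sub_cancel_left]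
    exact Finset.dvd_sum fun i _ => (pow_dvd_pow ϖ' (by omega)).mul_right _)
  refine ⟨L, L.2, fun n hn => ?_⟩
  -- In degree `n ≥ e` the normalized coefficient of `f - (E/ϖ) L` is divisible by every power of
  -- `ϖ`, hence zero because `W` is separated.
  have hc : ∀ N, ∃ w : W, PowerSeries.coeff n ((f' - E' * L : B.intRing) : (FractionRing W)⟦X⟧) *
      algebraMap W (FractionRing W) B.ϖ ^ (n / B.e) =
        algebraMap W (FractionRing W) (B.ϖ ^ N * w) := by
    intro N
    have h1 := hL N
    rw [SModEq.sub_mem, smul_eq_mul, Ideal.mul_top, Ideal.span_singleton_pow,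
      Ideal.mem_span_singleton] at h1
    obtain ⟨t, ht⟩ := h1
    have h2 : (f' - E' * L : B.intRing) = (f' - E' * S N - ϖ' ^ N * g N) +
        ϖ' ^ N * (g N + E' * t) := by
      linear_combination E' * ht
    have h3 : ((ϖ' ^ N : B.intRing) : (FractionRing W)⟦X⟧) =
          PowerSeries.C (algebraMap W (FractionRing W) B.ϖ ^ N) := by
        rw [map_pow, ← hϖ']; rfl
    obtain ⟨w, hw⟩ := (g N + E' * t).2.2 n
    refine ⟨w, ?_⟩
    rw [h2, Subring.coe_add, map_add, hS N n hn, Subring.coe_mul, h3, PowerSeries.coeff_C_mul,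
      zero_add, mul_assoc, hw, map_mul, map_pow]
  obtain ⟨w, hw⟩ := hc 0
  have hw0 : w = 0 := by
    refine IsHausdorff.haus (I := IsLocalRing.maximalIdeal W) inferInstance w fun N => ?_
    rw [SModEq.zero, smul_eq_mul, Ideal.mul_top, B.irreducible_ϖ.maximalIdeal_eq,
      Ideal.span_singleton_pow, Ideal.mem_span_singleton]
    obtain ⟨w', hw'⟩ := hc N
    refine ⟨w', IsFractionRing.injective W (FractionRing W) ?_⟩
    rw [← hw', hw, pow_zero, one_mul]
  rw [hw0, mul_zero, map_zero] at hw
  exact (mul_eq_zero.1 hw).resolve_right (pow_ne_zero _ hϖ0)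

/-- A polynomial, as an element of `R`. -/
noncomputable def ofPoly : (FractionRing W)[X] →+* B.R :=
  Polynomial.eval₂RingHom (algebraMap (FractionRing W) B.R) B.uR

omit [IsAdicComplete (IsLocalRing.maximalIdeal W) W] in
theorem toSeries_ofPoly (p : (FractionRing W)[X]) : B.toSeries (B.ofPoly p) = p := by
  have : B.toSeries.comp B.ofPoly = Polynomial.coeToPowerSeries.ringHom := by
    refine Polynomial.ringHom_ext (fun a => ?_) ?_
    · simp only [ofPoly, RingHom.comp_apply, Polynomial.coe_eval₂RingHom, Polynomial.eval₂_C,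
        Polynomial.coeToPowerSeries.ringHom_apply, Polynomial.coe_C]
      rfl
    · simp only [ofPoly, RingHom.comp_apply, Polynomial.coe_eval₂RingHom, Polynomial.eval₂_X,
        Polynomial.coeToPowerSeries.ringHom_apply, Polynomial.coe_X]
      rfl
  exact congrArg (· p) (congrArg DFunLike.coe this)

omit [IsAdicComplete (IsLocalRing.maximalIdeal W) W] in
theorem ofPoly_eis : B.ofPoly (B.eis.map (algebraMap W (FractionRing W))) = B.E :=
  B.toSeries_injective (B.toSeries_ofPoly _)

/-- After multiplication by a power of `ϖ` the integral division applies. Its remainder has no terms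
of degree `≥ e`, so it equals its own truncation. Questions modulo `E` thereby become questions
about `K₀[u]`. -/
theorem exists_eq_ofPoly_add_mul (f : B.R) : ∃ (p : (FractionRing W)[X]) (Q : B.R),
    f = B.ofPoly p + B.E * Q := by
  have hϖ0 := B.algebraMap_ϖ_ne_zero
  obtain ⟨N, hN⟩ := (B.mem_R_iff _).1 f.2
  obtain ⟨Q, hQ, h⟩ := B.exists_eq_add_mul_intRing _ hN
  obtain ⟨Q, rfl⟩ := exists_toSeries_eq hQ.1
  change ∀ n ≥ B.e, PowerSeries.coeff n (algebraMap W (FractionRing W) B.ϖ ^ N • B.toSeries f -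
    _ * B.toSeries Q) = 0 at h
  let P := algebraMap W (FractionRing W) B.ϖ ^ N • B.toSeries f -
    (algebraMap W (FractionRing W) B.ϖ)⁻¹ • B.toSeries B.E * B.toSeries Q
  have hP : ((PowerSeries.trunc B.e P : (FractionRing W)[X]) : (FractionRing W)⟦X⟧) = P := by
    ext n
    rw [Polynomial.coeff_coe, PowerSeries.coeff_trunc]
    split_ifs with hn
    · rfl
    · exact (h n (not_lt.1 hn)).symm
  refine ⟨(algebraMap W (FractionRing W) B.ϖ ^ N)⁻¹ • PowerSeries.trunc B.e P,
    ((algebraMap W (FractionRing W) B.ϖ ^ N)⁻¹ * (algebraMap W (FractionRing W) B.ϖ)⁻¹) • Q,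
    B.toSeries_injective ?_⟩
  have hsm : ∀ (a : FractionRing W) (x : B.R), B.toSeries (a • x) = a • B.toSeries x :=
    fun _ _ => rfl
  rw [map_add, map_mul, toSeries_ofPoly, Polynomial.coe_smul, hP, hsm, smul_sub, smul_smul,
    inv_mul_cancel₀ (pow_ne_zero _ hϖ0), one_smul, smul_mul_assoc, smul_smul, mul_smul_comm,
    sub_add_cancel]

/-- The residue ring `R / I` is a field. -/
theorem mem_or_exists_mul_sub_one_mem (a : B.R) :
    B.E ∣ a ∨ ∃ b, B.E ∣ a * b - 1 := by
  obtain ⟨p, Q, rfl⟩ := B.exists_eq_ofPoly_add_mul a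
  have hprime : (Ideal.span {algebraMap OE W B.π}).IsPrime :=
    (Ideal.span_singleton_prime B.irreducible_ϖ.ne_zero).2 B.irreducible_ϖ.prime
  -- Eisenstein's criterion and Gauss's lemma make `E` irreducible over `K₀`. If it does not divide
  -- the remainder `p`, a Bézout relation in `K₀[u]` provides the inverse modulo `E`.
  have hirr : Irreducible B.eis :=
    B.isEisensteinAt_eis.irreducible hprime B.monic_eis.isPrimitive B.e_pos
  have hirr' : Irreducible (B.eis.map (algebraMap W (FractionRing W))) :=
    (B.monic_eis.irreducible_iff_irreducible_map_fraction_map).1 hirr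
  by_cases hd : B.eis.map (algebraMap W (FractionRing W)) ∣ p
  · left
    refine dvd_add ?_ (dvd_mul_right _ _)
    rw [← ofPoly_eis]
    exact map_dvd _ hd
  · right
    obtain ⟨s, t, hst⟩ := (hirr'.coprime_iff_not_dvd).2 hd
    refine ⟨B.ofPoly t, Q * B.ofPoly t - B.ofPoly s, ?_⟩
    have := congrArg B.ofPoly hst
    rw [map_add, map_mul, map_mul, ofPoly_eis, map_one] at this
    linear_combination this

end BKDatum

end BreuilKisin

/-! ### Base change along arbitrary ring maps. -/

namespace BreuilKisin

section ScalarExtension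

variable {A B C : Type*} [CommRing A] [CommRing B] [CommRing C] {σ : A →+* B} {τ : B →+* C}
  {ρ : A →+* C} {M N N' P : Type*} [AddCommGroup M] [Module A M] [AddCommGroup N] [Module B N]
  [AddCommGroup N'] [Module B N'] [AddCommGroup P] [Module C P]

/-- The linear map `σ^* M → N`, `b ⊗ m ↦ b • g m`. -/
noncomputable def Pullback.linearLift (g : M →ₛₗ[σ] N) : Pullback σ M →ₗ[B] N :=
  Pullback.lift (f := σ) (RingHom.id B) (fun _ => rfl) g

@[simp] theorem Pullback.linearLift_unit (g : M →ₛₗ[σ] N) (m : M) :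
    Pullback.linearLift g (Pullback.unit σ m) = g m := Pullback.lift_unit _ _ _ _

theorem Pullback.span_range_unit (σ : A →+* B) :
    Submodule.span B (Set.range (Pullback.unit σ : M →ₛₗ[σ] Pullback σ M)) = ⊤ := by
  let := σ.toAlgebra
  rw [eq_top_iff]
  rintro (x : B ⊗[A] M) -
  induction x with
  | zero => exact Submodule.zero_mem _
  | add x y hx hy => exact Submodule.add_mem _ hx hy
  | tmul b m =>
    have h : (b ⊗ₜ m : B ⊗[A] M) = b • ((1 : B) ⊗ₜ[A] m : B ⊗[A] M) := by
      rw [TensorProduct.smul_tmul', smul_eq_mul, mul_one]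
    rw [h]
    exact Submodule.smul_mem _ b (Submodule.subset_span ⟨m, rfl⟩)

/-- The semilinear map `g : M → N` exhibits `N` as the base change of `M` along `σ`. -/
def IsScalarExtension (g : M →ₛₗ[σ] N) : Prop :=
  Function.Bijective (Pullback.linearLift g)

/-- The bridge to `IsBaseChange`. The algebra structures have to be local: the Frobenius gives a
second map from a ring to itself, which cannot be an instance next to the identity. -/
theorem Pullback.isBaseChange_iff (g : M →ₛₗ[σ] N) :
    letI := σ.toAlgebra
    letI : Module A N := Module.compHom N σ
    haveI : IsScalarTower A B N := ⟨fun a b n => by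
      rw [Algebra.smul_def, mul_smul]; rfl⟩
    IsScalarExtension g ↔ IsBaseChange B
      ({ toFun := g, map_add' := map_add g, map_smul' := map_smulₛₗ g } : M →ₗ[A] N) := by
  let := σ.toAlgebra
  let : Module A N := Module.compHom N σ
  have : IsScalarTower A B N := ⟨fun a b n => by
    rw [Algebra.smul_def, mul_smul]; rfl⟩
  have h : ∀ x : B ⊗[A] M, Pullback.linearLift g x =
      TensorProduct.lift (((Algebra.linearMap B <| Module.End B (M →ₗ[A] N)).flip
      ({ toFun := g, map_add' := map_add g, map_smul' := map_smulₛₗ g } : M →ₗ[A] N)).restrictScalars A) x := by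
    intro x
    induction x with
    | zero => rw [map_zero]; exact map_zero (Pullback.linearLift g)
    | add x y hx hy => rw [map_add, ← hx, ← hy]; exact map_add (Pullback.linearLift g) x y
    | tmul b m => rfl
  change Function.Bijective _ ↔ Function.Bijective _
  rw [← show _ = _ from funext h]
  rfl

/-- Transitivity of base change. -/
theorem IsScalarExtension.comp_iff {g : M →ₛₗ[σ] N} (hg : IsScalarExtension g) (h : N →ₛₗ[τ] P)
    (k : M →ₛₗ[ρ] P) (hρ : ∀ a, ρ a = τ (σ a)) (hk : ∀ m, k m = h (g m)) :
    IsScalarExtension k ↔ IsScalarExtension h := by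
  obtain rfl : ρ = τ.comp σ := RingHom.ext hρ
  let := σ.toAlgebra
  let := τ.toAlgebra
  let := (τ.comp σ).toAlgebra
  have : IsScalarTower A B C := .of_algebraMap_eq' rfl
  let : Module A N := Module.compHom N σ
  have : IsScalarTower A B N := ⟨fun a b n => by
      rw [Algebra.smul_def, mul_smul]; rfl⟩
  let : Module B P := Module.compHom P τ
  have : IsScalarTower B C P := ⟨fun a b n => by
      rw [Algebra.smul_def, mul_smul]; rfl⟩
  let : Module A P := Module.compHom P (τ.comp σ)
  have : IsScalarTower A C P := ⟨fun a b n => by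
      rw [Algebra.smul_def, mul_smul]; rfl⟩
  have : IsScalarTower A B P := ⟨fun a b n => by
      rw [Algebra.smul_def, mul_smul]; rfl⟩
  rw [Pullback.isBaseChange_iff] at hg
  rw [Pullback.isBaseChange_iff, Pullback.isBaseChange_iff]
  rw [← IsBaseChange.comp_iff hg]
  have : (⟨⟨k, map_add k⟩, map_smulₛₗ k⟩ : M →ₗ[A] P) =
    LinearMap.comp ((⟨⟨h, map_add h⟩, map_smulₛₗ h⟩ : N →ₗ[B] P).restrictScalars A)
      (⟨⟨g, map_add g⟩, map_smulₛₗ g⟩ : M →ₗ[A] N) := LinearMap.ext hk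
  rw [← this]

/-- A map back that undoes `g` on `M` is a left inverse of the induced map on `σ^* M`, and the
spanning condition is its surjectivity. -/
theorem IsScalarExtension.of_retraction {g : M →ₛₗ[σ] N} (f : N →ₗ[B] Pullback σ M)
    (hf : ∀ m, f (g m) = Pullback.unit σ m) (hspan : Submodule.span B (Set.range g) = ⊤) :
    IsScalarExtension g := by
  constructor
  · have : f ∘ₗ Pullback.linearLift g = LinearMap.id :=
      LinearMap.ext_on_range (Pullback.span_range_unit σ) fun m => by
        rw [LinearMap.comp_apply, Pullback.linearLift_unit, hf, LinearMap.id_apply]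
    exact Function.LeftInverse.injective (g := f) fun x => LinearMap.congr_fun this x
  · rw [← LinearMap.range_eq_top, eq_top_iff, ← hspan, Submodule.span_le]
    rintro _ ⟨m, rfl⟩
    exact ⟨_, Pullback.linearLift_unit g m⟩

theorem Pullback.isScalarExtension_unit (σ : A →+* B) :
    IsScalarExtension (Pullback.unit σ : M →ₛₗ[σ] Pullback σ M) :=
  .of_retraction LinearMap.id (fun _ => rfl) (Pullback.span_range_unit σ)

/-- The map `M → B ⊗[A] M`, `m ↦ 1 ⊗ m`, as a semilinear map. -/
noncomputable def tensorUnit (A B M : Type*) [CommRing A] [CommRing B] [Algebra A B]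
    [AddCommGroup M] [Module A M] :
    M →ₛₗ[algebraMap A B] B ⊗[A] M where
  toFun m := 1 ⊗ₜ m
  map_add' := TensorProduct.tmul_add _
  map_smul' a m := by rw [TensorProduct.tmul_smul, algebraMap_smul]

@[simp] theorem tensorUnit_apply [Algebra A B] (m : M) : tensorUnit A B M m = 1 ⊗ₜ m := rfl

theorem isScalarExtension_tensorUnit [Algebra A B] : IsScalarExtension (tensorUnit A B M) :=
  .of_retraction (semilinearLift (RingHom.id B) (fun _ => rfl) (Pullback.unit (algebraMap A B)))
    (fun m => by rw [tensorUnit_apply, semilinearLift_tmul, map_one, one_smul]) (by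
      rw [eq_top_iff]
      rintro x -
      induction x with
      | zero => exact Submodule.zero_mem _
      | add x y hx hy => exact Submodule.add_mem _ hx hy
      | tmul b m =>
        have h : (b ⊗ₜ m : B ⊗[A] M) = b • ((1 : B) ⊗ₜ[A] m : B ⊗[A] M) := by
          rw [TensorProduct.smul_tmul', smul_eq_mul, mul_one]
        rw [h]
        exact Submodule.smul_mem _ b (Submodule.subset_span ⟨m, rfl⟩))

namespace IsScalarExtension

variable {g : M →ₛₗ[σ] N} {g' : M →ₛₗ[σ] N'}

/-- Two base changes of a module are isomorphic. -/
theorem exists_equiv (hg : IsScalarExtension g) (hg' : IsScalarExtension g') :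
    ∃ e : N ≃ₗ[B] N', ∀ m, e (g m) = g' m := by
  let e₁ := LinearEquiv.ofBijective (Pullback.linearLift g) hg
  let e₂ := LinearEquiv.ofBijective (Pullback.linearLift g') hg'
  refine ⟨e₁.symm.trans e₂, fun m => ?_⟩
  have h₁ : e₁ (Pullback.unit σ m) = g m := Pullback.linearLift_unit _ _
  have h₂ : e₂ (Pullback.unit σ m) = g' m := Pullback.linearLift_unit _ _
  rw [LinearEquiv.trans_apply, ← h₁, LinearEquiv.symm_apply_apply, h₂]

theorem span_range (hg : IsScalarExtension g) : Submodule.span B (Set.range g) = ⊤ := by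
  rw [← LinearMap.range_eq_top.2 hg.2, LinearMap.range_eq_map, ← Pullback.span_range_unit σ,
    Submodule.map_span, ← Set.range_comp]
  congr 2
  ext m
  exact (Pullback.linearLift_unit g m).symm

/-- Maps out of a base change that are semilinear along `τ` are determined by their values on `M`. -/
theorem hom_ext (hg : IsScalarExtension g) {f f' : N →ₛₗ[τ] P} (h : ∀ m, f (g m) = f' (g m)) :
    f = f' :=
  LinearMap.ext_on_range hg.span_range h

theorem postcomp (hg : IsScalarExtension g) (e : N ≃ₗ[B] N') (hk : ∀ m, g' m = e (g m)) :
    IsScalarExtension g' := by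
  have : ⇑(Pullback.linearLift g') =
      e ∘ Pullback.linearLift g := by
    have h2 : Pullback.linearLift g' =
      e.toLinearMap ∘ₗ Pullback.linearLift g :=
      hom_ext (Pullback.isScalarExtension_unit σ) fun m => by
        rw [LinearMap.comp_apply, Pullback.linearLift_unit, Pullback.linearLift_unit, hk]; rfl
    exact congrArg DFunLike.coe h2
  rw [IsScalarExtension, this]
  exact e.bijective.comp hg

end IsScalarExtension

end ScalarExtension

/-! ### Elementary modifications of projective modules. -/

section Projective

/-- Let `A / E` be a field. A submodule `Q` of a finite projective module `P` over `A` with `E P ⊆ Q` is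
finite projective. -/
theorem finite_projective_of_smul_mem {A : Type*} [CommRing A] [IsDomain A] {E : A} (hE0 : E ≠ 0)
    (hE : ∀ a, E ∣ a ∨ ∃ b, E ∣ a * b - 1) {P : Type*} [AddCommGroup P] [Module A P]
    (Q : Submodule A P) (hEQ : ∀ x, E • x ∈ Q)
    [Module.Finite A P] [Module.Projective A P] : Module.Finite A Q ∧ Module.Projective A Q := by
  -- If `E` is a unit, `A / E` is the zero ring rather than a field, but then `Q` is everything.
  by_cases hu : IsUnit E
  · have hQ : Q = ⊤ := by
      rw [eq_top_iff]
      rintro x -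
      obtain ⟨u, rfl⟩ := hu
      have := hEQ ((↑u⁻¹ : A) • x)
      rwa [smul_smul, Units.mul_inv, one_smul] at this
    rw [hQ]
    exact ⟨inferInstance, .of_equiv (Submodule.topEquiv).symm⟩
  have hmax : (Ideal.span {E}).IsMaximal := by
    refine Ideal.isMaximal_iff.2 ⟨fun h => hu (Ideal.span_singleton_eq_top.1
      ((Ideal.eq_top_iff_one _).2 h)), fun J x hJ hx hxJ => ?_⟩
    obtain h | ⟨b, hb⟩ := hE x
    · exact absurd (Ideal.mem_span_singleton.2 h) hx
    · have h1 := hJ (Ideal.mem_span_singleton.2 hb)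
      have h2 := J.mul_mem_right b hxJ
      simpa using sub_mem h2 h1
  let k := A ⧸ Ideal.span {E}
  let : Field k := Ideal.Quotient.field _
  have htors : Module.IsTorsionBySet A (P ⧸ Q) (Ideal.span {E} : Ideal A) := by
    rintro x ⟨a, ha⟩
    obtain ⟨b, rfl⟩ := Ideal.mem_span_singleton.1 ha
    obtain ⟨y, rfl⟩ := Q.mkQ_surjective x
    change (E * b) • Q.mkQ y = 0
    rw [← map_smul, mul_comm, mul_smul, ← mul_smul, mul_comm, mul_smul, Submodule.mkQ_apply,
      Submodule.Quotient.mk_eq_zero]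
    exact hEQ _
  let : Module k (P ⧸ Q) := htors.module
  have : IsScalarTower A k (P ⧸ Q) := htors.isScalarTower
  have : Module.Finite k (P ⧸ Q) := Module.Finite.of_restrictScalars_finite A k _
  let b := Module.finBasis k (P ⧸ Q)
  let n := Module.finrank k (P ⧸ Q)
  choose y hy using fun i => Q.mkQ_surjective (b i)
  -- the surjection `Q × Aⁿ → P`
  let F : (Fin n → A) →ₗ[A] P := Fintype.linearCombination A y
  have hF : ∀ r, F r = ∑ i, r i • y i := fun r => Fintype.linearCombination_apply A y r
  -- Modulo `Q`, the vector `F r` has the classes of the `r i` as its coordinates in the basis `b`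
  -- of `P / Q`.
  have hFQ : ∀ r, F r ∈ Q ↔ ∀ i, E ∣ r i := by
    intro r
    rw [← Submodule.Quotient.mk_eq_zero, ← Submodule.mkQ_apply, hF, map_sum]
    have h1 : ∀ i, Q.mkQ (r i • y i) = (Ideal.Quotient.mk _ (r i) : k) • b i := by
      intro i
      rw [map_smul, hy, ← algebraMap_smul k]
      rfl
    rw [Finset.sum_congr rfl fun i _ => h1 i]
    constructor
    · intro h i
      have := Fintype.linearIndependent_iff.1 b.linearIndependent _ h i
      rwa [Ideal.Quotient.eq_zero_iff_mem, Ideal.mem_span_singleton] at this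
    · intro h
      refine Finset.sum_eq_zero fun i _ => ?_
      rw [Ideal.Quotient.eq_zero_iff_mem.2 (Ideal.mem_span_singleton.2 (h i)), zero_smul]
  let H : (Q × (Fin n → A)) →ₗ[A] P := Q.subtype.coprod F
  have hH : Function.Surjective H := by
    intro x
    have h1 := b.sum_repr (Q.mkQ x)
    choose r hr using fun i => Ideal.Quotient.mk_surjective (b.repr (Q.mkQ x) i)
    have h2 : Q.mkQ (F r) = Q.mkQ x := by
      rw [hF, map_sum, ← h1]
      refine Finset.sum_congr rfl fun i _ => ?_
      rw [map_smul, hy, ← algebraMap_smul k, ← hr]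
      rfl
    refine ⟨(⟨x - F r, ?_⟩, r), ?_⟩
    · rw [← Submodule.Quotient.mk_eq_zero, ← Submodule.mkQ_apply, map_sub, h2, sub_self]
    · simp [H]
  -- the kernel of `H` is the image of the free module `Aⁿ` under `r ↦ (-F (E r), E r)`
  let κ : (Fin n → A) →ₗ[A] (Q × (Fin n → A)) :=
    ((-(E • F)).codRestrict Q fun r => by
      rw [LinearMap.neg_apply, LinearMap.smul_apply]
      exact neg_mem (hEQ _)).prod (E • LinearMap.id)
  have hκ : Function.Injective κ := by
    intro r s h
    have h2 : E • r = E • s := congrArg Prod.snd h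
    exact smul_right_injective _ hE0 h2
  have hκH : Function.Exact κ H := by
    rintro ⟨⟨x, hx⟩, r⟩
    constructor
    · intro h
      have h1 : x + F r = 0 := h
      have h2 : F r ∈ Q := by
        rw [← neg_eq_of_add_eq_zero_right h1]; exact neg_mem hx
      choose s hs using (hFQ r).1 h2
      have hs' : r = E • s := funext hs
      refine ⟨s, Prod.ext (Subtype.ext ?_) hs'.symm⟩
      change -(E • F s) = x
      rw [← map_smul, ← hs', ← eq_neg_of_add_eq_zero_left h1]
    · rintro ⟨s, hs⟩
      have h1 : -(E • F s) = x := congrArg (fun z => (z.1 : P)) hs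
      have h2 : E • s = r := congrArg Prod.snd hs
      change x + F r = 0
      rw [← h1, ← h2, map_smul, neg_add_cancel]
  -- As in Schanuel's lemma, the sequence `0 → Aⁿ → Q × Aⁿ → P → 0` splits because `P` is
  -- projective. So `Q` is a direct summand of a module isomorphic to `Aⁿ × P`.
  obtain ⟨l, hl⟩ := Module.projective_lifting_property H LinearMap.id hH
  have e := (hκH.splitSurjectiveEquiv hκ ⟨l, hl⟩).1
  have hproj : Module.Projective A (Q × (Fin n → A)) := .of_equiv e.symm
  have hfin : Module.Finite A (Q × (Fin n → A)) := .equiv e.symm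
  exact ⟨.of_surjective (LinearMap.fst A Q (Fin n → A)) Prod.fst_surjective,
    .of_split (LinearMap.inl A Q (Fin n → A)) (LinearMap.fst A Q (Fin n → A)) rfl⟩

end Projective

end BreuilKisin

/-! ### Dual bases, localization at `E`, and the intersection of `R[1/I]` with `𝔖̂₀`. -/

namespace BreuilKisin

section Coordinates

variable {k : Type*} [CommRing k]

/-- The coordinate function `s ⊗ m ↦ s g(m)` of a base change. -/
noncomputable def coordMap (S : Type*) [CommRing S] [Algebra k S] {N : Type*} [AddCommGroup N]
    [Module k N] (g : N →ₗ[k] k) : S ⊗[k] N →ₗ[S] S :=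
  LinearMap.liftBaseChange S (Algebra.linearMap k S ∘ₗ g)

@[simp] theorem coordMap_tmul (S : Type*) [CommRing S] [Algebra k S] {N : Type*} [AddCommGroup N]
    [Module k N] (g : N →ₗ[k] k) (s : S) (m : N) :
    coordMap S g (s ⊗ₜ m) = s * algebraMap k S (g m) := by
  simp [coordMap]

/-- A finite projective module has a finite dual basis. -/
theorem exists_dual_basis (k N : Type*) [CommRing k] [AddCommGroup N] [Module k N] [Module.Finite k N]
    [Module.Projective k N] : ∃ (n : ℕ) (y : Fin n → N) (g : Fin n → N →ₗ[k] k),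
      ∀ m, ∑ i, g i m • y i = m := by
  obtain ⟨n, f, g, -, -, h⟩ := Module.Finite.exists_comp_eq_id_of_projective k N
  refine ⟨n, fun i => f (Pi.single i 1), fun i => LinearMap.proj i ∘ₗ g, fun m => ?_⟩
  conv_rhs => rw [← LinearMap.id_apply (R := k) m, ← h, LinearMap.comp_apply,
    pi_eq_sum_univ' (g m), map_sum]
  refine Finset.sum_congr rfl fun i _ => ?_
  rw [map_smul]
  rfl

/-- A dual basis remains one after base change, so statements on `S ⊗ N` reduce to coordinates in
`S`. -/
theorem sum_coordMap {S N : Type*} [CommRing S] [Algebra k S] [AddCommGroup N] [Module k N]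
    {n : ℕ} {y : Fin n → N} {g : Fin n → N →ₗ[k] k} (h : ∀ m, ∑ i, g i m • y i = m)
    (x : S ⊗[k] N) : ∑ i, coordMap S (g i) x • ((1 : S) ⊗ₜ[k] y i) = x := by
  induction x with
  | zero => simp
  | add x x' hx hx' =>
    conv_rhs => rw [← hx, ← hx']
    simp only [map_add, add_smul, Finset.sum_add_distrib]
  | tmul s m =>
    conv_rhs => rw [← h m, TensorProduct.tmul_sum]
    refine Finset.sum_congr rfl fun i _ => ?_
    rw [coordMap_tmul, TensorProduct.smul_tmul', smul_eq_mul, mul_one, TensorProduct.tmul_smul,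
      TensorProduct.smul_tmul', Algebra.smul_def, mul_comm]

end Coordinates

section Localization

variable {A B : Type*} [CommRing A] [CommRing B] [Algebra A B] {M N : Type*} [AddCommGroup M]
  [Module A M] [AddCommGroup N] [Module A N] [Module B N] [IsScalarTower A B N]

/-- A linear map to a module over an algebra, as a semilinear map. -/
def semilinearOfLinear (B : Type*) [CommRing B] [Algebra A B] [Module B N] [IsScalarTower A B N]
    (f : M →ₗ[A] N) : M →ₛₗ[algebraMap A B] N where
  toFun := f
  map_add' := map_add f
  map_smul' a m := by rw [map_smul, algebraMap_smul]

theorem _root_.IsBaseChange.isScalarExtension {f : M →ₗ[A] N} (h : IsBaseChange B f) :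
    IsScalarExtension (semilinearOfLinear B f) :=
  isScalarExtension_tensorUnit.postcomp h.equiv fun m => by
    rw [tensorUnit_apply, h.equiv_tmul, one_smul]; rfl

/-- A submodule `M` of `N` such that every element of `N` is of the form `m / E ^ n`. -/
theorem isScalarExtension_of_injective {E : A} [IsLocalization.Away E B] {f : M →ₗ[A] N}
    (hf : Function.Injective f) (h : ∀ x : N, ∃ n : ℕ, E ^ n • x ∈ LinearMap.range f) :
    IsScalarExtension (semilinearOfLinear B f) := by
  refine IsBaseChange.isScalarExtension ?_
  have hu : ∀ n : ℕ, IsUnit (algebraMap A B (E ^ n)) := fun n => by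
    rw [map_pow]; exact (IsLocalization.Away.algebraMap_isUnit E).pow n
  rw [← isLocalizedModule_iff_isBaseChange (Submonoid.powers E) B f]
  refine ⟨?_, ?_, ?_⟩
  · rintro ⟨_, n, rfl⟩
    rw [Module.End.isUnit_iff]
    have h1 := (Module.End.isUnit_iff _).1 ((hu n).map (algebraMap B (Module.End B N)))
    convert h1 using 1
    ext x
    change E ^ n • x = algebraMap A B (E ^ n) • x
    rw [algebraMap_smul]
  · intro x
    obtain ⟨n, m, hm⟩ := h x
    exact ⟨(m, ⟨_, n, rfl⟩), hm.symm⟩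
  · intro x y hxy
    exact ⟨1, by rw [hf hxy]⟩

end Localization

/-- Approximation of the elements of the completion at a principal ideal. -/
theorem _root_.AdicCompletion.exists_eq_add_pow_mul {A : Type*} [CommRing A] (E : A)
    (s : AdicCompletion (Ideal.span {E}) A) (n : ℕ) :
    ∃ (r : A) (t : AdicCompletion (Ideal.span {E}) A),
      s = algebraMap A _ r + algebraMap A _ E ^ n * t := by
  obtain ⟨r, hr⟩ := Ideal.Quotient.mk_surjective (AdicCompletion.evalₐ (Ideal.span {E}) n s)
  have h : AdicCompletion.evalₐ (Ideal.span {E}) n (s - algebraMap A _ r) = 0 := by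
    rw [map_sub, AlgHom.commutes, ← hr]
    exact sub_self _
  have hmem : s - algebraMap A _ r ∈
      (Ideal.span {E}) ^ n • (⊤ : Submodule A (AdicCompletion (Ideal.span {E}) A)) := by
    rw [AdicCompletion.pow_smul_top_eq_ker_eval ⟨{E}, by simp⟩, LinearMap.mem_ker]
    rw [← AdicCompletion.factor_evalₐ_eq_eval _ _ (by simp), h, map_zero]
  rw [Ideal.span_singleton_pow, Submodule.ideal_span_singleton_smul,
    Submodule.mem_smul_pointwise_iff_exists] at hmem
  obtain ⟨t, -, ht⟩ := hmem
  refine ⟨r, t, ?_⟩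
  rw [← map_pow, ← sub_eq_iff_eq_add', ← ht, Algebra.smul_def]

namespace BKDatum

variable {OE : Type v} {OK : Type w} {W : Type u}
  [CommRing OE] [IsDomain OE] [IsDiscreteValuationRing OE]
  [CommRing OK] [IsDomain OK] [IsDiscreteValuationRing OK]
  [CommRing W] [IsDomain W] [IsDiscreteValuationRing W]
  [Algebra OE W] [Algebra W OK] (B : BKDatum OE OK W)

/-- The reduction `𝔖̂₀ → R / Iⁿ`. -/
noncomputable def evalS₀ (n : ℕ) : B.S₀ →+* B.R ⧸ (Ideal.span {B.E}) ^ n :=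
  (AdicCompletion.evalₐ (Ideal.span {B.E}) n).toRingHom

theorem evalS₀_algebraMap (n : ℕ) (r : B.R) :
    B.evalS₀ n (algebraMap B.R B.S₀ r) = Ideal.Quotient.mk _ r :=
  (AdicCompletion.evalₐ (Ideal.span {B.E}) n).commutes r

theorem exists_eq_add_pow_mul (s : B.S₀) (n : ℕ) :
    ∃ (r : B.R) (t : B.S₀), s = algebraMap B.R B.S₀ r + algebraMap B.R B.S₀ B.E ^ n * t :=
  AdicCompletion.exists_eq_add_pow_mul B.E s n

theorem toFrS₀_algebraMap (r : B.R) :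
    B.toFrS₀ (algebraMap B.R B.RI r) = algebraMap B.S₀ B.FrS₀ (algebraMap B.R B.S₀ r) := by
  rw [AlgHom.commutes, ← IsScalarTower.algebraMap_apply]

/-- The intersection of `R[1/I]` and `𝔖̂₀` is `R`. -/
theorem exists_algebraMap_eq_of_toFrS₀_eq {x : B.RI} {s : B.S₀}
    (h : B.toFrS₀ x = algebraMap B.S₀ B.FrS₀ s) : ∃ r, algebraMap B.R B.RI r = x := by
  obtain ⟨n, r, hr⟩ := B.exists_pow_mul_eq x
  have h1 : algebraMap B.S₀ B.FrS₀ (algebraMap B.R B.S₀ r) =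
      algebraMap B.S₀ B.FrS₀ (algebraMap B.R B.S₀ B.E ^ n * s) := by
    rw [← toFrS₀_algebraMap, ← hr, map_mul, map_pow, toFrS₀_algebraMap, h, map_mul, map_pow]
  obtain ⟨⟨_, m, rfl⟩, hm⟩ := IsLocalization.exists_of_eq
    (M := Submonoid.powers (algebraMap B.R B.S₀ B.E)) h1
  -- The equality holds in `𝔖̂₀` only after multiplication by `E ^ m`. Reducing modulo `E ^ (m + n)`
  -- avoids any use of regularity of `E` in `𝔖̂₀`: it gives `E ^ (m + n) ∣ E ^ m * r` in the domain
  -- `R`, where `E ^ m` cancels.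
  have h2 := congrArg (B.evalS₀ (m + n)) hm
  have hE : B.evalS₀ (m + n) (algebraMap B.R B.S₀ B.E) ^ (m + n) = 0 := by
    rw [evalS₀_algebraMap, ← map_pow, Ideal.Quotient.eq_zero_iff_mem]
    exact Ideal.pow_mem_pow (Ideal.mem_span_singleton_self _) _
  simp only [map_mul, map_pow] at h2
  rw [← mul_assoc, ← pow_add, hE, zero_mul, evalS₀_algebraMap, evalS₀_algebraMap, ← map_pow,
    ← map_mul, Ideal.Quotient.eq_zero_iff_mem, Ideal.span_singleton_pow,
    Ideal.mem_span_singleton, pow_add] at h2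
  obtain ⟨r', rfl⟩ := (mul_dvd_mul_iff_left (pow_ne_zero m B.E_ne_zero)).1 h2
  refine ⟨r', ((B.isUnit_algebraMap_RI_E.pow n).mul_right_inj).1 ?_⟩
  rw [hr, map_mul, map_pow]

/-- The elements of `N ⊗ R[1/I]` whose image in `N ⊗ Fr(𝔖̂₀)` lies in `N ⊗ 𝔖̂₀` are the elements of
`N ⊗ R`. -/
theorem mem_span_of_toFrS₀_mem {k : Type*} [CommRing k] [Algebra k B.R] [Algebra k B.RI]
    [IsScalarTower k B.R B.RI] [Algebra k B.S₀] [IsScalarTower k B.R B.S₀] [Algebra k B.FrS₀]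
    [IsScalarTower k B.R B.FrS₀] [IsScalarTower k B.S₀ B.FrS₀] {N : Type*} [AddCommGroup N]
    [Module k N] [Module.Finite k N] [Module.Projective k N] (x : B.RI ⊗[k] N)
    (hx : TensorProduct.AlgebraTensorModule.map (A := B.R) B.toFrS₀.toLinearMap
        (LinearMap.id : N →ₗ[k] N) x ∈
      Submodule.span B.S₀ (Set.range fun m : N => (1 : B.FrS₀) ⊗ₜ[k] m)) :
    x ∈ Submodule.span B.R (Set.range fun m : N => (1 : B.RI) ⊗ₜ[k] m) := by
  -- Coordinates reduce the claim to single elements of `R[1/I]`. The base ring `k` is kept general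
  -- because both `D` over `K₀` and `M` over `R` are needed.
  obtain ⟨n, y, g, h⟩ := exists_dual_basis k N
  rw [← sum_coordMap h x]
  refine Submodule.sum_mem _ fun i _ => ?_
  have h1 : ∀ x, B.toFrS₀ (coordMap B.RI (g i) x) = coordMap B.FrS₀ (g i)
      (TensorProduct.AlgebraTensorModule.map (A := B.R) B.toFrS₀.toLinearMap
        (LinearMap.id : N →ₗ[k] N) x) := by
    intro x
    induction x with
    | zero => simp
    | add x y hx hy => simp only [map_add, hx, hy]
    | tmul b m =>
      rw [coordMap_tmul, TensorProduct.AlgebraTensorModule.map_tmul, coordMap_tmul, map_mul,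
        IsScalarTower.algebraMap_apply k B.R B.RI, AlgHom.commutes,
        ← IsScalarTower.algebraMap_apply]
      rfl
  have h2 : ∀ z ∈ Submodule.span B.S₀ (Set.range fun m : N => (1 : B.FrS₀) ⊗ₜ[k] m),
      ∃ s, coordMap B.FrS₀ (g i) z = algebraMap B.S₀ B.FrS₀ s := by
    intro z hz
    induction hz using Submodule.span_induction with
    | mem z hz =>
      obtain ⟨m, rfl⟩ := hz
      exact ⟨algebraMap k B.S₀ (g i m), by
        simp only [coordMap_tmul]
        rw [one_mul, ← IsScalarTower.algebraMap_apply]⟩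
    | zero => exact ⟨0, by simp⟩
    | add z z' _ _ h h' =>
      obtain ⟨s, hs⟩ := h
      obtain ⟨s', hs'⟩ := h'
      exact ⟨s + s', by rw [map_add, hs, hs', map_add]⟩
    | smul s z _ h =>
      obtain ⟨s', hs'⟩ := h
      exact ⟨s * s', by
        rw [← algebraMap_smul B.FrS₀ s z, map_smul, hs', smul_eq_mul, map_mul]⟩
  obtain ⟨s, hs⟩ := h2 _ hx
  rw [← h1] at hs
  obtain ⟨r, hr⟩ := B.exists_algebraMap_eq_of_toFrS₀_eq hs
  rw [← hr, algebraMap_smul]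
  exact Submodule.smul_mem _ _ (Submodule.subset_span ⟨_, rfl⟩)

end BKDatum

end BreuilKisin

/-! ### Lattices and the glueing. -/

namespace BreuilKisin

section Modules

variable {OE : Type v} {OK : Type w} {W : Type u}
  [CommRing OE] [IsDomain OE] [IsDiscreteValuationRing OE]
  [CommRing OK] [IsDomain OK] [IsDiscreteValuationRing OK]
  [CommRing W] [IsDomain W] [IsDiscreteValuationRing W]
  [Algebra OE W] [Algebra W OK]
  {B : BKDatum OE OK W}

/-- Multiplication by a power of `E` on a module over an `R`-algebra in which `E` is invertible. -/
theorem bijective_pow_smul {S V : Type*} [CommRing S] [Algebra B.R S] [AddCommGroup V]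
    [Module B.R V] [Module S V] [IsScalarTower B.R S V] (hE : IsUnit (algebraMap B.R S B.E))
    (n : ℕ) : Function.Bijective fun x : V => B.E ^ n • x := by
  have h1 := (Module.End.isUnit_iff _).1 ((hE.pow n).map (algebraMap S (Module.End S V)))
  convert h1 using 1
  ext x
  change B.E ^ n • x = algebraMap B.R S B.E ^ n • x
  rw [← map_pow, algebraMap_smul]

/-- Submodules of a finitely generated module that become equal after inverting `E`. -/
theorem exists_pow_smul_mem_of_span {A V : Type*} [CommRing A] [AddCommGroup V] [Module A V] (E : A)
    {P Q : Submodule A V} (hP : P.FG) (h : ∀ x ∈ P, ∃ n : ℕ, E ^ n • x ∈ Q) :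
    ∃ n : ℕ, ∀ x ∈ P, E ^ n • x ∈ Q := by
  obtain ⟨s, rfl⟩ := hP
  choose! n hn using fun x (hx : x ∈ s) => h x (Submodule.subset_span hx)
  refine ⟨∑ x ∈ s, n x, fun x hx => ?_⟩
  induction hx using Submodule.span_induction with
  | mem x hx =>
    obtain ⟨d, hd⟩ := Nat.exists_eq_add_of_le
      (Finset.single_le_sum (f := n) (fun _ _ => Nat.zero_le _) hx)
    rw [hd, add_comm, pow_add, mul_smul]
    exact Q.smul_mem _ (hn x hx)
  | zero => rw [smul_zero]; exact Q.zero_mem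
  | add x y _ _ hx hy => rw [smul_add]; exact Q.add_mem hx hy
  | smul a x _ hx => rw [smul_comm]; exact Q.smul_mem _ hx

/-- Every element of a module over a localization is a fraction. -/
theorem exists_pow_smul_mem_span {A S V : Type*} [CommRing A] [CommRing S] [Algebra A S]
    [AddCommGroup V] [Module A V] [Module S V] [IsScalarTower A S V] (E : A)
    [IsLocalization.Away E S] (s : Set V) {x : V} (hx : x ∈ Submodule.span S s) :
    ∃ n : ℕ, E ^ n • x ∈ Submodule.span A s := by
  induction hx using Submodule.span_induction with
  | mem x hx => exact ⟨0, by rw [pow_zero, one_smul]; exact Submodule.subset_span hx⟩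
  | zero => exact ⟨0, by simp⟩
  | add x y _ _ hx hy =>
    obtain ⟨n, hn⟩ := hx
    obtain ⟨m, hm⟩ := hy
    refine ⟨n + m, ?_⟩
    rw [smul_add]
    refine add_mem ?_ ?_
    · rw [add_comm, pow_add, mul_smul]; exact Submodule.smul_mem _ _ hn
    · rw [pow_add, mul_smul]; exact Submodule.smul_mem _ _ hm
  | smul a x _ hx =>
    obtain ⟨n, hn⟩ := hx
    obtain ⟨m, r, hr⟩ := IsLocalization.Away.surj E a
    refine ⟨m + n, ?_⟩
    have : E ^ (m + n) • a • x = r • E ^ n • x := by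
      rw [← algebraMap_smul S r, ← hr, pow_add, mul_smul, smul_comm (E ^ n) a, mul_comm,
        mul_smul, ← map_pow, algebraMap_smul]
    rw [this]
    exact Submodule.smul_mem _ _ hn

/-- Let `A / E` be a field and let `L` be a finite projective module over `A`. A submodule `M ⊆ L` that
contains a multiple `Eⁿ L` is finite projective. -/
theorem finite_projective_of_pow_smul_mem {A : Type*} [CommRing A] [IsDomain A] {E : A} (hE0 : E ≠ 0)
    (hE : ∀ a, E ∣ a ∨ ∃ b, E ∣ a * b - 1) {V : Type*} [AddCommGroup V] [Module A V]
    {M L : Submodule A V} [Module.Finite A L] [Module.Projective A L] (hML : M ≤ L) {n : ℕ}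
    (hn : ∀ x ∈ L, E ^ n • x ∈ M) : Module.Finite A M ∧ Module.Projective A M := by
  induction n generalizing L with
  | zero =>
    have : L = M := le_antisymm (fun x hx => by simpa using hn x hx) hML
    subst this
    exact ⟨inferInstance, inferInstance⟩
  | succ n ih =>
    -- The module `M + E L` contains `E L`, so it is finite projective by the one-step criterion,
    -- and `Eⁿ` already maps it into `M`.
    let L' : Submodule A V := M ⊔ L.map (E • LinearMap.id)
    have hL' : L' ≤ L := sup_le hML (by
      rintro _ ⟨x, hx, rfl⟩
      exact L.smul_mem _ hx)
    obtain ⟨h1, h2⟩ := finite_projective_of_smul_mem hE0 hE (L'.submoduleOf L) fun x => by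
      exact Submodule.mem_sup_right (T := L.map (E • LinearMap.id)) ⟨x, x.2, rfl⟩
    let e := Submodule.submoduleOfEquivOfLe hL'
    have := Module.Finite.equiv e
    have := Module.Projective.of_equiv e
    refine ih (L := L') le_sup_left fun x hx => ?_
    obtain ⟨y, hy, z, ⟨z, hz, rfl⟩, rfl⟩ := Submodule.mem_sup.1 hx
    rw [smul_add]
    refine add_mem (M.smul_mem _ hy) ?_
    have := hn z hz
    rwa [pow_succ, mul_smul] at this

namespace HodgePink

variable (D : HodgePink B)

/-- `D ⊗ R`, as a submodule of `D ⊗ R[1/I]`. -/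
noncomputable def stdLattice : Submodule B.R (B.RI ⊗[FractionRing W] D.carrier) :=
  Submodule.span B.R (Set.range fun d : D.carrier => (1 : B.RI) ⊗ₜ[FractionRing W] d)

/-- `D ⊗ 𝔖̂₀`, as a submodule of `D ⊗ Fr(𝔖̂₀)`. -/
noncomputable def stdLatticeFr : Submodule B.S₀ (B.FrS₀ ⊗[FractionRing W] D.carrier) :=
  Submodule.span B.S₀ (Set.range fun d : D.carrier => (1 : B.FrS₀) ⊗ₜ[FractionRing W] d)

@[simp] theorem toFr_tmul (b : B.RI) (d : D.carrier) : D.toFr (b ⊗ₜ d) = B.toFrS₀ b ⊗ₜ d := rfl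

theorem mem_stdLattice_of_toFr_mem {x : B.RI ⊗[FractionRing W] D.carrier}
    (hx : D.toFr x ∈ D.stdLatticeFr) : x ∈ D.stdLattice :=
  B.mem_span_of_toFrS₀_mem x hx

theorem toFr_mem_stdLatticeFr {x : B.RI ⊗[FractionRing W] D.carrier} (hx : x ∈ D.stdLattice) :
    D.toFr x ∈ D.stdLatticeFr := by
  have h : D.stdLattice ≤ (D.stdLatticeFr.restrictScalars B.R).comap D.toFr := by
    refine Submodule.span_le.2 ?_
    rintro _ ⟨d, rfl⟩
    refine Submodule.subset_span ⟨d, ?_⟩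
    simp
  exact h hx

theorem stdLatticeFr_fg : D.stdLatticeFr.FG := by
  let b := Module.finBasis (FractionRing W) D.carrier
  refine Submodule.fg_def.2 ⟨Set.range fun i => (1 : B.FrS₀) ⊗ₜ[FractionRing W] b i,
    Set.finite_range _, le_antisymm ?_ ?_⟩
  · refine Submodule.span_mono ?_
    rintro _ ⟨i, rfl⟩
    exact ⟨_, rfl⟩
  · refine Submodule.span_le.2 ?_
    rintro _ ⟨d, rfl⟩
    rw [SetLike.mem_coe, ← b.sum_repr d]
    beta_reduce
    rw [TensorProduct.tmul_sum]
    refine Submodule.sum_mem _ fun i _ => ?_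
    rw [TensorProduct.tmul_smul, ← algebraMap_smul B.S₀]
    exact Submodule.smul_mem _ _ (Submodule.subset_span ⟨i, rfl⟩)

theorem span_tmul_eq_top (S : Type*) [CommRing S] [Algebra (FractionRing W) S] :
    Submodule.span S (Set.range fun d : D.carrier => (1 : S) ⊗ₜ[FractionRing W] d) = ⊤ :=
  (isScalarExtension_tensorUnit (A := FractionRing W) (B := S) (M := D.carrier)).span_range

/-- The lattice `Λ` is commensurable with the standard lattice. -/
theorem exists_pow_smul_lattice : ∃ n : ℕ, (∀ x ∈ D.lattice, B.E ^ n • x ∈ D.stdLatticeFr) ∧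
    ∀ x ∈ D.stdLatticeFr, B.E ^ n • x ∈ D.lattice := by
  have := D.isLattice
  obtain ⟨n, hn⟩ := exists_pow_smul_mem_of_span (algebraMap B.R B.S₀ B.E) (P := D.lattice)
    (Q := D.stdLatticeFr) this.fg fun x _ => exists_pow_smul_mem_span (S := B.FrS₀) _ _ (by
      rw [D.span_tmul_eq_top]; trivial)
  obtain ⟨m, hm⟩ := exists_pow_smul_mem_of_span (algebraMap B.R B.S₀ B.E) (P := D.stdLatticeFr)
    (Q := D.lattice) D.stdLatticeFr_fg fun x _ => by
      have h := exists_pow_smul_mem_span (S := B.FrS₀) (algebraMap B.R B.S₀ B.E)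
        (D.lattice : Set (B.FrS₀ ⊗[FractionRing W] D.carrier)) (x := x) (by
          rw [this.span_eq_top]; trivial)
      rwa [Submodule.span_eq] at h
  simp only [← map_pow, algebraMap_smul] at hn hm
  refine ⟨n + m, fun x hx => ?_, fun x hx => ?_⟩
  · rw [add_comm, pow_add, mul_smul]
    exact (D.stdLatticeFr.restrictScalars B.R).smul_mem _ (hn x hx)
  · rw [pow_add, mul_smul]
    exact (D.lattice.restrictScalars B.R).smul_mem _ (hm x hx)

theorem mem_glueing {x : B.RI ⊗[FractionRing W] D.carrier} :
    x ∈ D.glueing ↔ D.toFr x ∈ D.lattice := Iff.rfl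

/-- The glueing is commensurable with the standard lattice. -/
theorem exists_pow_smul_glueing : ∃ n : ℕ, (∀ x ∈ D.glueing, B.E ^ n • x ∈ D.stdLattice) ∧
    ∀ x ∈ D.stdLattice, B.E ^ n • x ∈ D.glueing := by
  obtain ⟨n, h1, h2⟩ := D.exists_pow_smul_lattice
  refine ⟨n, fun x hx => D.mem_stdLattice_of_toFr_mem ?_, fun x hx => ?_⟩
  · rw [map_smul]; exact h1 _ hx
  · rw [mem_glueing, map_smul]; exact h2 _ (D.toFr_mem_stdLatticeFr hx)

/-- The standard lattice is free. -/
theorem exists_basis_stdLattice :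
    Nonempty (Module.Basis (Fin (Module.finrank (FractionRing W) D.carrier)) B.R D.stdLattice) := by
  let b := Module.finBasis (FractionRing W) D.carrier
  let b' := Algebra.TensorProduct.basis B.RI b
  have hb' : ∀ i, b' i = 1 ⊗ₜ b i := fun i => Algebra.TensorProduct.basis_apply _ _
  have hli : LinearIndependent B.R b' := b'.linearIndependent.restrict_scalars fun x y h => by
    simp only [Algebra.smul_def, mul_one] at h
    exact B.algebraMap_RI_injective h
  have hspan : Submodule.span B.R (Set.range b') = D.stdLattice := by
    refine le_antisymm (Submodule.span_mono ?_) (Submodule.span_le.2 ?_)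
    · rintro _ ⟨i, rfl⟩
      exact ⟨b i, (hb' i).symm⟩
    · rintro _ ⟨d, rfl⟩
      rw [SetLike.mem_coe, ← b.sum_repr d]
      beta_reduce
      rw [TensorProduct.tmul_sum]
      refine Submodule.sum_mem _ fun i _ => ?_
      rw [TensorProduct.tmul_smul, ← algebraMap_smul B.R, ← hb']
      exact Submodule.smul_mem _ _ (Submodule.subset_span ⟨i, rfl⟩)
  exact ⟨(Module.Basis.span hli).map (LinearEquiv.ofEq _ _ hspan)⟩

/-- Inverting `E` in the glueing gives back all of `D ⊗ R[1/I]`, whatever the lattice is. -/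
theorem exists_pow_smul_mem_glueing (x : B.RI ⊗[FractionRing W] D.carrier) :
    ∃ n : ℕ, B.E ^ n • x ∈ D.glueing := by
  obtain ⟨n, -, h⟩ := D.exists_pow_smul_glueing
  obtain ⟨m, hm⟩ := exists_pow_smul_mem_span (A := B.R) (S := B.RI) B.E
    (Set.range fun d : D.carrier => (1 : B.RI) ⊗ₜ[FractionRing W] d) (x := x) (by
      rw [D.span_tmul_eq_top]; trivial)
  exact ⟨n + m, by rw [pow_add, mul_smul]; exact h _ hm⟩

/-- The criterion wants a submodule of the free module `D ⊗ R`. The glueing need not be one, but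
`Eⁿ` times it is, and that multiple contains `E^(2n) (D ⊗ R)`. Multiplication by `Eⁿ` is injective,
so the conclusion transfers back. -/
theorem glueing_finite_projective [IsAdicComplete (IsLocalRing.maximalIdeal W) W] :
    Module.Finite B.R D.glueing ∧ Module.Projective B.R D.glueing := by
  obtain ⟨b⟩ := D.exists_basis_stdLattice
  have := Module.Finite.of_basis b
  have := Module.Projective.of_basis b
  obtain ⟨n, h1, h2⟩ := D.exists_pow_smul_glueing
  let μ : (B.RI ⊗[FractionRing W] D.carrier) →ₗ[B.R] (B.RI ⊗[FractionRing W] D.carrier) :=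
    B.E ^ n • LinearMap.id
  have hμ : Function.Injective μ := fun x y h =>
    (bijective_pow_smul (V := B.RI ⊗[FractionRing W] D.carrier) B.isUnit_algebraMap_RI_E n).1 h
  obtain ⟨h3, h4⟩ := finite_projective_of_pow_smul_mem B.E_ne_zero B.mem_or_exists_mul_sub_one_mem
    (M := D.glueing.map μ) (L := D.stdLattice) (n := n + n) (by
      rintro _ ⟨x, hx, rfl⟩
      exact h1 x hx) (fun x hx => ⟨_, h2 x hx, by rw [pow_add, mul_smul]; rfl⟩)
  let e := Submodule.equivMapOfInjective μ hμ D.glueing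
  exact ⟨.equiv e.symm, .of_equiv e.symm⟩

/-- The lattice `Λ` is generated by the glueing. -/
theorem span_toFr_glueing : Submodule.span B.S₀ (D.toFr '' D.glueing) = D.lattice := by
  refine le_antisymm (Submodule.span_le.2 ?_) fun x hx => ?_
  · rintro _ ⟨x, hx, rfl⟩
    exact hx
  obtain ⟨n, h1, h2⟩ := D.exists_pow_smul_lattice
  -- The approximation of `Eⁿ x` has to be good modulo `E^(2n)`: one factor `Eⁿ` is lost on dividing
  -- to return to `x`, and the other moves the error term into `Λ`. The difference then lies in `Λ`,
  -- so the approximating element belongs to the glueing.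
  have happrox : ∀ y ∈ D.stdLatticeFr, ∃ l ∈ D.stdLattice, ∃ t ∈ D.stdLatticeFr,
      y = D.toFr l + B.E ^ (n + n) • t := by
    intro y hy
    induction hy using Submodule.span_induction with
    | mem y hy =>
      obtain ⟨d, rfl⟩ := hy
      exact ⟨1 ⊗ₜ d, Submodule.subset_span ⟨d, rfl⟩, 0, zero_mem _, by simp⟩
    | zero => exact ⟨0, zero_mem _, 0, zero_mem _, by simp⟩
    | add y y' _ _ hy hy' =>
      obtain ⟨l, hl, t, ht, rfl⟩ := hy
      obtain ⟨l', hl', t', ht', rfl⟩ := hy'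
      exact ⟨l + l', add_mem hl hl', t + t', add_mem ht ht', by
        rw [map_add, smul_add]; abel⟩
    | smul s y _ hy =>
      obtain ⟨l, hl, t, ht, rfl⟩ := hy
      obtain ⟨r, s', rfl⟩ := B.exists_eq_add_pow_mul s (n + n)
      refine ⟨r • l, Submodule.smul_mem _ _ hl,
        s' • D.toFr l + (algebraMap B.R B.S₀ r + algebraMap B.R B.S₀ B.E ^ (n + n) * s') • t,
        add_mem (Submodule.smul_mem _ _ (D.toFr_mem_stdLatticeFr hl)) (Submodule.smul_mem _ _ ht), ?_⟩
      rw [map_smul, smul_add, smul_add, add_smul, algebraMap_smul, mul_smul, ← map_pow,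
        algebraMap_smul, add_assoc, smul_comm (B.E ^ (n + n)) _ t]
  obtain ⟨l, hl, t, ht, hlt⟩ := happrox _ (h1 x hx)
  obtain ⟨y, hy⟩ := (bijective_pow_smul B.isUnit_algebraMap_RI_E n).2 l
  have hxy : x = D.toFr y + B.E ^ n • t := by
    apply (bijective_pow_smul (V := B.FrS₀ ⊗[FractionRing W] D.carrier)
      B.isUnit_algebraMap_E n).1
    simp only at hy ⊢
    rw [smul_add, ← map_smul, hy, hlt, pow_add, mul_smul]
  have hy' : y ∈ D.glueing := by
    rw [mem_glueing, ← sub_eq_of_eq_add hxy]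
    exact sub_mem hx (h2 t ht)
  rw [hxy]
  refine add_mem (Submodule.subset_span ⟨y, hy', rfl⟩) ?_
  -- The error `Eⁿ t` is an `𝔖̂₀`-combination of the vectors `Eⁿ (1 ⊗ d)`, which come from the
  -- glueing.
  have h5 : D.stdLatticeFr ≤ ((Submodule.span B.S₀ (D.toFr '' D.glueing)).comap
      (algebraMap B.R B.S₀ (B.E ^ n) • LinearMap.id)) := by
    refine Submodule.span_le.2 ?_
    rintro _ ⟨d, rfl⟩
    refine Submodule.subset_span ⟨B.E ^ n • (1 ⊗ₜ d), ?_, ?_⟩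
    · rw [SetLike.mem_coe, mem_glueing, map_smul, toFr_tmul, map_one]
      exact h2 _ (Submodule.subset_span ⟨d, rfl⟩)
    · rw [map_smul, toFr_tmul, map_one, LinearMap.smul_apply, algebraMap_smul, LinearMap.id_apply]
  have h6 := h5 ht
  rwa [Submodule.mem_comap, LinearMap.smul_apply, algebraMap_smul, LinearMap.id_apply] at h6

end HodgePink

end Modules

end BreuilKisin

/-! ### Existence, uniqueness and bijectivity of the Frobenius lift. -/

namespace BreuilKisin

/-- The inverse matrix of the Frobenius of an isocrystal. -/
theorem exists_frobenius_inverse {K D : Type*} [Field K] [AddCommGroup D] [Module K D] {σ : K →+* K}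
    (φ : D →ₛₗ[σ] D) (hφ : Submodule.span K (Set.range φ) = ⊤) {n : ℕ}
    (b : Module.Basis (Fin n) K D) :
    ∃ C : Fin n → Fin n → K, (∀ j, b j = ∑ l, C l j • φ (b l)) ∧
      ∀ l j, ∑ i, C l i * b.repr (φ (b j)) i = if l = j then 1 else 0 := by
  have hspan : Submodule.span K (Set.range fun l => φ (b l)) = ⊤ := by
    rw [eq_top_iff, ← hφ, Submodule.span_le]
    rintro _ ⟨d, rfl⟩
    rw [SetLike.mem_coe, ← b.sum_repr d, map_sum]
    refine Submodule.sum_mem _ fun i _ => ?_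
    rw [map_smulₛₗ]
    exact Submodule.smul_mem _ _ (Submodule.subset_span ⟨i, rfl⟩)
  have h1 : ∀ j, ∃ c : Fin n → K, ∑ l, c l • φ (b l) = b j := fun j =>
    (Submodule.mem_span_range_iff_exists_fun _).1 (by rw [hspan]; trivial)
  choose c hc using h1
  refine ⟨fun l j => c j l, fun j => (hc j).symm, ?_⟩
  let Φ : Matrix (Fin n) (Fin n) K := fun i j => b.repr (φ (b j)) i
  let C : Matrix (Fin n) (Fin n) K := fun l j => c j l
  have hΦC : Φ * C = 1 := by
    ext i j
    rw [Matrix.mul_apply, Matrix.one_apply]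
    have := congrArg (fun d => b.repr d i) (hc j)
    simp only [map_sum, map_smul, Finsupp.coe_finsetSum, Finset.sum_apply, Finsupp.smul_apply,
      smul_eq_mul, Module.Basis.repr_self, Finsupp.single_apply] at this
    simp only [eq_comm (a := j)] at this
    rw [← this]
    exact Finset.sum_congr rfl fun l _ => mul_comm _ _
  have hCΦ := mul_eq_one_comm.1 hΦC
  intro l j
  have := congrFun (congrFun hCΦ l) j
  rwa [Matrix.mul_apply, Matrix.one_apply] at this

/-- Needed because fixed points are sought in `Hom(D, M[1/I])`, written as a finite power of
`M[1/I]`. -/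
instance _root_.Module.Projective.pi_of_finite {R N ι : Type*} [CommRing R] [AddCommGroup N] [Module R N]
    [Finite ι] [Module.Projective R N] : Module.Projective R (ι → N) := by
  classical
  have := Fintype.ofFinite ι
  exact .of_equiv (DFinsupp.linearEquivFunOnFintype (R := R) (ι := ι) (M := fun _ => N))

section Modules

variable {OE : Type v} {OK : Type w} {W : Type u}
  [CommRing OE] [IsDomain OE] [IsDiscreteValuationRing OE]
  [CommRing OK] [IsDomain OK] [IsDiscreteValuationRing OK]
  [CommRing W] [IsDomain W] [IsDiscreteValuationRing W]
  [Algebra OE W] [Algebra W OK] {B : BKDatum OE OK W}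

/-- An element of a projective `R[1/I]`-module that is zero modulo `u`. -/
def VanishesAtZero {H : Type*} [AddCommGroup H] [Module B.RI H] (x : H) : Prop :=
  ∀ g : H →ₗ[B.RI] B.RI, B.evRI (g x) = 0

section FixedPoints

variable [Finite (IsLocalRing.ResidueField OE)] {H : Type*} [AddCommGroup H] [Module B.RI H]
  [Module.Finite B.RI H] [Module.Projective B.RI H]

/-- **Dwork's trick**: fixed points of the Frobenius modulo `u` lift to fixed points. -/
theorem exists_fixed_point (ψ : H →ₛₗ[B.frobRI] H) (h : H) (hψ : VanishesAtZero (B := B) (ψ h - h)) :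
    ∃ x, ψ x = x ∧ VanishesAtZero (B := B) (x - h) := by
  obtain ⟨n, y, g, hg⟩ := exists_dual_basis B.RI H
  have hsum : ∀ (i : Fin n) (z : Fin n → B.RI), ∑ j, g i (ψ (y j)) * B.frobRI (z j) =
      g i (ψ (∑ j, z j • y j)) := by
    intro i z
    rw [map_sum, map_sum]
    refine Finset.sum_congr rfl fun j _ => ?_
    rw [map_smulₛₗ, map_smul, smul_eq_mul, mul_comm]
  -- The matrix of `ψ` on the generators `y` defines the system; the coordinates of `h` solve it
  -- modulo `u` by hypothesis. The generators may have relations, but a solution of the system still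
  -- gives a fixed element.
  obtain ⟨z, hz0, hz⟩ := B.exists_fixed_vector (fun i j => g i (ψ (y j)))
    (fun i => B.evRI (g i h)) fun i => by
      have h1 := hψ (g i)
      rw [map_sub, map_sub, sub_eq_zero] at h1
      rw [← h1]
      conv_rhs => rw [← hg h, ← hsum, map_sum]
      simp only [map_mul, B.evRI_frobRI]
  have hx : ψ (∑ j, z j • y j) = ∑ j, z j • y j := by
    conv_lhs => rw [← hg (ψ (∑ j, z j • y j))]
    refine Finset.sum_congr rfl fun i _ => ?_
    rw [← hsum, hz]
  refine ⟨_, hx, fun f => ?_⟩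
  have h2 : ∀ i, B.evRI (g i (∑ j, z j • y j - h)) = 0 := by
    intro i
    rw [← hx, map_sub, ← hsum, hz, map_sub, hz0, sub_self]
  rw [← hg (∑ j, z j • y j - h), map_sum, map_sum]
  refine Finset.sum_eq_zero fun i _ => ?_
  rw [map_smul, smul_eq_mul, map_mul, h2, zero_mul]

/-- The coordinates satisfy a Frobenius system and vanish at `u = 0`, so by contraction they are
divisible by every power of `u`. -/
theorem eq_zero_of_fixed (ψ : H →ₛₗ[B.frobRI] H) {x : H} (hx : ψ x = x)
    (h0 : VanishesAtZero (B := B) x) : x = 0 := by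
  obtain ⟨n, y, g, hg⟩ := exists_dual_basis B.RI H
  have hsum : ∀ i, g i x = ∑ j, g i (ψ (y j)) * B.frobRI (g j x) := by
    intro i
    conv_lhs => rw [← hx, ← hg x, map_sum, map_sum]
    refine Finset.sum_congr rfl fun j _ => ?_
    rw [map_smulₛₗ, map_smul, smul_eq_mul, mul_comm]
  have key : ∀ k ≥ 1, ∀ i, PowerSeries.X ^ k ∣ B.serRI (g i x) := by
    intro k hk
    induction k, hk using Nat.le_induction with
    | base =>
      intro i
      rw [pow_one, PowerSeries.X_dvd_iff, B.constantCoeff_serRI, h0]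
    | succ k hk ih =>
      intro i
      rw [hsum, map_sum]
      refine Finset.dvd_sum fun j _ => ?_
      rw [map_mul, B.serRI_frobRI]
      exact (B.X_pow_succ_dvd_frobSeries hk (ih j)).mul_left _
  rw [← hg x]
  refine Finset.sum_eq_zero fun i _ => ?_
  have : g i x = 0 := B.serRI_injective (by
    rw [map_zero]
    exact PowerSeries.eq_zero_of_forall_X_pow_dvd fun k hk => key k hk i)
  rw [this, zero_smul]

end FixedPoints

namespace PhiModule

variable [Finite (IsLocalRing.ResidueField OE)] (M : PhiModule B)

@[simp] theorem red_tmul (b : B.RI) (m : M.carrier) :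
    M.red (b ⊗ₜ m) = B.evRI b • Pullback.unit B.evR m := rfl

@[simp] theorem phiRI_tmul (b : B.RI) (m : M.carrier) :
    M.phiRI (b ⊗ₜ m) = B.frobRI b • M.phi m := rfl

@[simp] theorem fibrePhi_unit (m : M.carrier) :
    M.fibrePhi (Pullback.unit B.evR m) = M.red (M.phi m) := Pullback.lift_unit _ _ _ _

theorem red_phiRI (x : B.RI ⊗[B.R] M.carrier) : M.red (M.phiRI x) = M.fibrePhi (M.red x) := by
  induction x with
  | zero => simp
  | add x y hx hy => rw [map_add, map_add, hx, hy, map_add, map_add]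
  | tmul b m =>
    rw [phiRI_tmul, map_smulₛₗ, B.evRI_frobRI, red_tmul, map_smulₛₗ, fibrePhi_unit]

/-- Bijectivity of `φ_M`, restated for the semilinear map. Transitivity of base change then passes
it on to `M[1/I]` and to the fibre. -/
theorem isScalarExtension_phi : IsScalarExtension M.phi := by
  have h : IsScalarExtension (M.frob.toLinearMap.comp
      (tensorUnit B.R B.RI (Pullback B.frobR M.carrier))) :=
    isScalarExtension_tensorUnit.postcomp M.frob fun _ => rfl
  exact ((Pullback.isScalarExtension_unit B.frobR).comp_iff _ M.phi (fun _ => rfl)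
    fun _ => rfl).2 h

theorem isScalarExtension_phiRI : IsScalarExtension M.phiRI :=
  (isScalarExtension_tensorUnit.comp_iff M.phiRI M.phi
    (fun r => (B.frobRI_algebraMap r).symm) fun m => by
      rw [tensorUnit_apply, phiRI_tmul, map_one, one_smul]).1 M.isScalarExtension_phi

theorem isScalarExtension_red : IsScalarExtension M.red :=
  (isScalarExtension_tensorUnit.comp_iff M.red (Pullback.unit B.evR)
    (fun r => (B.evRI_algebraMap r).symm) fun m => by
      rw [tensorUnit_apply, red_tmul, map_one, one_smul]).1 (Pullback.isScalarExtension_unit _)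

/-- The map `redPhi` factors in two ways: as `φ_M` followed by reduction, and as reduction followed
by `fibrePhi`. The first factorization shows that it is a base change, the second transfers this to
`fibrePhi`. Hence `D(M)` is an isocrystal. -/
theorem isScalarExtension_fibrePhi : IsScalarExtension M.fibrePhi :=
  ((Pullback.isScalarExtension_unit B.evR).comp_iff M.fibrePhi M.redPhi (fun _ => rfl)
    fun m => (M.fibrePhi_unit m).symm).1
    ((M.isScalarExtension_phi.comp_iff M.red M.redPhi (fun r => (evRI_comp r).symm)
      fun _ => rfl).2 M.isScalarExtension_red)

theorem red_surjective : Function.Surjective M.red := by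
  intro d
  have : d ∈ Submodule.span (FractionRing W) (Set.range (Pullback.unit B.evR : M.carrier →ₛₗ[B.evR] M.fibre)) := by
    rw [Pullback.span_range_unit]; trivial
  induction this using Submodule.span_induction with
  | mem d hd =>
    obtain ⟨m, rfl⟩ := hd
    exact ⟨1 ⊗ₜ m, by rw [red_tmul, map_one, one_smul]⟩
  | zero => exact ⟨0, map_zero _⟩
  | add d d' _ _ h h' =>
    obtain ⟨x, rfl⟩ := h
    obtain ⟨x', rfl⟩ := h'
    exact ⟨x + x', map_add _ _ _⟩
  | smul a d _ h =>
    obtain ⟨x, rfl⟩ := h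
    exact ⟨algebraMap (FractionRing W) B.RI a • x, by rw [map_smulₛₗ, B.evRI_algebraMap_K]⟩

/-- A functional on `M[1/I]`, evaluated at `u = 0`, factors through `D(M)`. Conversely the
coordinate functionals of a dual basis detect the reduction. -/
theorem vanishesAtZero_iff (x : B.RI ⊗[B.R] M.carrier) :
    VanishesAtZero (B := B) x ↔ M.red x = 0 := by
  constructor
  · intro h
    obtain ⟨n, y, g, hg⟩ := exists_dual_basis B.R M.carrier
    rw [← sum_coordMap hg x, map_sum]
    refine Finset.sum_eq_zero fun i _ => ?_
    rw [map_smulₛₗ, h, zero_smul]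
  · intro h g
    let g' : M.carrier →ₛₗ[B.evR] FractionRing W :=
      { toFun := fun m => B.evRI (g (1 ⊗ₜ m))
        map_add' := fun x y => by rw [TensorProduct.tmul_add, map_add, map_add]
        map_smul' := fun r m => by
          rw [TensorProduct.tmul_smul, ← algebraMap_smul B.RI, map_smul, smul_eq_mul, map_mul,
            B.evRI_algebraMap, smul_eq_mul] }
    have key : ∀ x, B.evRI (g x) = Pullback.linearLift g' (M.red x) := by
      intro x
      induction x with
      | zero => simp
      | add x y hx hy => rw [map_add, map_add, map_add, map_add, hx, hy]
      | tmul b m =>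
        rw [red_tmul, map_smul, Pullback.linearLift_unit, ← mul_one b, ← smul_eq_mul,
          ← TensorProduct.smul_tmul', map_smul, smul_eq_mul, map_mul]
        simp [g']
    rw [key, h, map_zero]

/-- The Frobenius of `M[1/I]` is semilinear over `K₀`. -/
theorem phiRI_smul_K (a : FractionRing W) (x : B.RI ⊗[B.R] M.carrier) :
    M.phiRI (a • x) = B.frobK a • M.phiRI x := by
  rw [← algebraMap_smul B.RI, map_smulₛₗ, B.frobRI_algebraMap_K, algebraMap_smul]

theorem red_smul_K (a : FractionRing W) (x : B.RI ⊗[B.R] M.carrier) :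
    M.red (a • x) = a • M.red x := by
  rw [← algebraMap_smul B.RI, map_smulₛₗ, B.evRI_algebraMap_K]

instance : Module.Finite (FractionRing W) M.fibre := by
  obtain ⟨n, y, g, hg⟩ := exists_dual_basis B.R M.carrier
  refine ⟨Submodule.fg_def.2 ⟨Set.range fun i => Pullback.unit B.evR (y i), Set.finite_range _, ?_⟩⟩
  rw [eq_top_iff, ← Pullback.span_range_unit B.evR, Submodule.span_le]
  rintro _ ⟨m, rfl⟩
  rw [SetLike.mem_coe, ← hg m, map_sum]
  refine Submodule.sum_mem _ fun i _ => ?_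
  rw [map_smulₛₗ]
  exact Submodule.smul_mem _ _ (Submodule.subset_span ⟨i, rfl⟩)

section Lift

variable {D : Type*} [AddCommGroup D] [Module (FractionRing W) D]
  [Module.Finite (FractionRing W) D] (φ : D →ₛₗ[B.frobK] D)
  (hφ : Submodule.span (FractionRing W) (Set.range φ) = ⊤)

/-- The operator `x ↦ φ_M ∘ x ∘ φ_D⁻¹` on `Hom(D, M[1/I])`, in coordinates. -/
noncomputable def homFrob {n : ℕ} (C : Fin n → Fin n → FractionRing W) :
    (Fin n → B.RI ⊗[B.R] M.carrier) →ₛₗ[B.frobRI] (Fin n → B.RI ⊗[B.R] M.carrier) where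
  toFun x j := ∑ l, C l j • M.phiRI (x l)
  map_add' x y := by
    ext j
    simp only [Pi.add_apply, map_add, smul_add, Finset.sum_add_distrib]
  map_smul' a x := by
    ext j
    simp only [Pi.smul_apply, map_smulₛₗ, Finset.smul_sum]
    exact Finset.sum_congr rfl fun l _ => smul_comm _ _ _

theorem vanishesAtZero_pi {n : ℕ} {x : Fin n → B.RI ⊗[B.R] M.carrier} (h : ∀ i, M.red (x i) = 0) :
    VanishesAtZero (B := B) x := by
  intro g
  have h1 : x = ∑ i, LinearMap.single B.RI (fun _ => B.RI ⊗[B.R] M.carrier) i (x i) := by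
    ext i
    simp [LinearMap.single_apply, Finset.sum_apply, Pi.single_apply]
  rw [h1, map_sum, map_sum]
  exact Finset.sum_eq_zero fun i _ => (M.vanishesAtZero_iff _).2 (h i)
    (g ∘ₗ LinearMap.single B.RI (fun _ => B.RI ⊗[B.R] M.carrier) i)

theorem red_of_vanishesAtZero_pi {n : ℕ} {x : Fin n → B.RI ⊗[B.R] M.carrier}
    (h : VanishesAtZero (B := B) x) (i : Fin n) : M.red (x i) = 0 :=
  (M.vanishesAtZero_iff _).1 fun g => h (g ∘ₗ LinearMap.proj i)

include hφ in
/-- Equivariant maps from an isocrystal to `M[1/I]` are determined by their reduction modulo `u`. -/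
theorem eq_zero_of_equivariant (δ : D →ₗ[FractionRing W] B.RI ⊗[B.R] M.carrier)
    (hδ : ∀ d, δ (φ d) = M.phiRI (δ d)) (h0 : ∀ d, M.red (δ d) = 0) : δ = 0 := by
  let b := Module.finBasis (FractionRing W) D
  obtain ⟨C, hC, -⟩ := exists_frobenius_inverse φ hφ b
  have h1 := eq_zero_of_fixed (M.homFrob C) (x := fun j => δ (b j)) (by
    ext j
    change ∑ l, C l j • M.phiRI (δ (b l)) = δ (b j)
    conv_rhs => rw [hC j, map_sum]
    exact Finset.sum_congr rfl fun l _ => by rw [map_smul, hδ]) (M.vanishesAtZero_pi fun j => h0 _)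
  exact b.ext fun j => congrFun h1 j

include hφ in
/-- Equivariant maps from an isocrystal to `D(M)` lift to equivariant maps to `M[1/I]`. -/
theorem exists_equivariant (δ₀ : D →ₗ[FractionRing W] M.fibre)
    (hδ₀ : ∀ d, δ₀ (φ d) = M.fibrePhi (δ₀ d)) :
    ∃ δ : D →ₗ[FractionRing W] B.RI ⊗[B.R] M.carrier,
      (∀ d, M.red (δ d) = δ₀ d) ∧ ∀ d, δ (φ d) = M.phiRI (δ d) := by
  let b := Module.finBasis (FractionRing W) D
  obtain ⟨C, hC, hC'⟩ := exists_frobenius_inverse φ hφ b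
  choose h hh using fun j => M.red_surjective (δ₀ (b j))
  obtain ⟨x, hx, hxh⟩ := exists_fixed_point (M.homFrob C) h (M.vanishesAtZero_pi fun j => by
    change M.red ((∑ l, C l j • M.phiRI (h l)) - h j) = 0
    rw [map_sub, hh, map_sum, sub_eq_zero]
    conv_rhs => rw [hC j, map_sum]
    refine Finset.sum_congr rfl fun l _ => ?_
    rw [red_smul_K, red_phiRI, hh, map_smul, hδ₀])
  have hred : ∀ j, M.red (x j) = δ₀ (b j) := by
    intro j
    have h1 := M.red_of_vanishesAtZero_pi hxh j
    rw [Pi.sub_apply, map_sub, hh, sub_eq_zero] at h1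
    exact h1
  have hfix : ∀ j, ∑ l, C l j • M.phiRI (x l) = x j := fun j => congrFun hx j
  let δ := b.constr (FractionRing W) x
  have hδ : ∀ j, δ (b j) = x j := fun j => b.constr_basis _ _ _
  refine ⟨δ, fun d => ?_, fun d => ?_⟩
  · rw [← b.sum_repr d, map_sum, map_sum, map_sum]
    refine Finset.sum_congr rfl fun i _ => ?_
    rw [map_smul, red_smul_K, map_smul, hδ, hred]
  -- Being fixed by `homFrob` says `φ_M ∘ δ ∘ φ_D⁻¹ = δ` on the basis. Moving `φ_D` to the other
  -- side uses that `C` is also a left inverse of the Frobenius matrix, which is `hC'`.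
  · have hb : ∀ j, δ (φ (b j)) = M.phiRI (δ (b j)) := by
      intro j
      rw [← b.sum_repr (φ (b j)), map_sum, hδ]
      have h1 : ∀ i, δ (b.repr (φ (b j)) i • b i) =
          ∑ l, (C l i * b.repr (φ (b j)) i) • M.phiRI (x l) := by
        intro i
        rw [map_smul, hδ, ← hfix i, Finset.smul_sum]
        exact Finset.sum_congr rfl fun l _ => by rw [smul_smul, mul_comm]
      rw [Finset.sum_congr rfl fun i _ => h1 i, Finset.sum_comm]
      simp only [← Finset.sum_smul, hC', ite_smul, one_smul, zero_smul]
      simp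
    rw [← b.sum_repr d, map_sum, map_sum, map_sum, map_sum]
    refine Finset.sum_congr rfl fun i _ => ?_
    rw [map_smulₛₗ, map_smul, map_smul, hb, phiRI_smul_K]

end Lift

/-- There is exactly one Frobenius-equivariant lift `ξ` of the identity of `D(M)`. -/
theorem existsUnique_isFrobeniusLift : ∃! ξ, M.IsFrobeniusLift ξ := by
  have hφ := M.isScalarExtension_fibrePhi.span_range
  obtain ⟨δ, h1, h2⟩ := M.exists_equivariant M.fibrePhi hφ LinearMap.id fun _ => rfl
  refine ⟨LinearMap.liftBaseChange B.RI δ, ⟨fun d => ?_, fun d => ?_⟩, fun ξ hξ => ?_⟩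
  · rw [LinearMap.liftBaseChange_tmul, one_smul]; exact h1 d
  · rw [LinearMap.liftBaseChange_tmul, LinearMap.liftBaseChange_tmul, one_smul, one_smul]
    exact h2 d
  · let δ' : M.fibre →ₗ[FractionRing W] B.RI ⊗[B.R] M.carrier :=
      ξ.restrictScalars (FractionRing W) ∘ₗ TensorProduct.mk (FractionRing W) B.RI M.fibre 1
    have h3 : δ' - δ = 0 := M.eq_zero_of_equivariant M.fibrePhi hφ (δ' - δ)
      (fun d => by
        rw [LinearMap.sub_apply, LinearMap.sub_apply, map_sub, h2]
        exact congrArg (· - _) (hξ.2 d))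
      fun d => by
        rw [LinearMap.sub_apply, map_sub, h1]
        exact sub_eq_zero.2 (hξ.1 d)
    refine isScalarExtension_tensorUnit.hom_ext (A := FractionRing W) fun d => ?_
    rw [tensorUnit_apply, LinearMap.liftBaseChange_tmul, one_smul]
    have h4 : δ' d - δ d = 0 := LinearMap.congr_fun h3 d
    exact sub_eq_zero.1 h4

variable {M}
variable {ξ : (B.RI ⊗[FractionRing W] M.fibre) →ₗ[B.RI] (B.RI ⊗[B.R] M.carrier)}

theorem IsFrobeniusLift.phiRI_mem_range (hξ : M.IsFrobeniusLift ξ)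
    (z : B.RI ⊗[FractionRing W] M.fibre) : M.phiRI (ξ z) ∈ LinearMap.range ξ := by
  induction z with
  | zero => rw [map_zero, map_zero]; exact zero_mem _
  | add x y hx hy => rw [map_add, map_add]; exact add_mem hx hy
  | tmul b d =>
    have : (b ⊗ₜ d : B.RI ⊗[FractionRing W] M.fibre) = b • (1 ⊗ₜ d) := by
      rw [TensorProduct.smul_tmul', smul_eq_mul, mul_one]
    rw [this, map_smul, map_smulₛₗ, ← hξ.2]
    exact Submodule.smul_mem _ _ ⟨_, rfl⟩

/-- Modulo `u` the map `ξ` is onto, so Nakayama gives an `a` with `a(0) = 1` that kills the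
cokernel. Such an `a` may have zeros on the disc; the Frobenius pushes them out. -/
theorem IsFrobeniusLift.surjective (hξ : M.IsFrobeniusLift ξ) : Function.Surjective ξ := by
  obtain ⟨n, y, g, hg⟩ := exists_dual_basis B.R M.carrier
  obtain ⟨a, ha, ha'⟩ := Submodule.exists_sub_one_mem_and_smul_eq_zero_of_fg_of_le_smul
    (RingHom.ker B.evRI) (⊤ : Submodule B.RI ((B.RI ⊗[B.R] M.carrier) ⧸ LinearMap.range ξ))
    Module.Finite.fg_top (by
      rintro q -
      obtain ⟨x, rfl⟩ := Submodule.mkQ_surjective _ q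
      have h1 : M.red (x - ξ (1 ⊗ₜ M.red x)) = 0 := by rw [map_sub, hξ.1, sub_self]
      have h2 : (LinearMap.range ξ).mkQ x =
          (LinearMap.range ξ).mkQ (x - ξ (1 ⊗ₜ M.red x)) := by
        rw [map_sub, eq_comm, sub_eq_self]
        exact (Submodule.Quotient.mk_eq_zero _).2 ⟨_, rfl⟩
      rw [h2, ← sum_coordMap hg (x - ξ (1 ⊗ₜ M.red x)), map_sum]
      refine Submodule.sum_mem _ fun i _ => ?_
      rw [map_smul]
      exact Submodule.smul_mem_smul ((M.vanishesAtZero_iff _).2 h1 _) trivial)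
  have hev : B.evRI a = 1 := by
    rw [RingHom.mem_ker, map_sub, map_one, sub_eq_zero] at ha
    exact ha
  have hmem : ∀ x, a • x ∈ LinearMap.range ξ := fun x => by
    rw [← Submodule.Quotient.mk_eq_zero, Submodule.Quotient.mk_smul]
    exact ha' _ trivial
  -- If `c M[1/I]` lies in the image, so does `φ_q(c) M[1/I]`: the elements `φ_M(y)` span `M[1/I]`,
  -- one has `φ_q(c) φ_M(y) = φ_M(c y)`, and the image is Frobenius-stable.
  have hiter : ∀ k x, B.frobRI^[k] a • x ∈ LinearMap.range ξ := by
    intro k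
    induction k with
    | zero => exact hmem
    | succ k ih =>
      intro x
      rw [Function.iterate_succ_apply']
      have hx : x ∈ Submodule.span B.RI (Set.range M.phiRI) := by
        rw [M.isScalarExtension_phiRI.span_range]; trivial
      induction hx using Submodule.span_induction with
      | mem x hx =>
        obtain ⟨y, rfl⟩ := hx
        rw [← map_smulₛₗ]
        obtain ⟨z, hz⟩ := ih y
        rw [← hz]
        exact hξ.phiRI_mem_range z
      | zero => rw [smul_zero]; exact zero_mem _
      | add x y _ _ hx hy => rw [smul_add]; exact add_mem hx hy
      | smul c x _ hx => rw [smul_comm]; exact Submodule.smul_mem _ _ hx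
  obtain ⟨k, hk⟩ := B.exists_isUnit_frobRI_iterate a hev
  intro x
  obtain ⟨c, hc⟩ := hk.exists_left_inv
  have := Submodule.smul_mem _ c (hiter k x)
  rwa [smul_smul, hc, one_smul] at this

/-- Surjectivity onto a projective module gives a section `s`. Since `ξ s ξ = ξ` and `ξ` is the
identity modulo `u`, the matrix of `s ∘ ξ` reduces to the identity, so its determinant is nonzero in
the domain `R[1/I]`. No comparison of ranks is needed. -/
theorem IsFrobeniusLift.injective (hξ : M.IsFrobeniusLift ξ) : Function.Injective ξ := by
  obtain ⟨s, hs⟩ := Module.projective_lifting_property ξ LinearMap.id hξ.surjective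
  let b := Module.finBasis (FractionRing W) M.fibre
  let b' := Algebra.TensorProduct.basis B.RI b
  have hb' : ∀ i, b' i = 1 ⊗ₜ b i := fun i => Algebra.TensorProduct.basis_apply _ _
  have hred : ∀ (x : B.RI ⊗[FractionRing W] M.fibre) i,
      B.evRI (b'.repr x i) = b.repr (M.red (ξ x)) i := by
    intro x i
    induction x with
    | zero => simp
    | add x y hx hy => simp only [map_add, Finsupp.add_apply, hx, hy]
    | tmul c d =>
      have : (c ⊗ₜ d : B.RI ⊗[FractionRing W] M.fibre) = c • (1 ⊗ₜ d) := by
        rw [TensorProduct.smul_tmul', smul_eq_mul, mul_one]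
      rw [this, map_smul ξ, map_smulₛₗ M.red, hξ.1]
      rw [← this, Algebra.TensorProduct.basis_repr_tmul]
      simp
  let T : Matrix _ _ B.RI := LinearMap.toMatrix b' b' (s ∘ₗ ξ)
  have hT : B.evRI.mapMatrix T = 1 := by
    ext i j
    rw [RingHom.mapMatrix_apply, Matrix.map_apply]
    change B.evRI (LinearMap.toMatrix b' b' (s ∘ₗ ξ) i j) = _
    rw [LinearMap.toMatrix_apply, hred, LinearMap.comp_apply]
    have : ξ (s (ξ (b' j))) = ξ (b' j) := LinearMap.congr_fun hs _
    rw [this, hb', hξ.1, Module.Basis.repr_self, Finsupp.single_apply, Matrix.one_apply]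
    simp only [eq_comm]
  have hdet : T.det ≠ 0 := by
    intro h
    have h1 := congrArg B.evRI h
    rw [RingHom.map_det, map_zero, hT, Matrix.det_one] at h1
    exact one_ne_zero h1
  rw [injective_iff_map_eq_zero]
  intro x hx
  have h1 : T.mulVec (b'.repr x) = 0 := by
    rw [LinearMap.toMatrix_mulVec_repr, LinearMap.comp_apply, hx, map_zero, map_zero]
    rfl
  have h2 := Matrix.eq_zero_of_mulVec_eq_zero hdet h1
  exact b'.repr.map_eq_zero_iff.1 (DFunLike.coe_injective h2)

end PhiModule

end Modules

end BreuilKisin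

/-! ### The functor `D(·)`. -/

namespace BreuilKisin

section Modules

open CategoryTheory

variable {OE : Type v} {OK : Type w} {W : Type u}
  [CommRing OE] [IsDomain OE] [IsDiscreteValuationRing OE]
  [CommRing OK] [IsDomain OK] [IsDiscreteValuationRing OK]
  [CommRing W] [IsDomain W] [IsDiscreteValuationRing W]
  [Algebra OE W] [Algebra W OK] [Finite (IsLocalRing.ResidueField OE)] {B : BKDatum OE OK W}

theorem isScalarExtension_id {A N : Type*} [CommRing A] [AddCommGroup N] [Module A N] :
    IsScalarExtension (LinearMap.id : N →ₗ[A] N) :=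
  .of_retraction (Pullback.unit (RingHom.id A)) (fun _ => rfl) (by
    rw [show Set.range (LinearMap.id : N →ₗ[A] N) = Set.univ from Set.range_id, Submodule.span_univ])

/-- The inverse image of a lattice under an isomorphism is a lattice. -/
theorem isLattice_comap {A K V V' : Type*} [CommRing A] [CommRing K] [Algebra A K] [AddCommGroup V]
    [Module A V] [Module K V] [IsScalarTower A K V] [AddCommGroup V'] [Module A V'] [Module K V']
    [IsScalarTower A K V'] (e : V ≃ₗ[K] V') {f : V →ₗ[K] V'} (hf : ∀ x, f x = e x)
    (Λ : Submodule A V') (h : Λ.IsLattice K) :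
    (Λ.comap (f.restrictScalars A)).IsLattice K := by
  have h1 : Λ.comap (f.restrictScalars A) = Λ.map ((e.symm : V' →ₗ[K] V).restrictScalars A) := by
    ext x
    constructor
    · intro hx
      exact ⟨f x, hx, by simp [hf]⟩
    · rintro ⟨y, hy, rfl⟩
      simpa [hf] using hy
  rw [h1]
  refine ⟨h.fg.map _, ?_⟩
  have h2 : ((Λ.map ((e.symm : V' →ₗ[K] V).restrictScalars A) : Submodule A V) : Set V) =
      (e.symm : V' →ₗ[K] V) '' Λ := rfl
  rw [h2, Submodule.span_image, h.span_eq_top, Submodule.map_top, LinearEquiv.range]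

namespace PhiModule

variable (M N : PhiModule B)

@[simp] theorem toFr_tmul (b : B.RI) (m : M.carrier) : M.toFr (b ⊗ₜ m) = B.toFrS₀ b ⊗ₜ m := rfl

/-- The map `M[1/I] → M ⊗ Fr(𝔖̂₀)` as a semilinear map. -/
noncomputable def toFrSemilinear :
    (B.RI ⊗[B.R] M.carrier) →ₛₗ[(B.toFrS₀ : B.RI →+* B.FrS₀)] (B.FrS₀ ⊗[B.R] M.carrier) where
  toFun := M.toFr
  map_add' := map_add _
  map_smul' b x := by
    induction x with
    | zero => simp
    | add x y hx hy => rw [smul_add, map_add, map_add, smul_add, hx, hy]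
    | tmul c m =>
      rw [TensorProduct.smul_tmul', toFr_tmul, toFr_tmul, TensorProduct.smul_tmul', smul_eq_mul,
        smul_eq_mul, map_mul]
      rfl

theorem isScalarExtension_toFr : IsScalarExtension M.toFrSemilinear :=
  (isScalarExtension_tensorUnit.comp_iff M.toFrSemilinear (tensorUnit B.R B.FrS₀ M.carrier)
    (fun r => (B.toFrS₀.commutes r).symm) fun m => by
      change _ = M.toFr (1 ⊗ₜ m)
      rw [toFr_tmul, map_one]; rfl).1 isScalarExtension_tensorUnit

variable {M N}

theorem frXi_tmul (ξ : (B.RI ⊗[FractionRing W] M.fibre) →ₗ[B.RI] (B.RI ⊗[B.R] M.carrier))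
    (s : B.FrS₀) (d : M.fibre) : M.frXi ξ (s ⊗ₜ d) = s • M.toFr (ξ (1 ⊗ₜ d)) :=
  LinearMap.liftBaseChange_tmul ..

/-- Through the isomorphism `ξ`, the module `M[1/I]` is a base change of `D(M)`; by transitivity so
is `M ⊗ Fr(𝔖̂₀)`. It follows that the transported completion is a lattice. -/
theorem IsFrobeniusLift.exists_equiv
    {ξ : (B.RI ⊗[FractionRing W] M.fibre) →ₗ[B.RI] (B.RI ⊗[B.R] M.carrier)}
    (hξ : M.IsFrobeniusLift ξ) :
    ∃ e : (B.FrS₀ ⊗[FractionRing W] M.fibre) ≃ₗ[B.FrS₀] (B.FrS₀ ⊗[B.R] M.carrier),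
      ∀ x, M.frXi ξ x = e x := by
  let e₁ := LinearEquiv.ofBijective ξ ⟨hξ.injective, hξ.surjective⟩
  let g := e₁.toLinearMap.comp (tensorUnit (FractionRing W) B.RI M.fibre)
  have hg : IsScalarExtension g := isScalarExtension_tensorUnit.postcomp e₁ fun _ => rfl
  let k : M.fibre →ₛₗ[algebraMap (FractionRing W) B.FrS₀] (B.FrS₀ ⊗[B.R] M.carrier) :=
    (M.frXi ξ).comp (tensorUnit (FractionRing W) B.FrS₀ M.fibre)
  have hk : IsScalarExtension k :=
    (hg.comp_iff M.toFrSemilinear k (fun a => by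
      rw [IsScalarTower.algebraMap_apply (FractionRing W) B.R B.FrS₀,
        IsScalarTower.algebraMap_apply (FractionRing W) B.R B.RI]
      exact (B.toFrS₀.commutes _).symm) fun d => by
      change M.frXi ξ (1 ⊗ₜ d) = M.toFr (ξ (1 ⊗ₜ d))
      rw [frXi_tmul, one_smul]).2 M.isScalarExtension_toFr
  obtain ⟨e, he⟩ := isScalarExtension_tensorUnit.exists_equiv hk
  refine ⟨e, fun x => ?_⟩
  have : M.frXi ξ = e.toLinearMap := isScalarExtension_tensorUnit.hom_ext (A := FractionRing W)
    fun d => (he d).symm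
  rw [this]; rfl

theorem isLattice_completion : M.completion.IsLattice B.FrS₀ := by
  refine ⟨?_, ?_⟩
  · obtain ⟨n, y, g, hg⟩ := exists_dual_basis B.R M.carrier
    refine Submodule.fg_def.2 ⟨Set.range fun i => (1 : B.FrS₀) ⊗ₜ[B.R] y i, Set.finite_range _,
      le_antisymm ?_ ?_⟩
    · refine Submodule.span_mono ?_
      rintro _ ⟨i, rfl⟩
      exact ⟨_, rfl⟩
    · refine Submodule.span_le.2 ?_
      rintro _ ⟨m, rfl⟩
      rw [SetLike.mem_coe, ← hg m]
      beta_reduce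
      rw [TensorProduct.tmul_sum]
      refine Submodule.sum_mem _ fun i _ => ?_
      rw [TensorProduct.tmul_smul, ← algebraMap_smul B.S₀]
      exact Submodule.smul_mem _ _ (Submodule.subset_span ⟨i, rfl⟩)
  · rw [eq_top_iff, ← (isScalarExtension_tensorUnit (A := B.R) (B := B.FrS₀)
      (M := M.carrier)).span_range]
    exact Submodule.span_mono Submodule.subset_span

/-- The base change of a morphism commutes with the semilinear Frobenius maps. -/
theorem Hom.baseChange_phiRI (f : M ⟶ N) (x : B.RI ⊗[B.R] M.carrier) :
    f.hom.baseChange B.RI (M.phiRI x) = N.phiRI (f.hom.baseChange B.RI x) := by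
  induction x with
  | zero => simp
  | add x y hx hy => simp only [map_add, hx, hy]
  | tmul b m =>
    rw [phiRI_tmul, map_smul, f.comm, LinearMap.baseChange_tmul, phiRI_tmul]

/-- The reduction of a morphism modulo `u`. -/
noncomputable def Hom.fibreMap (f : M ⟶ N) : M.fibre →ₗ[FractionRing W] N.fibre :=
  Pullback.linearLift ((Pullback.unit B.evR).comp f.hom)

@[simp] theorem Hom.fibreMap_unit (f : M ⟶ N) (m : M.carrier) :
    Hom.fibreMap f (Pullback.unit B.evR m) = Pullback.unit B.evR (f.hom m) :=
  Pullback.linearLift_unit _ _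

theorem Hom.red_baseChange (f : M ⟶ N) (x : B.RI ⊗[B.R] M.carrier) :
    N.red (f.hom.baseChange B.RI x) = Hom.fibreMap f (M.red x) := by
  induction x with
  | zero => simp
  | add x y hx hy => simp only [map_add, hx, hy]
  | tmul b m => rw [LinearMap.baseChange_tmul, red_tmul, red_tmul, map_smul, fibreMap_unit]

theorem Hom.fibreMap_fibrePhi (f : M ⟶ N) (d : M.fibre) :
    Hom.fibreMap f (M.fibrePhi d) = N.fibrePhi (Hom.fibreMap f d) := by
  obtain ⟨x, rfl⟩ := M.red_surjective d
  rw [← red_phiRI, ← red_baseChange, baseChange_phiRI, red_phiRI, red_baseChange]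

/-- The Frobenius lifts `ξ` are natural. -/
theorem Hom.baseChange_frobeniusLift (f : M ⟶ N)
    {ξ : (B.RI ⊗[FractionRing W] M.fibre) →ₗ[B.RI] (B.RI ⊗[B.R] M.carrier)}
    {ξ' : (B.RI ⊗[FractionRing W] N.fibre) →ₗ[B.RI] (B.RI ⊗[B.R] N.carrier)}
    (hξ : M.IsFrobeniusLift ξ) (hξ' : N.IsFrobeniusLift ξ') (d : M.fibre) :
    f.hom.baseChange B.RI (ξ (1 ⊗ₜ d)) = ξ' (1 ⊗ₜ Hom.fibreMap f d) := by
  let δ : M.fibre →ₗ[FractionRing W] (B.RI ⊗[B.R] N.carrier) :=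
    (f.hom.baseChange B.RI).restrictScalars (FractionRing W) ∘ₗ
      ξ.restrictScalars (FractionRing W) ∘ₗ TensorProduct.mk (FractionRing W) B.RI M.fibre 1
  let δ' : M.fibre →ₗ[FractionRing W] (B.RI ⊗[B.R] N.carrier) :=
    ξ'.restrictScalars (FractionRing W) ∘ₗ
      TensorProduct.mk (FractionRing W) B.RI N.fibre 1 ∘ₗ Hom.fibreMap f
  have hδ : ∀ d, δ d = f.hom.baseChange B.RI (ξ (1 ⊗ₜ d)) := fun _ => rfl
  have hδ' : ∀ d, δ' d = ξ' (1 ⊗ₜ Hom.fibreMap f d) := fun _ => rfl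
  -- Both sides are equivariant and have the same reduction, the fibre map of `f`, so uniqueness
  -- identifies them.
  have h : δ - δ' = 0 := N.eq_zero_of_equivariant M.fibrePhi M.isScalarExtension_fibrePhi.span_range
    (δ - δ') (fun d => by
      rw [LinearMap.sub_apply, LinearMap.sub_apply, map_sub, hδ, hδ, hδ', hδ', hξ.2,
        baseChange_phiRI, fibreMap_fibrePhi, hξ'.2])
    fun d => by
      rw [LinearMap.sub_apply, map_sub, hδ, hδ', red_baseChange, hξ.1, hξ'.1, sub_self]
  have h1 : δ d - δ' d = 0 := LinearMap.congr_fun h d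
  exact sub_eq_zero.1 h1

theorem toFr_baseChange (f : M.carrier →ₗ[B.R] N.carrier) (x : B.RI ⊗[B.R] M.carrier) :
    N.toFr (f.baseChange B.RI x) = f.baseChange B.FrS₀ (M.toFr x) := by
  induction x with
  | zero => simp
  | add x y hx hy => simp only [map_add, hx, hy]
  | tmul b m => simp

theorem baseChange_mem_completion (f : M.carrier →ₗ[B.R] N.carrier) {x : B.FrS₀ ⊗[B.R] M.carrier}
    (hx : x ∈ M.completion) : f.baseChange B.FrS₀ x ∈ N.completion := by
  have h : M.completion ≤ N.completion.comap ((f.baseChange B.FrS₀).restrictScalars B.S₀) := by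
    refine Submodule.span_le.2 ?_
    rintro _ ⟨m, rfl⟩
    exact Submodule.subset_span ⟨f m, by simp⟩
  exact h hx

/-- Naturality of `ξ` translates this into the fact that a linear map `M → N` respects completions.
-/
theorem Hom.map_fibreLattice (f : M ⟶ N)
    {ξ : (B.RI ⊗[FractionRing W] M.fibre) →ₗ[B.RI] (B.RI ⊗[B.R] M.carrier)}
    {ξ' : (B.RI ⊗[FractionRing W] N.fibre) →ₗ[B.RI] (B.RI ⊗[B.R] N.carrier)}
    (hξ : M.IsFrobeniusLift ξ) (hξ' : N.IsFrobeniusLift ξ') {x : B.FrS₀ ⊗[FractionRing W] M.fibre}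
    (hx : x ∈ M.fibreLattice ξ) : (Hom.fibreMap f).baseChange B.FrS₀ x ∈ N.fibreLattice ξ' := by
  have h : ∀ x, N.frXi ξ' ((Hom.fibreMap f).baseChange B.FrS₀ x) =
      f.hom.baseChange B.FrS₀ (M.frXi ξ x) := by
    intro x
    induction x with
    | zero => simp
    | add x y hx hy => simp only [map_add, hx, hy]
    | tmul s d =>
      rw [LinearMap.baseChange_tmul, frXi_tmul, frXi_tmul, map_smul, ← toFr_baseChange,
        baseChange_frobeniusLift f hξ hξ']
  change N.frXi ξ' _ ∈ N.completion
  rw [h]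
  exact baseChange_mem_completion _ hx

variable (M)

/-- The Frobenius-equivariant lift `ξ` of the identity of `D(M)`. -/
noncomputable def frobeniusLift :
    (B.RI ⊗[FractionRing W] M.fibre) →ₗ[B.RI] (B.RI ⊗[B.R] M.carrier) :=
  M.existsUnique_isFrobeniusLift.choose

theorem isFrobeniusLift_frobeniusLift : M.IsFrobeniusLift M.frobeniusLift :=
  M.existsUnique_isFrobeniusLift.choose_spec.1

/-- The Hodge–Pink isocrystal `D(M)`. -/
noncomputable def reduction : HodgePink B where
  carrier := M.fibre
  frob := LinearEquiv.ofBijective (Pullback.linearLift M.fibrePhi) M.isScalarExtension_fibrePhi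
  lattice := M.fibreLattice M.frobeniusLift
  isLattice := by
    obtain ⟨e, he⟩ := M.isFrobeniusLift_frobeniusLift.exists_equiv
    exact isLattice_comap e he M.completion M.isLattice_completion

theorem reduction_phi (d : M.fibre) : M.reduction.phi d = M.fibrePhi d :=
  Pullback.linearLift_unit M.fibrePhi d

variable (B)

/-- The functor `D(·)`. -/
noncomputable def reductionFunctor : PhiModule B ⥤ HodgePink B where
  obj M := M.reduction
  map {M N} f :=
    { hom := Hom.fibreMap f
      comm := fun d => (congrArg (Hom.fibreMap f) (M.reduction_phi d)).trans
        ((Hom.fibreMap_fibrePhi f d).trans (N.reduction_phi _).symm)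
      map_lattice := fun _ hx => Hom.map_fibreLattice f M.isFrobeniusLift_frobeniusLift
        N.isFrobeniusLift_frobeniusLift hx }
  map_id M := HodgePink.Hom.ext ((Pullback.isScalarExtension_unit B.evR).hom_ext fun m =>
    Hom.fibreMap_unit (𝟙 M) m)
  map_comp {_ _ _} f g := HodgePink.Hom.ext ((Pullback.isScalarExtension_unit B.evR).hom_ext
    fun m => (Hom.fibreMap_unit (f ≫ g) m).trans
      ((congrArg (Hom.fibreMap g) (Hom.fibreMap_unit f m)).trans
        (Hom.fibreMap_unit g (f.hom m))).symm)

theorem isReductionFunctor_reductionFunctor : IsReductionFunctor (reductionFunctor B) := by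
  refine ⟨fun M => LinearEquiv.refl _ _, fun M d => (M.reduction_phi d).symm, fun M =>
    ⟨M.frobeniusLift, M.isFrobeniusLift_frobeniusLift, fun x => ?_⟩, fun M N f m =>
    Hom.fibreMap_unit f m⟩
  have : (LinearEquiv.refl (FractionRing W) M.fibre).toLinearMap.baseChange B.FrS₀ x = x := by
    change (LinearMap.id : M.fibre →ₗ[FractionRing W] M.fibre).baseChange B.FrS₀ x = x
    rw [LinearMap.baseChange_id]
    rfl
  exact (iff_of_eq (congrArg (· ∈ M.fibreLattice M.frobeniusLift) this))

end PhiModule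

end Modules

end BreuilKisin

/-! ### The functor `M(·)`. -/

namespace BreuilKisin

section Modules

open CategoryTheory

variable {OE : Type v} {OK : Type w} {W : Type u}
  [CommRing OE] [IsDomain OE] [IsDiscreteValuationRing OE]
  [CommRing OK] [IsDomain OK] [IsDiscreteValuationRing OK]
  [CommRing W] [IsDomain W] [IsDiscreteValuationRing W]
  [Algebra OE W] [Algebra W OK] [Finite (IsLocalRing.ResidueField OE)] {B : BKDatum OE OK W}

namespace HodgePink

variable (D D' : HodgePink B)

theorem tmulPhi_apply (d : D.carrier) : D.tmulPhi d = 1 ⊗ₜ D.phi d := rfl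

@[simp] theorem phiRI_tmul (b : B.RI) (d : D.carrier) :
    D.phiRI (b ⊗ₜ d) = B.frobRI b • (1 ⊗ₜ[FractionRing W] D.phi d) := by
  rw [← tmulPhi_apply]
  exact semilinearLift_tmul _ _ _ _ _

omit [Finite (IsLocalRing.ResidueField OE)] in
theorem isScalarExtension_phi : IsScalarExtension D.phi :=
  (Pullback.isScalarExtension_unit B.frobK).postcomp D.frob fun _ => rfl

theorem isScalarExtension_tmulPhi : IsScalarExtension D.tmulPhi :=
  (D.isScalarExtension_phi.comp_iff (tensorUnit (FractionRing W) B.RI D.carrier) D.tmulPhi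
    (fun a => B.frobRI_algebraMap_K a) fun _ => rfl).2 isScalarExtension_tensorUnit

theorem isScalarExtension_phiRI : IsScalarExtension D.phiRI :=
  (isScalarExtension_tensorUnit.comp_iff D.phiRI D.tmulPhi (fun _ => rfl) fun d => by
    rw [tensorUnit_apply, phiRI_tmul, map_one, one_smul]; rfl).1 D.isScalarExtension_tmulPhi

omit [Finite (IsLocalRing.ResidueField OE)] in
/-- A module that is identified with the glueing generates `D ⊗ R[1/I]`. -/
theorem exists_equiv_liftBaseChange {N : Type*} [AddCommGroup N] [Module B.R N]
    {ι : N →ₗ[B.R] (B.RI ⊗[FractionRing W] D.carrier)} (hι : Function.Injective ι)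
    (hr : LinearMap.range ι = D.glueing) :
    IsScalarExtension (semilinearOfLinear B.RI ι) ∧
    ∃ e : (B.RI ⊗[B.R] N) ≃ₗ[B.RI] (B.RI ⊗[FractionRing W] D.carrier),
      ∀ x, e x = ι.liftBaseChange B.RI x := by
  have h : IsScalarExtension (semilinearOfLinear B.RI ι) :=
    isScalarExtension_of_injective (E := B.E) hι fun x => by
      rw [hr]; exact D.exists_pow_smul_mem_glueing x
  obtain ⟨e, he⟩ := isScalarExtension_tensorUnit.exists_equiv h
  refine ⟨h, e, fun x => ?_⟩
  have : e.toLinearMap = ι.liftBaseChange B.RI :=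
    isScalarExtension_tensorUnit.hom_ext (A := B.R) fun n => by
      rw [tensorUnit_apply, LinearMap.liftBaseChange_tmul, one_smul]
      exact he n
  exact LinearMap.congr_fun this x

/-- Both `(φ_q^* N)[1/I]` and `D ⊗ R[1/I]`, the latter via `φ_D ∘ ι`, are base changes of `N` along
the Frobenius `R → R[1/I]`. The isomorphism between them is the Frobenius of `N`. No compatibility
of `Λ` with the Frobenius is required, since poles along `I` are allowed. -/
theorem exists_frob {N : Type*} [AddCommGroup N] [Module B.R N]
    {ι : N →ₗ[B.R] (B.RI ⊗[FractionRing W] D.carrier)} (hι : Function.Injective ι)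
    (hr : LinearMap.range ι = D.glueing) :
    ∃ φ : (B.RI ⊗[B.R] Pullback B.frobR N) ≃ₗ[B.RI] (B.RI ⊗[B.R] N),
      ∀ n, ι.liftBaseChange B.RI (φ (1 ⊗ₜ Pullback.unit B.frobR n)) = D.phiRI (ι n) := by
  obtain ⟨hS, e, he⟩ := D.exists_equiv_liftBaseChange hι hr
  have : RingHomCompTriple B.frobR (algebraMap B.R B.RI) ((algebraMap B.R B.RI).comp B.frobR) := ⟨rfl⟩
  let g : N →ₛₗ[(algebraMap B.R B.RI).comp B.frobR] (B.RI ⊗[B.R] Pullback B.frobR N) :=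
    (tensorUnit B.R B.RI (Pullback B.frobR N)).comp (Pullback.unit B.frobR)
  have hg : IsScalarExtension g :=
    ((Pullback.isScalarExtension_unit B.frobR).comp_iff (tensorUnit B.R B.RI (Pullback B.frobR N)) g
      (fun _ => rfl) fun _ => rfl).2 isScalarExtension_tensorUnit
  let k : N →ₛₗ[(algebraMap B.R B.RI).comp B.frobR] (B.RI ⊗[FractionRing W] D.carrier) :=
    { toFun n := D.phiRI (ι n)
      map_add' x y := by rw [map_add, map_add]
      map_smul' a x := by
        rw [map_smul, ← algebraMap_smul B.RI, map_smulₛₗ, B.frobRI_algebraMap]; rfl }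
  have hk : IsScalarExtension k :=
    (hS.comp_iff D.phiRI k (fun r => (B.frobRI_algebraMap r).symm) fun _ => rfl).2
      D.isScalarExtension_phiRI
  obtain ⟨φ, hφ⟩ := hg.exists_equiv hk
  refine ⟨φ.trans e.symm, fun n => ?_⟩
  rw [← he, LinearEquiv.trans_apply, LinearEquiv.apply_symm_apply]
  exact hφ n

omit [Finite (IsLocalRing.ResidueField OE)] in
/-- The map `D ⊗ R[1/I] → D ⊗ Fr(𝔖̂₀)` is natural in `D`. -/
theorem toFr_baseChange {D D' : HodgePink B} (f : D.carrier →ₗ[FractionRing W] D'.carrier)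
    (x : B.RI ⊗[FractionRing W] D.carrier) :
    D'.toFr (f.baseChange B.RI x) = f.baseChange B.FrS₀ (D.toFr x) := by
  induction x with
  | zero => simp
  | add x y hx hy => simp only [map_add, hx, hy]
  | tmul b m => simp

theorem Hom.baseChange_phiRI {D D' : HodgePink B} (f : D ⟶ D') (x : B.RI ⊗[FractionRing W] D.carrier) :
    f.hom.baseChange B.RI (D.phiRI x) = D'.phiRI (f.hom.baseChange B.RI x) := by
  induction x with
  | zero => simp
  | add x y hx hy => simp only [map_add, hx, hy]
  | tmul b m =>
    rw [phiRI_tmul, map_smul, LinearMap.baseChange_tmul, f.comm, LinearMap.baseChange_tmul, phiRI_tmul]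

omit [Finite (IsLocalRing.ResidueField OE)] in
theorem Hom.baseChange_mem_glueing {D D' : HodgePink B} (f : D ⟶ D')
    {x : B.RI ⊗[FractionRing W] D.carrier} (hx : x ∈ D.glueing) :
    f.hom.baseChange B.RI x ∈ D'.glueing := by
  rw [mem_glueing, toFr_baseChange]
  exact f.map_lattice _ hx

variable [IsAdicComplete (IsLocalRing.maximalIdeal W) W]

/-- The `φ_q`-module `M(D)`. -/
noncomputable def modification : PhiModule B where
  carrier := D.glueing
  finite := D.glueing_finite_projective.1
  projective := D.glueing_finite_projective.2
  frob := (D.exists_frob D.glueing.injective_subtype (Submodule.range_subtype _)).choose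

/-- The inclusion of `M(D)` in `D ⊗ R[1/I]`. -/
noncomputable def modificationSubtype :
    D.modification.carrier →ₗ[B.R] (B.RI ⊗[FractionRing W] D.carrier) :=
  D.glueing.subtype

theorem modificationSubtype_injective : Function.Injective D.modificationSubtype :=
  D.glueing.injective_subtype

theorem range_modificationSubtype : LinearMap.range D.modificationSubtype = D.glueing :=
  Submodule.range_subtype _

theorem modificationSubtype_phi (m : D.modification.carrier) :
    D.modificationSubtype.liftBaseChange B.RI (D.modification.phi m) =
      D.phiRI (D.modificationSubtype m) :=
  (D.exists_frob D.glueing.injective_subtype (Submodule.range_subtype _)).choose_spec m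

variable {D D'}

/-- The map `M(D) → M(D')` induced by a morphism `D → D'`. -/
noncomputable def Hom.modificationMap (f : D ⟶ D') :
    D.modification.carrier →ₗ[B.R] D'.modification.carrier :=
  ((f.hom.baseChange B.RI).restrictScalars B.R).restrict (p := D.glueing) (q := D'.glueing)
    fun _ hx => Hom.baseChange_mem_glueing f hx

theorem Hom.modificationSubtype_map (f : D ⟶ D') (m : D.modification.carrier) :
    D'.modificationSubtype (Hom.modificationMap f m) =
      f.hom.baseChange B.RI (D.modificationSubtype m) := rfl

/-- Checked inside `D' ⊗ R[1/I]`, where the Frobenius of the glueing is by construction that of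
`D'`. -/
theorem Hom.modificationMap_phi (f : D ⟶ D') (m : D.modification.carrier) :
    (Hom.modificationMap f).baseChange B.RI (D.modification.phi m) =
      D'.modification.phi (Hom.modificationMap f m) := by
  obtain ⟨-, e, he⟩ := D'.exists_equiv_liftBaseChange D'.modificationSubtype_injective
    D'.range_modificationSubtype
  apply e.injective
  rw [he, he, modificationSubtype_phi, Hom.modificationSubtype_map, ← Hom.baseChange_phiRI,
    ← modificationSubtype_phi]
  induction D.modification.phi m with
  | zero => simp
  | add x y hx hy => simp only [map_add, hx, hy]
  | tmul b m =>
    rw [LinearMap.baseChange_tmul, LinearMap.liftBaseChange_tmul, LinearMap.liftBaseChange_tmul,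
      map_smul, Hom.modificationSubtype_map]

variable (B)

/-- The functor `M(·)`. -/
noncomputable def modificationFunctor : HodgePink B ⥤ PhiModule B where
  obj D := D.modification
  map f := ⟨Hom.modificationMap f, Hom.modificationMap_phi f⟩
  map_id D := PhiModule.Hom.ext (LinearMap.ext fun m => D.modificationSubtype_injective (by
    change (LinearMap.id : D.carrier →ₗ[FractionRing W] D.carrier).baseChange B.RI
      (D.modificationSubtype m) = D.modificationSubtype m
    rw [LinearMap.baseChange_id]; rfl))
  map_comp {D _ D''} f g := PhiModule.Hom.ext (LinearMap.ext fun m => D''.modificationSubtype_injective (by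
    change (g.hom ∘ₗ f.hom).baseChange B.RI (D.modificationSubtype m) =
      g.hom.baseChange B.RI (f.hom.baseChange B.RI (D.modificationSubtype m))
    rw [LinearMap.baseChange_comp]; rfl))

theorem isModificationFunctor_modificationFunctor : IsModificationFunctor (modificationFunctor B) :=
  ⟨fun D => D.modificationSubtype, fun D => ⟨D.modificationSubtype_injective,
    D.range_modificationSubtype⟩, fun D m => D.modificationSubtype_phi m,
    fun _ _ f m => Hom.modificationSubtype_map f m⟩

end HodgePink

end Modules

end BreuilKisin

/-! ### The Hodge–Pink isocrystal of a glueing. -/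

namespace BreuilKisin

section Modules

open CategoryTheory

variable {OE : Type v} {OK : Type w} {W : Type u}
  [CommRing OE] [IsDomain OE] [IsDiscreteValuationRing OE]
  [CommRing OK] [IsDomain OK] [IsDiscreteValuationRing OK]
  [CommRing W] [IsDomain W] [IsDiscreteValuationRing W]
  [Algebra OE W] [Algebra W OK] {B : BKDatum OE OK W}

namespace HodgePink

variable (D : HodgePink B)

/-- The reduction map `D ⊗ R[1/I] → D` modulo `u`. -/
noncomputable def red : (B.RI ⊗[FractionRing W] D.carrier) →ₛₗ[B.evRI] D.carrier :=
  semilinearLift B.evRI (σ := RingHom.id _) B.evRI_algebraMap_K LinearMap.id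

@[simp] theorem red_tmul (b : B.RI) (d : D.carrier) : D.red (b ⊗ₜ d) = B.evRI b • d :=
  semilinearLift_tmul _ _ _ _ _

theorem isScalarExtension_red : IsScalarExtension D.red :=
  (isScalarExtension_tensorUnit.comp_iff D.red LinearMap.id
    (fun a => (B.evRI_algebraMap_K a).symm) fun d => by
      rw [tensorUnit_apply, red_tmul, map_one, one_smul]; rfl).1 isScalarExtension_id

theorem red_baseChange {D D' : HodgePink B} (f : D.carrier →ₗ[FractionRing W] D'.carrier)
    (x : B.RI ⊗[FractionRing W] D.carrier) : D'.red (f.baseChange B.RI x) = f (D.red x) := by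
  induction x with
  | zero => simp
  | add x y hx hy => simp only [map_add, hx, hy]
  | tmul b d => rw [LinearMap.baseChange_tmul, red_tmul, red_tmul, map_smul]

/-- The map `D ⊗ R[1/I] → D ⊗ Fr(𝔖̂₀)` as a semilinear map. -/
noncomputable def toFrSemilinear : (B.RI ⊗[FractionRing W] D.carrier)
    →ₛₗ[(B.toFrS₀ : B.RI →+* B.FrS₀)] (B.FrS₀ ⊗[FractionRing W] D.carrier) where
  toFun := D.toFr
  map_add' := map_add _
  map_smul' b x := by
    induction x with
    | zero => simp
    | add x y hx hy => rw [smul_add, map_add, map_add, smul_add, hx, hy]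
    | tmul c m =>
      rw [TensorProduct.smul_tmul', toFr_tmul, toFr_tmul, TensorProduct.smul_tmul', smul_eq_mul,
        smul_eq_mul, map_mul]
      rfl

theorem toFrS₀_algebraMap_K (a : FractionRing W) :
    algebraMap (FractionRing W) B.FrS₀ a = B.toFrS₀ (algebraMap (FractionRing W) B.RI a) := by
  rw [IsScalarTower.algebraMap_apply (FractionRing W) B.R B.FrS₀,
    IsScalarTower.algebraMap_apply (FractionRing W) B.R B.RI]
  exact (B.toFrS₀.commutes _).symm

theorem isScalarExtension_toFr : IsScalarExtension D.toFrSemilinear :=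
  (isScalarExtension_tensorUnit.comp_iff D.toFrSemilinear
    (tensorUnit (FractionRing W) B.FrS₀ D.carrier) toFrS₀_algebraMap_K fun m => by
      change _ = D.toFr (1 ⊗ₜ m)
      rw [toFr_tmul, map_one]; rfl).1 isScalarExtension_tensorUnit

variable [Finite (IsLocalRing.ResidueField OE)]

theorem red_phiRI (x : B.RI ⊗[FractionRing W] D.carrier) : D.red (D.phiRI x) = D.phi (D.red x) := by
  induction x with
  | zero => simp
  | add x y hx hy => simp only [map_add, hx, hy]
  | tmul b d =>
    rw [phiRI_tmul, map_smulₛₗ, red_tmul, red_tmul, map_smulₛₗ, map_one, one_smul, B.evRI_frobRI]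

end HodgePink

variable [Finite (IsLocalRing.ResidueField OE)]

/-- `ι` identifies the `φ_q`-module `N` with the glueing `M(D)`. -/
structure IsModification (N : PhiModule B) (D : HodgePink B)
    (ι : N.carrier →ₗ[B.R] (B.RI ⊗[FractionRing W] D.carrier)) : Prop where
  injective : Function.Injective ι
  range_eq : LinearMap.range ι = D.glueing
  map_phi : ∀ n, ι.liftBaseChange B.RI (N.phi n) = D.phiRI (ι n)

namespace IsModification

variable {N : PhiModule B} {D : HodgePink B}
  {ι : N.carrier →ₗ[B.R] (B.RI ⊗[FractionRing W] D.carrier)} (h : IsModification N D ι)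

include h

theorem map_phiRI (x : B.RI ⊗[B.R] N.carrier) :
    ι.liftBaseChange B.RI (N.phiRI x) = D.phiRI (ι.liftBaseChange B.RI x) := by
  induction x with
  | zero => simp
  | add x y hx hy => simp only [map_add, hx, hy]
  | tmul b n =>
    rw [PhiModule.phiRI_tmul, map_smul, h.map_phi, LinearMap.liftBaseChange_tmul, map_smulₛₗ]

/-- The fibre at `u = 0` does not change when `E` is inverted, because `E(0) ≠ 0`. So it is the
fibre of `D ⊗ R[1/I]`, which is `D`. -/
theorem exists_fibreEquiv_unit : ∃ β : N.fibre ≃ₗ[FractionRing W] D.carrier,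
    ∀ n, β (Pullback.unit B.evR n) = D.red (ι n) := by
  let k : N.carrier →ₛₗ[B.evR] D.carrier :=
    { toFun n := D.red (ι n)
      map_add' x y := by rw [map_add, map_add]
      map_smul' a x := by rw [map_smul, ← algebraMap_smul B.RI, map_smulₛₗ, B.evRI_algebraMap] }
  exact (Pullback.isScalarExtension_unit B.evR).exists_equiv (g' := k)
    (((D.exists_equiv_liftBaseChange h.injective h.range_eq).1.comp_iff D.red k
      (fun r => (B.evRI_algebraMap r).symm) fun _ => rfl).2 D.isScalarExtension_red)

section Fibre

variable {β : N.fibre ≃ₗ[FractionRing W] D.carrier}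
  (hβ : ∀ n, β (Pullback.unit B.evR n) = D.red (ι n))

include hβ

omit h in
theorem fibreEquiv_red (x : B.RI ⊗[B.R] N.carrier) :
    β (N.red x) = D.red (ι.liftBaseChange B.RI x) := by
  induction x with
  | zero => simp
  | add x y hx hy => simp only [map_add, hx, hy]
  | tmul b n => rw [PhiModule.red_tmul, map_smul, hβ, LinearMap.liftBaseChange_tmul, map_smulₛₗ]

theorem fibreEquiv_fibrePhi (d : N.fibre) : β (N.fibrePhi d) = D.phi (β d) := by
  obtain ⟨x, rfl⟩ := N.red_surjective d
  rw [← PhiModule.red_phiRI, fibreEquiv_red hβ, h.map_phiRI, D.red_phiRI, fibreEquiv_red hβ]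

/-- Composing `β` with the inverse of `ι[1/I]` gives an equivariant lift of the identity, and there
is only one. Thus `ξ` is the tautological identification. -/
theorem liftBaseChange_frobeniusLift
    {ξ : (B.RI ⊗[FractionRing W] N.fibre) →ₗ[B.RI] (B.RI ⊗[B.R] N.carrier)}
    (hξ : N.IsFrobeniusLift ξ) (d : N.fibre) :
    ι.liftBaseChange B.RI (ξ (1 ⊗ₜ d)) = 1 ⊗ₜ β d := by
  obtain ⟨-, e, he⟩ := D.exists_equiv_liftBaseChange h.injective h.range_eq
  let ξ' := e.symm.toLinearMap ∘ₗ β.toLinearMap.baseChange B.RI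
  have hξ' : ∀ d, ι.liftBaseChange B.RI (ξ' (1 ⊗ₜ d)) = 1 ⊗ₜ β d := fun d => by
    rw [← he]
    change e (e.symm (β.toLinearMap.baseChange B.RI (1 ⊗ₜ d))) = _
    rw [LinearEquiv.apply_symm_apply, LinearMap.baseChange_tmul]
    rfl
  have hlift : N.IsFrobeniusLift ξ' := by
    refine ⟨fun d => β.injective ?_, fun d => e.injective ?_⟩
    · rw [fibreEquiv_red hβ, hξ', D.red_tmul, map_one, one_smul]
    · rw [he, he, hξ', h.map_phiRI, hξ', D.phiRI_tmul, map_one, one_smul,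
        h.fibreEquiv_fibrePhi hβ]
  rw [N.existsUnique_isFrobeniusLift.unique hξ hlift, hξ']

/-- With `ξ` known, the transported lattice is the `𝔖̂₀`-span of the image of the glueing in `D ⊗
Fr(𝔖̂₀)`, and that span is `Λ` by `span_toFr_glueing`. -/
theorem mem_fibreLattice_iff
    {ξ : (B.RI ⊗[FractionRing W] N.fibre) →ₗ[B.RI] (B.RI ⊗[B.R] N.carrier)}
    (hξ : N.IsFrobeniusLift ξ) (x : B.FrS₀ ⊗[FractionRing W] N.fibre) :
    x ∈ N.fibreLattice ξ ↔ β.toLinearMap.baseChange B.FrS₀ x ∈ D.lattice := by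
  let k : N.carrier →ₛₗ[algebraMap B.R B.FrS₀] (B.FrS₀ ⊗[FractionRing W] D.carrier) :=
    semilinearOfLinear B.FrS₀ (D.toFr ∘ₗ ι)
  have hk : IsScalarExtension k :=
    ((D.exists_equiv_liftBaseChange h.injective h.range_eq).1.comp_iff D.toFrSemilinear k
      (fun r => (B.toFrS₀.commutes r).symm) fun _ => rfl).2 D.isScalarExtension_toFr
  obtain ⟨e, he⟩ := isScalarExtension_tensorUnit.exists_equiv hk
  have he' : ∀ n : N.carrier, e (1 ⊗ₜ n) = D.toFr (ι n) := he
  have h1 : ∀ x, e (N.toFr x) = D.toFr (ι.liftBaseChange B.RI x) := fun x => by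
    induction x with
    | zero => simp
    | add x y hx hy => simp only [map_add, hx, hy]
    | tmul b n =>
      have h2 : (B.toFrS₀ b ⊗ₜ n : B.FrS₀ ⊗[B.R] N.carrier) = B.toFrS₀ b • (1 ⊗ₜ n) := by
        rw [TensorProduct.smul_tmul', smul_eq_mul, mul_one]
      rw [PhiModule.toFr_tmul, h2, map_smul, he', LinearMap.liftBaseChange_tmul]
      exact (D.toFrSemilinear.map_smulₛₗ b (ι n)).symm
  have h2 : ∀ x, e (N.frXi ξ x) = β.toLinearMap.baseChange B.FrS₀ x := fun x => by
    induction x with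
    | zero => simp
    | add x y hx hy => simp only [map_add, hx, hy]
    | tmul s d =>
      rw [PhiModule.frXi_tmul, map_smul, h1, h.liftBaseChange_frobeniusLift hβ hξ, D.toFr_tmul,
        map_one, LinearMap.baseChange_tmul, TensorProduct.smul_tmul', smul_eq_mul, mul_one]
      rfl
  have h3 : N.completion.map ((e : (B.FrS₀ ⊗[B.R] N.carrier) →ₗ[B.FrS₀] _).restrictScalars B.S₀) =
      D.lattice := by
    rw [← D.span_toFr_glueing, PhiModule.completion, Submodule.map_span, ← h.range_eq,
      ← Set.range_comp, LinearMap.coe_range, ← Set.range_comp]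
    exact congrArg (fun f => Submodule.span B.S₀ (Set.range f)) (funext he')
  rw [← h2, ← h3]
  change N.frXi ξ x ∈ N.completion ↔ _
  refine ⟨fun hx => ⟨_, hx, rfl⟩, ?_⟩
  rintro ⟨y, hy, hxy⟩
  rwa [← e.injective hxy]

end Fibre

end IsModification

/-- A finite projective module embeds in its base change along an injective ring map. -/
theorem _root_.TensorProduct.mk_one_injective_of_projective {A S M : Type*} [CommRing A]
    [CommRing S] [Algebra A S] (hS : Function.Injective (algebraMap A S)) [AddCommGroup M]
    [Module A M] [Module.Finite A M] [Module.Projective A M] : Function.Injective (TensorProduct.mk A S M 1) := by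
  obtain ⟨n, y, g, hg⟩ := exists_dual_basis A M
  intro m m' h
  rw [← hg m, ← hg m']
  refine Finset.sum_congr rfl fun i _ => ?_
  have h1 := congrArg (coordMap S (g i)) h
  rw [TensorProduct.mk_apply, TensorProduct.mk_apply, coordMap_tmul, coordMap_tmul, one_mul,
    one_mul] at h1
  rw [hS h1]

end Modules

end BreuilKisin

/-! ### Recovering `M` from `D(M)`, and the equivalence. -/

namespace BreuilKisin

section Modules

open CategoryTheory

variable {OE : Type v} {OK : Type w} {W : Type u}
  [CommRing OE] [IsDomain OE] [IsDiscreteValuationRing OE]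
  [CommRing OK] [IsDomain OK] [IsDiscreteValuationRing OK]
  [CommRing W] [IsDomain W] [IsDiscreteValuationRing W]
  [Algebra OE W] [Algebra W OK] [Finite (IsLocalRing.ResidueField OE)] {B : BKDatum OE OK W}

section BaseChange

variable {A S V V' : Type*} [CommRing A] [CommRing S] [Algebra A S] [AddCommGroup V] [Module A V]
  [AddCommGroup V'] [Module A V'] (e : V ≃ₗ[A] V')

theorem baseChange_symm_apply (x : S ⊗[A] V) :
    e.symm.toLinearMap.baseChange S (e.toLinearMap.baseChange S x) = x := by
  rw [← LinearMap.comp_apply, ← LinearMap.baseChange_comp, LinearEquiv.symm_comp,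
    LinearMap.baseChange_id]
  rfl

theorem baseChange_apply_symm (x : S ⊗[A] V') :
    e.toLinearMap.baseChange S (e.symm.toLinearMap.baseChange S x) = x := by
  rw [← LinearMap.comp_apply, ← LinearMap.baseChange_comp, LinearEquiv.comp_symm,
    LinearMap.baseChange_id]
  rfl

end BaseChange

section Reconstruction

variable {M : PhiModule B} {ξ : (B.RI ⊗[FractionRing W] M.fibre) →ₗ[B.RI] (B.RI ⊗[B.R] M.carrier)}
  (hξ : M.IsFrobeniusLift ξ) {D : HodgePink B} (α : M.fibre ≃ₗ[FractionRing W] D.carrier)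

variable (ξ) in
/-- The map `D ⊗ R[1/I] → M[1/I]` that corresponds to a Frobenius lift `ξ` under `D(M) ≃ D`. -/
noncomputable def comparison : (B.RI ⊗[FractionRing W] D.carrier) →ₗ[B.RI]
    (B.RI ⊗[B.R] M.carrier) :=
  ξ ∘ₗ α.symm.toLinearMap.baseChange B.RI

theorem comparison_tmul (b : B.RI) (d : D.carrier) :
    comparison ξ α (b ⊗ₜ d) = b • ξ (1 ⊗ₜ α.symm d) := by
  have h : (b ⊗ₜ d : B.RI ⊗[FractionRing W] D.carrier) = b • (1 ⊗ₜ d) := by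
    rw [TensorProduct.smul_tmul', smul_eq_mul, mul_one]
  rw [h, map_smul]
  rfl

include hξ

theorem comparison_bijective : Function.Bijective (comparison ξ α) := by
  have h : Function.Bijective (α.symm.toLinearMap.baseChange B.RI) := by
    rw [← LinearEquiv.coe_baseChange]
    exact (α.symm.baseChange (FractionRing W) B.RI _ _).bijective
  have hξ : Function.Bijective ξ := ⟨hξ.injective, hξ.surjective⟩
  exact hξ.comp h

theorem comparison_phiRI (hα : ∀ d, α (M.fibrePhi d) = D.phi (α d))
    (x : B.RI ⊗[FractionRing W] D.carrier) :
    comparison ξ α (D.phiRI x) = M.phiRI (comparison ξ α x) := by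
  induction x with
  | zero => simp
  | add x y hx hy => simp only [map_add, hx, hy]
  | tmul b d =>
    have h : α.symm (D.phi d) = M.fibrePhi (α.symm d) := by
      rw [LinearEquiv.symm_apply_eq, hα, LinearEquiv.apply_symm_apply]
    rw [D.phiRI_tmul, map_smul, comparison_tmul, comparison_tmul, map_smulₛₗ, one_smul, h, hξ.2]

omit hξ in
theorem toFr_comparison (x : B.RI ⊗[FractionRing W] D.carrier) :
    M.toFr (comparison ξ α x) = M.frXi ξ (α.symm.toLinearMap.baseChange B.FrS₀ (D.toFr x)) := by
  induction x with
  | zero => simp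
  | add x y hx hy => simp only [map_add, hx, hy]
  | tmul b d =>
    rw [comparison_tmul, D.toFr_tmul, LinearMap.baseChange_tmul, PhiModule.frXi_tmul]
    exact M.toFrSemilinear.map_smulₛₗ b _

omit hξ in
-- The lattice condition says that the image in `M ⊗ Fr(𝔖̂₀)` lies in `M^∧_I`, and `M[1/I] ∩ M^∧_I =
-- M`.
theorem mem_glueing_iff_comparison
    (hL : ∀ x, α.toLinearMap.baseChange B.FrS₀ x ∈ D.lattice ↔ x ∈ M.fibreLattice ξ)
    (x : B.RI ⊗[FractionRing W] D.carrier) :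
    x ∈ D.glueing ↔ comparison ξ α x ∈ LinearMap.range (TensorProduct.mk B.R B.RI M.carrier 1) := by
  rw [D.mem_glueing, ← baseChange_apply_symm α (D.toFr x), hL]
  change M.frXi ξ _ ∈ M.completion ↔ _
  rw [← toFr_comparison]
  constructor
  · intro h
    have h2 := B.mem_span_of_toFrS₀_mem (k := B.R) (N := M.carrier) (comparison ξ α x) h
    rw [← Submodule.span_eq (LinearMap.range (TensorProduct.mk B.R B.RI M.carrier 1))]
    exact h2
  · rintro ⟨m, hm⟩
    rw [← hm, TensorProduct.mk_apply, PhiModule.toFr_tmul, map_one]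
    exact Submodule.subset_span ⟨m, rfl⟩

/-- Both `N` and `M` embed in `M[1/I]`, the former through the glueing and `ξ`, with the same image.
Equivariance of `ξ` makes the resulting isomorphism compatible with the Frobenius maps. -/
theorem IsModification.exists_equiv {N : PhiModule B}
    {ι : N.carrier →ₗ[B.R] (B.RI ⊗[FractionRing W] D.carrier)} (h : IsModification N D ι)
    (hα : ∀ d, α (M.fibrePhi d) = D.phi (α d))
    (hL : ∀ x, α.toLinearMap.baseChange B.FrS₀ x ∈ D.lattice ↔ x ∈ M.fibreLattice ξ) :
    ∃ γ : N.carrier ≃ₗ[B.R] M.carrier, (∀ n, 1 ⊗ₜ γ n = comparison ξ α (ι n)) ∧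
      ∀ n, γ.toLinearMap.baseChange B.RI (N.phi n) = M.phi (γ n) := by
  let j := TensorProduct.mk B.R B.RI M.carrier 1
  have hj : Function.Injective j :=
    TensorProduct.mk_one_injective_of_projective B.algebraMap_RI_injective
  let f : N.carrier →ₗ[B.R] (B.RI ⊗[B.R] M.carrier) := (comparison ξ α).restrictScalars B.R ∘ₗ ι
  have hf : Function.Injective f := (comparison_bijective hξ α).1.comp h.injective
  have hr : LinearMap.range f = LinearMap.range j := by
    ext y
    constructor
    · rintro ⟨n, rfl⟩
      exact (mem_glueing_iff_comparison α hL _).1 (h.range_eq ▸ ⟨n, rfl⟩)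
    · intro hy
      obtain ⟨x, rfl⟩ := (comparison_bijective hξ α).2 y
      have hx := (mem_glueing_iff_comparison α hL x).2 hy
      rw [← h.range_eq] at hx
      obtain ⟨n, rfl⟩ := hx
      exact ⟨n, rfl⟩
  let γ := (LinearEquiv.ofInjective f hf).trans
    ((LinearEquiv.ofEq _ _ hr).trans (LinearEquiv.ofInjective j hj).symm)
  have hγ : ∀ n, 1 ⊗ₜ γ n = comparison ξ α (ι n) := fun n =>
    congrArg Subtype.val ((LinearEquiv.ofInjective j hj).apply_symm_apply _)
  refine ⟨γ, hγ, fun n => ?_⟩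
  have h1 : ∀ y, γ.toLinearMap.baseChange B.RI y = comparison ξ α (ι.liftBaseChange B.RI y) := by
    intro y
    induction y with
    | zero => simp
    | add x y hx hy => simp only [map_add, hx, hy]
    | tmul b n =>
      rw [LinearMap.baseChange_tmul, LinearMap.liftBaseChange_tmul, map_smul, ← hγ,
        TensorProduct.smul_tmul', smul_eq_mul, mul_one]
      rfl
  rw [h1, h.map_phi, comparison_phiRI hξ α hα, ← hγ, PhiModule.phiRI_tmul, map_one, one_smul]

/-- Supplies the naturality in `M` of the isomorphism between the glueing of `D(M)` and `M`. -/
theorem baseChange_comparison {M' : PhiModule B}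
    {ξ' : (B.RI ⊗[FractionRing W] M'.fibre) →ₗ[B.RI] (B.RI ⊗[B.R] M'.carrier)}
    (hξ' : M'.IsFrobeniusLift ξ') {D' : HodgePink B} (α' : M'.fibre ≃ₗ[FractionRing W] D'.carrier)
    (f : M ⟶ M') (g : D.carrier →ₗ[FractionRing W] D'.carrier)
    (hg : ∀ m, g (α (Pullback.unit B.evR m)) = α' (Pullback.unit B.evR (f.hom m)))
    (x : B.RI ⊗[FractionRing W] D.carrier) :
    f.hom.baseChange B.RI (comparison ξ α x) = comparison ξ' α' (g.baseChange B.RI x) := by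
  have h1 : g ∘ₗ α.toLinearMap = α'.toLinearMap ∘ₗ PhiModule.Hom.fibreMap f :=
    (Pullback.isScalarExtension_unit B.evR).hom_ext fun m => by
      change g (α (Pullback.unit B.evR m)) = α' (PhiModule.Hom.fibreMap f (Pullback.unit B.evR m))
      rw [hg, PhiModule.Hom.fibreMap_unit]
  induction x with
  | zero => simp
  | add x y hx hy => simp only [map_add, hx, hy]
  | tmul b d =>
    obtain ⟨d, rfl⟩ := α.surjective d
    have h2 : g (α d) = α' (PhiModule.Hom.fibreMap f d) := LinearMap.congr_fun h1 d
    rw [comparison_tmul, map_smul, LinearMap.baseChange_tmul, comparison_tmul, h2,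
      LinearEquiv.symm_apply_apply, LinearEquiv.symm_apply_apply,
      PhiModule.Hom.baseChange_frobeniusLift f hξ hξ']

end Reconstruction

/-- An isomorphism of Hodge–Pink isocrystals from a linear isomorphism. -/
noncomputable def HodgePink.isoMk {D D' : HodgePink B} (e : D.carrier ≃ₗ[FractionRing W] D'.carrier)
    (he : ∀ d, e (D.phi d) = D'.phi (e d))
    (hL : ∀ x, e.toLinearMap.baseChange B.FrS₀ x ∈ D'.lattice ↔ x ∈ D.lattice) : D ≅ D' where
  hom := ⟨e, he, fun x hx => (hL x).2 hx⟩
  inv := ⟨e.symm, fun d => e.injective (by simp [he]), fun x hx => (hL _).1 (by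
    rwa [baseChange_apply_symm])⟩
  hom_inv_id := HodgePink.Hom.ext (LinearMap.ext e.symm_apply_apply)
  inv_hom_id := HodgePink.Hom.ext (LinearMap.ext e.apply_symm_apply)

/-- An isomorphism of `φ_q`-modules from a linear isomorphism. -/
noncomputable def PhiModule.isoMk {M N : PhiModule B} (e : M.carrier ≃ₗ[B.R] N.carrier)
    (he : ∀ m, e.toLinearMap.baseChange B.RI (M.phi m) = N.phi (e m)) : M ≅ N where
  hom := ⟨e, he⟩
  inv := ⟨e.symm, fun n => by
    obtain ⟨m, rfl⟩ := e.surjective n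
    rw [← he, baseChange_symm_apply]
    exact congrArg M.phi (e.symm_apply_apply m).symm⟩
  hom_inv_id := PhiModule.Hom.ext (LinearMap.ext e.symm_apply_apply)
  inv_hom_id := PhiModule.Hom.ext (LinearMap.ext e.apply_symm_apply)

variable {F : HodgePink B ⥤ PhiModule B} {G : PhiModule B ⥤ HodgePink B}

/-- The functors enter only through their characterizing data, so the result holds for all choices
of them. The component at `D` is `D(M(D)) ≃ D` read through `α`. -/
theorem nonempty_modification_comp_reduction (hF : IsModificationFunctor F)
    (hG : IsReductionFunctor G) : Nonempty (F ⋙ G ≅ 𝟭 (HodgePink B)) := by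
  obtain ⟨ι, hι, hιφ, hιn⟩ := hF
  obtain ⟨α, hα, hL, hαn⟩ := hG
  choose ξ hξ hL using hL
  have h : ∀ D, IsModification (F.obj D) D (ι D) := fun D => ⟨(hι D).1, (hι D).2, hιφ D⟩
  choose β hβ using fun D => (h D).exists_fibreEquiv_unit
  have hL' : ∀ D x, ((α (F.obj D)).symm.trans (β D)).toLinearMap.baseChange B.FrS₀ x ∈ D.lattice ↔
      x ∈ (G.obj (F.obj D)).lattice := fun D x => by
    have h1 : ((α (F.obj D)).symm.trans (β D)).toLinearMap.baseChange B.FrS₀ x =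
        (β D).toLinearMap.baseChange B.FrS₀ ((α (F.obj D)).symm.toLinearMap.baseChange B.FrS₀ x) :=
      LinearMap.congr_fun (LinearMap.baseChange_comp _ _) x
    rw [h1, ← (h D).mem_fibreLattice_iff (hβ D) (hξ _), ← hL, baseChange_apply_symm]
  refine ⟨NatIso.ofComponents (fun D => HodgePink.isoMk ((α (F.obj D)).symm.trans (β D))
    (fun d => ?_) (hL' D)) fun {D D'} f => HodgePink.Hom.ext ?_⟩
  · obtain ⟨d, rfl⟩ := (α (F.obj D)).surjective d
    change (α (F.obj D)).symm.trans (β D) ((G.obj (F.obj D)).phi _) = D.phi _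
    rw [← hα, LinearEquiv.trans_apply, LinearEquiv.trans_apply, LinearEquiv.symm_apply_apply,
      LinearEquiv.symm_apply_apply, (h D).fibreEquiv_fibrePhi (hβ D)]
  · have h1 : ((β D').toLinearMap ∘ₗ (α (F.obj D')).symm.toLinearMap ∘ₗ
          (G.map (F.map f)).hom) ∘ₗ (α (F.obj D)).toLinearMap =
        f.hom ∘ₗ (β D).toLinearMap :=
      (Pullback.isScalarExtension_unit B.evR).hom_ext fun m => by
        change β D' ((α (F.obj D')).symm ((G.map (F.map f)).hom
          (α (F.obj D) (Pullback.unit B.evR m)))) = f.hom (β D (Pullback.unit B.evR m))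
        rw [hαn, LinearEquiv.symm_apply_apply, hβ, hβ, hιn, HodgePink.red_baseChange]
    ext d
    obtain ⟨d, rfl⟩ := (α (F.obj D)).surjective d
    refine (LinearMap.congr_fun h1 d).trans (congrArg (fun y => f.hom (β D y)) ?_)
    exact ((α (F.obj D)).symm_apply_apply d).symm

theorem nonempty_reduction_comp_modification (hF : IsModificationFunctor F)
    (hG : IsReductionFunctor G) : Nonempty (G ⋙ F ≅ 𝟭 (PhiModule B)) := by
  obtain ⟨ι, hι, hιφ, hιn⟩ := hF
  obtain ⟨α, hα, hL, hαn⟩ := hG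
  choose ξ hξ hL using hL
  have h : ∀ D, IsModification (F.obj D) D (ι D) := fun D => ⟨(hι D).1, (hι D).2, hιφ D⟩
  choose γ hγ hγφ using fun M => (h (G.obj M)).exists_equiv (hξ M) (α M) (hα M) (hL M)
  refine ⟨NatIso.ofComponents (fun M => PhiModule.isoMk (γ M) (hγφ M)) fun {M M'} f =>
    PhiModule.Hom.ext (LinearMap.ext fun n => ?_)⟩
  change γ M' ((F.map (G.map f)).hom n) = f.hom (γ M n)
  -- Naturality is tested in `M'[1/I]`, where `γ` is given by the comparison map.
  apply TensorProduct.mk_one_injective_of_projective (M := M'.carrier) B.algebraMap_RI_injective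
  rw [TensorProduct.mk_apply, TensorProduct.mk_apply, hγ, hιn,
    ← baseChange_comparison (hξ M) (α M) (hξ M') (α M') f _ (hαn M M' f), ← hγ,
    LinearMap.baseChange_tmul]

end Modules

end BreuilKisin

theorem mainTheorem8 (p : ℕ) [Fact p.Prime]
    {OE : Type v} {OK : Type w} {W : Type u}
    [CommRing OE] [IsDomain OE] [IsDiscreteValuationRing OE]
    [IsAdicComplete (IsLocalRing.maximalIdeal OE) OE] [Finite (IsLocalRing.ResidueField OE)]
    [CommRing OK] [IsDomain OK] [IsDiscreteValuationRing OK]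
    [IsAdicComplete (IsLocalRing.maximalIdeal OK) OK] [CharZero OK]
    [CharP (IsLocalRing.ResidueField OK) p] [PerfectRing (IsLocalRing.ResidueField OK) p]
    [CommRing W] [IsDomain W] [IsDiscreteValuationRing W]
    [IsAdicComplete (IsLocalRing.maximalIdeal W) W]
    [Algebra OE OK] [Algebra OE W] [Algebra W OK] [IsScalarTower OE W OK]
    (B : BKDatum OE OK W) :
    (∀ M : PhiModule B, ∃! ξ, M.IsFrobeniusLift ξ) ∧
    (∃ F : HodgePink B ⥤ PhiModule B, IsModificationFunctor F) ∧
    (∃ G : PhiModule B ⥤ HodgePink B, IsReductionFunctor G) ∧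
    ∀ (F : HodgePink B ⥤ PhiModule B) (G : PhiModule B ⥤ HodgePink B),
      IsModificationFunctor F → IsReductionFunctor G →
        ∃ e : HodgePink B ≌ PhiModule B, e.functor = F ∧ e.inverse = G := by
  refine ⟨fun M => M.existsUnique_isFrobeniusLift,
    ⟨_, HodgePink.isModificationFunctor_modificationFunctor B⟩,
    ⟨_, PhiModule.isReductionFunctor_reductionFunctor B⟩, fun F G hF hG => ?_⟩
  obtain ⟨η⟩ := nonempty_modification_comp_reduction hF hG
  obtain ⟨ε⟩ := nonempty_reduction_comp_modification hF hG
  -- Only the unit is adjusted to satisfy the triangle identity, so the functor and its inverse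
  -- remain `F` and `G` definitionally.
  exact ⟨CategoryTheory.Equivalence.mk F G η.symm ε, rfl, rfl⟩
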